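/- Let $M$ be a compact smooth ($C^\infty$, Hausdorff) manifold without boundary of dimension $n\ge 3$, and let $U\subseteq M$ be a nonempty open subset. For a smooth Riemannian metric $g$ on $M$, a \emph{limiting Carleman weight} for $g$ on $U$ is a real-valued smooth function $\varphi$ on $U$ with $d\varphi\neq 0$ everywhere on $U$ such that the Poisson bracket $\{\operatorname{Re}p_\varphi,\operatorname{Im}p_\varphi\}$ on $T^*U$ vanishes at every point of $T^*U$ where $p_\varphi=0$; here $p_\varphi(x,\xi)=|\xi|_g^2-|d\varphi|_g^2+2i\langle\xi,d\varphi\rangle_g$ is the semiclassical principal symbol of the conjugated Laplacian $e^{\varphi/h}(-h^2\Delta_g)e^{-\varphi/h}$. Put $k=3$ if $n=3$ and $k=2$ if $n\ge 4$, and endow the set $\mathcal{M}$ of all smooth Riemannian metrics on $M$ with the $C^k$ topology (uniform convergence on compact subsets of coordinate charts of the metric coefficients and of their partial derivatives of order at most $k$). Then the set of metrics $g\in\mathcal{M}$ for which no limiting Carleman weight exists on $U$ contains a subset that is open and dense in $\mathcal{M}$. -/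

import Mathlib

open scoped Manifold ContDiff Topology UniformConvergence

noncomputable section

namespace CarlemanWeights

/-- The coordinate space `ℝⁿ` with its Euclidean norm. -/
abbrev Coord (n : ℕ) : Type := EuclideanSpace ℝ (Fin n)

/-- The `i`-th partial derivative of `f` at `x`. -/
def partialDeriv {n : ℕ} (i : Fin n) (f : Coord n → ℝ) (x : Coord n) : ℝ :=
  fderiv ℝ f x (EuclideanSpace.single i 1)

/-- The Poisson bracket `∑ i, (∂a/∂ξᵢ ∂b/∂xᵢ - ∂a/∂xᵢ ∂b/∂ξᵢ)` in canonical coordinates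
`(x, ξ)` of a cotangent bundle. -/
def poissonBracket {n : ℕ} (a b : Coord n → Coord n → ℝ) (x ξ : Coord n) : ℝ :=
  ∑ i, (partialDeriv i (fun η => a x η) ξ * partialDeriv i (fun y => b y ξ) x
    - partialDeriv i (fun y => a y ξ) x * partialDeriv i (fun η => b x η) ξ)

section

variable (n : ℕ) (M : Type*) [TopologicalSpace M] [ChartedSpace (Coord n) M]
  [IsManifold (𝓡 n) ∞ M]

/-- Smooth Riemannian metrics on the manifold `M`. -/
abbrev SmoothMetric : Type _ :=
  Bundle.ContMDiffRiemannianMetric (𝓡 n) ∞ (Coord n) (TangentSpace (𝓡 n) : M → Type _)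

variable {n M}

/-- The coordinate vector field `∂ᵢ` of the chart `e`, at the point with coordinates `y`. -/
def coordVector (e : OpenPartialHomeomorph M (Coord n)) (i : Fin n) (y : Coord n) :
    TangentSpace (𝓡 n) (e.symm y) :=
  mfderiv (𝓡 n) (𝓡 n) e.symm y (EuclideanSpace.single i (1 : ℝ) : Coord n)

/-- The matrix `(gᵢⱼ)` of `g` in the chart `e`, as a function of the coordinates. It is meaningful
on `e.target`. -/
def metricMatrix (g : SmoothMetric n M) (e : OpenPartialHomeomorph M (Coord n)) (y : Coord n) :
    Matrix (Fin n) (Fin n) ℝ :=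
  Matrix.of fun i j => g.inner (e.symm y) (coordVector e i y) (coordVector e j y)

variable (n M) in
/-- The `C^k` topology on smooth metrics: uniform convergence, on every compact subset of every
chart of the smooth structure, of the derivatives of order at most `k` of all the coefficients. -/
@[reducible]
def ckTopology (k : ℕ) : TopologicalSpace (SmoothMetric n M) :=
  ⨅ (e : OpenPartialHomeomorph M (Coord n)) (_ : e ∈ IsManifold.maximalAtlas (𝓡 n) ∞ M)
    (i : Fin n) (j : Fin n) (m : ℕ) (_ : m ≤ k),
    TopologicalSpace.induced
      (fun g : SmoothMetric n M =>
        UniformOnFun.ofFun {K : Set (Coord n) | IsCompact K ∧ K ⊆ e.target}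
          (iteratedFDeriv ℝ m fun y => metricMatrix g e y i j))
      inferInstance

/-- In the chart `e`, the semiclassical principal symbol
`|ξ|² - |dφ|² + 2 i ⟨ξ, dφ⟩` of the conjugated Laplacian `e^{φ/h} (-h² Δ_g) e^{-φ/h}`; norms and
products of covectors are taken with the inverse matrix `(gⁱʲ)`. -/
def conjugatedSymbol (g : SmoothMetric n M) (φ : M → ℝ) (e : OpenPartialHomeomorph M (Coord n))
    (x ξ : Coord n) : ℂ :=
  let G := (metricMatrix g e x)⁻¹
  let dφ := fun i => partialDeriv i (fun y => φ (e.symm y)) x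
  ⟨∑ i, ∑ j, G i j * (ξ i * ξ j - dφ i * dφ j), 2 * ∑ i, ∑ j, G i j * (ξ i * dφ j)⟩

/-- `φ` is a limiting Carleman weight on the open set `U` for the metric `g`: it is smooth and
without critical points on `U`, and `{Re p, Im p} = 0` wherever `p = 0` on the cotangent bundle
of `U`, for the symbol `p` of the conjugated Laplacian (equivalently `{p̄, p} = 2i {Re p, Im p}`
vanishes there). The values of `φ` outside `U` play no role. -/
structure IsLimitingCarlemanWeight (g : SmoothMetric n M) (U : Set M) (φ : M → ℝ) : Prop where
  smooth : ContMDiffOn (𝓡 n) 𝓘(ℝ, ℝ) ∞ φ U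
  noncritical : ∀ q ∈ U, mfderiv (𝓡 n) 𝓘(ℝ, ℝ) φ q ≠ 0
  bracket : ∀ e ∈ IsManifold.maximalAtlas (𝓡 n) ∞ M, ∀ q ∈ U ∩ e.source, ∀ ξ : Coord n,
    conjugatedSymbol g φ e (e q) ξ = 0 →
      poissonBracket (fun x η => (conjugatedSymbol g φ e x η).re)
        (fun x η => (conjugatedSymbol g φ e x η).im) (e q) ξ = 0

end

end CarlemanWeights

end

/-! A limiting Carleman weight forces an algebraic condition on the jet of the metric at each point
of U, and a generic jet violates it. A single point of U is enough.

Let V be the gradient of φ and H its Hessian. The bracket at ξ equals 4(H(X,X) + H(V,V)), where X is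
the vector dual to ξ, and p_φ = 0 says that X is orthogonal to V and as long as V. This determines H
on the orthogonal complement of V, and ∇V takes the form recorded in `IsCarlemanField`: for the
conformal metric |dφ|²g the gradient of φ is a parallel unit field. Commuting second derivatives of
V then gives R(c,a)V explicitly (`curvature_field`). For n ≥ 4 it follows that g(R(a,b)V,c) = 0
whenever V, a, b, c are mutually orthogonal. In dimension three there is no room for such vectors.
One more covariant derivative yields instead a relation between components of ∇R (`cotton_eq_zero`),
which involves third derivatives of g; hence k = 3.

Thus an obstruction, defined on orthonormal frames at the point, vanishes on all frames whose first
vector lies along V (`HasDegenerateFrame`). Having no such direction is an open condition on g,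
because orthonormal frames stay in a compact set and the obstruction is continuous in the jet and
the frame (`isOpen_not_hasDegenerateFrame`).

Density is a dimension count. Add to g a symmetric form whose coefficients are homogeneous
polynomials of degree 2 (or 3 if n = 3) with coefficient tensor s. The lower jet is unchanged, and
the obstruction in the frame Q F₀ changes by a linear functional ℓ of the tensor s rotated by Q.
There are n frames with a common first direction for which these functionals are independent
(`exists_linearIndependent_weylFunctional`, `exists_linearIndependent_cottonFunctional`). For a
given direction the bad tensors s therefore lie in an affine subspace of codimension n. Directions
have n - 1 parameters, so the bad tensors have Hausdorff dimension less than that of the whole space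
(`dense_setOf_frame_ne_zero`). Good s exist arbitrarily close to 0. Bump functions make the
perturbation global, and compactness of M keeps it a metric and makes it small in C^k. -/

noncomputable section

namespace CarlemanWeights

/-! ### Rotated tensors, reflections and the dimension count -/

section FrameAction

open Matrix

variable {n r : ℕ}

/-- The components, in the frame given by the rows of `Q`, of the covariant tensor with
components `s`. -/
def frameAct (Q : Matrix (Fin n) (Fin n) ℝ) :
    ((Fin r → Fin n) → ℝ) →ₗ[ℝ] ((Fin r → Fin n) → ℝ) where
  toFun s I := ∑ K, s K * ∏ k, Q (I k) (K k)
  map_add' s t := by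
    ext I
    simp [add_mul, Finset.sum_add_distrib]
  map_smul' c s := by
    ext I
    simp [Finset.mul_sum, mul_assoc]

lemma frameAct_apply (Q : Matrix (Fin n) (Fin n) ℝ) (s : (Fin r → Fin n) → ℝ)
    (I : Fin r → Fin n) : frameAct Q s I = ∑ K, s K * ∏ k, Q (I k) (K k) := rfl

lemma frameAct_mul (P Q : Matrix (Fin n) (Fin n) ℝ) (s : (Fin r → Fin n) → ℝ) :
    frameAct (P * Q) s = frameAct P (frameAct Q s) := by
  ext I
  simp only [frameAct_apply, Matrix.mul_apply, Finset.prod_univ_sum, Fintype.piFinset_univ,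
    Finset.prod_mul_distrib, Finset.mul_sum, Finset.sum_mul]
  rw [Finset.sum_comm]
  refine Finset.sum_congr rfl fun K _ => Finset.sum_congr rfl fun J _ => ?_
  ring

lemma frameAct_one (s : (Fin r → Fin n) → ℝ) : frameAct 1 s = s := by
  ext I
  rw [frameAct_apply, Finset.sum_eq_single I]
  · simp
  · intro K _ hK
    obtain ⟨k, hk⟩ := Function.ne_iff.1 hK
    rw [Finset.prod_eq_zero (Finset.mem_univ k), mul_zero]
    rw [Matrix.one_apply_ne (Ne.symm hk)]
  · simp

/-- The matrix of the reflection in the hyperplane orthogonal to `w`. -/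
def reflectionMatrix (w : Fin n → ℝ) : Matrix (Fin n) (Fin n) ℝ :=
  Matrix.of fun i j => (if i = j then 1 else 0) - 2 / (w ⬝ᵥ w) * (w i * w j)

lemma reflectionMatrix_eq (w : Fin n → ℝ) :
    reflectionMatrix w = 1 - (2 / (w ⬝ᵥ w)) • vecMulVec w w := by
  ext i j
  simp [reflectionMatrix, Matrix.one_apply, vecMulVec_apply]

lemma reflectionMatrix_smul {t : ℝ} (ht : t ≠ 0) (w : Fin n → ℝ) :
    reflectionMatrix (t • w) = reflectionMatrix w := by
  ext i j
  simp only [reflectionMatrix, Matrix.of_apply, dotProduct_smul, smul_dotProduct, smul_eq_mul,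
    Pi.smul_apply]
  by_cases h : w ⬝ᵥ w = 0
  · simp [h]
  · field_simp

lemma reflectionMatrix_transpose (w : Fin n → ℝ) :
    (reflectionMatrix w)ᵀ = reflectionMatrix w := by
  ext i j
  simp [reflectionMatrix, eq_comm, mul_comm]

lemma reflectionMatrix_mul_self {w : Fin n → ℝ} (hw : w ≠ 0) :
    reflectionMatrix w * reflectionMatrix w = 1 := by
  have h : w ⬝ᵥ w ≠ 0 := by simpa using hw
  rw [reflectionMatrix_eq, sub_mul, mul_sub, mul_sub, one_mul, mul_one, one_mul, smul_mul_smul,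
    vecMulVec_mul_vecMulVec, vecMulVec_smul, smul_smul]
  have h2 : 2 / (w ⬝ᵥ w) * (2 / (w ⬝ᵥ w)) * (w ⬝ᵥ w) = 2 * (2 / (w ⬝ᵥ w)) := by
    field_simp
  rw [h2]
  module

/-- Every unit vector is, up to sign, a row of a reflection matrix. -/
lemma exists_reflectionMatrix_row (i₀ : Fin n) (u : Fin n → ℝ) (hu : u ⬝ᵥ u = 1) :
    ∃ w : Fin n → ℝ, w ≠ 0 ∧ (reflectionMatrix w i₀ = u ∨ reflectionMatrix w i₀ = -u) := by
  -- The reflection along e - u exchanges the unit vectors e and u. It degenerates when u = e; then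
  -- the reflection along u itself is used, and it produces -u.
  by_cases h : u = Pi.single i₀ 1
  · refine ⟨u, by rintro rfl; simp at hu, Or.inr ?_⟩
    ext j
    simp only [reflectionMatrix, Matrix.of_apply, hu, Pi.neg_apply]
    subst h
    by_cases hj : i₀ = j
    · subst hj; norm_num
    · simp [hj, Ne.symm hj]
  · refine ⟨Pi.single i₀ 1 - u, fun h0 => h (sub_eq_zero.1 h0).symm, Or.inl ?_⟩
    have hw : (Pi.single i₀ 1 - u) ⬝ᵥ (Pi.single i₀ 1 - u) = 2 * (1 - u i₀) := by
      simp [sub_dotProduct, dotProduct_sub, hu]; ring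
    have hne : (1 - u i₀) ≠ 0 := by
      intro h0
      rw [h0, mul_zero, dotProduct_self_eq_zero] at hw
      exact h (sub_eq_zero.1 hw).symm
    ext j
    simp only [reflectionMatrix, Matrix.of_apply, hw, Pi.sub_apply, Pi.single_eq_same]
    by_cases hj : i₀ = j
    · subst hj; simp; field_simp; ring
    · simp [hj, Ne.symm hj]; field_simp

lemma contDiff_frameAct {G : Type*} [NormedAddCommGroup G] [NormedSpace ℝ G]
    {Q : G → Matrix (Fin n) (Fin n) ℝ} (hQ : ∀ i j, ContDiff ℝ 1 fun x => Q x i j)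
    {s : G → (Fin r → Fin n) → ℝ} (hs : ContDiff ℝ 1 s) :
    ContDiff ℝ 1 fun x => frameAct (Q x) (s x) := by
  rw [contDiff_pi]
  intro I
  simp only [frameAct_apply]
  refine ContDiff.sum fun K _ => ?_
  exact ((contDiff_pi.1 hs) K).mul (contDiff_prod fun k _ => hQ _ _)

lemma contDiff_reflectionMatrix {G : Type*} [NormedAddCommGroup G] [NormedSpace ℝ G]
    {w : G → Fin n → ℝ} (hw : ContDiff ℝ 1 w) (h0 : ∀ x, w x ≠ 0) (i j : Fin n) :
    ContDiff ℝ 1 fun x => reflectionMatrix (w x) i j := by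
  have hwi := contDiff_pi.1 hw
  simp only [reflectionMatrix, Matrix.of_apply]
  refine contDiff_const.sub ((contDiff_const.div ?_ fun x => ?_).mul ((hwi i).mul (hwi j)))
  · simp only [dotProduct]
    exact ContDiff.sum fun k _ => (hwi k).mul (hwi k)
  · simpa using h0 x

lemma orthogonal_row_dotProduct {Q : Matrix (Fin n) (Fin n) ℝ} (hQ : Q * Qᵀ = 1) (i j : Fin n) :
    Q i ⬝ᵥ Q j = if i = j then 1 else 0 := by
  have := congrFun (congrFun hQ i) j
  rw [Matrix.one_apply] at this
  rw [← this]
  rfl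

/-- Transversality for frames. Let `c Q + ℓ (frameAct Q s)` be a family of affine functions of the
tensor `s`, indexed by the orthogonal matrices `Q`. If the linear parts at `n` suitable matrices
with the same first row direction are independent, then for a dense set of tensors `s` and
every `Q`, the value is non-zero at some `P * Q` whose row `i₀` is parallel to that of `Q`. -/
theorem dense_setOf_frame_ne_zero (i₀ : Fin n) (c : (Fin n → Fin n → ℝ) → ℝ)
    (hc : ContDiff ℝ 1 c) (ℓ : ((Fin r → Fin n) → ℝ) →ₗ[ℝ] ℝ)
    (P : Fin n → Matrix (Fin n) (Fin n) ℝ) (hP : ∀ p, P p * (P p)ᵀ = 1)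
    (hP₀ : ∀ p j, j ≠ i₀ → P p i₀ j = 0)
    (hli : LinearIndependent ℝ fun p => ℓ ∘ₗ frameAct (P p)) :
    Dense {s : (Fin r → Fin n) → ℝ | ∀ Q : Matrix (Fin n) (Fin n) ℝ, Q * Qᵀ = 1 →
      ∃ R : Matrix (Fin n) (Fin n) ℝ, R * Rᵀ = 1 ∧ (∀ j, j ≠ i₀ → R i₀ j = 0) ∧
        c (R * Q) + ℓ (frameAct (R * Q) s) ≠ 0} := by
  classical
  set S := (Fin r → Fin n) → ℝ
  -- The n conditions at the frames `P p`, gathered in one map. Independence of its components means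
  -- surjectivity: a functional killing the range would be a linear relation.
  let L : S →ₗ[ℝ] (Fin n → ℝ) := LinearMap.pi fun p => ℓ ∘ₗ frameAct (P p)
  have hL : Function.Surjective L := by
    rw [← LinearMap.range_eq_top]
    by_contra hne
    obtain ⟨f, hf0, hf⟩ := Submodule.exists_le_ker_of_lt_top _ (lt_top_iff_ne_top.2 hne)
    have h1 : ∑ p, f (Pi.single p 1) • (ℓ ∘ₗ frameAct (P p)) = 0 := by
      refine LinearMap.ext fun s => ?_
      have h2 : f (L s) = 0 := hf ⟨s, rfl⟩
      rw [LinearMap.pi_apply_eq_sum_univ f] at h2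
      simp only [LinearMap.coe_sum, Finset.sum_apply, LinearMap.smul_apply, LinearMap.zero_apply]
      rw [← h2]
      refine Finset.sum_congr rfl fun p _ => ?_
      have h3 : (fun j => if p = j then 1 else 0 : Fin n → ℝ) = Pi.single p 1 := by
        ext j
        simp [Pi.single_apply, eq_comm]
      rw [h3, smul_eq_mul, smul_eq_mul, mul_comm]
      rfl
    have h3 := Fintype.linearIndependent_iff.1 hli _ h1
    refine hf0 (LinearMap.pi_ext fun p x => ?_)
    have : (Pi.single p x : Fin n → ℝ) = x • Pi.single p 1 := by
      rw [← Pi.single_smul, smul_eq_mul, mul_one]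
    rw [this, map_smul, h3 p]
    simp
  obtain ⟨τ, hτ⟩ := L.exists_rightInverse_of_surjective (LinearMap.range_eq_top.2 hL)
  have hτ' : ∀ v, L (τ v) = v := fun v => LinearMap.congr_fun hτ v
  -- A direction is represented by a reflection vector. Since the reflection depends only on the
  -- line of that vector, one coordinate can be normalized to 1, which leaves n - 1 parameters in `W
  -- i`.
  let K := LinearMap.ker L
  let W : Fin n → Submodule ℝ (Fin n → ℝ) := fun i =>
    LinearMap.ker (LinearMap.proj i : (Fin n → ℝ) →ₗ[ℝ] ℝ)
  let w : ∀ i, W i × K → Fin n → ℝ := fun i x => Pi.single i 1 + (x.1 : Fin n → ℝ)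
  have hw : ∀ i x, w i x i = 1 := by
    intro i x
    have : (x.1 : Fin n → ℝ) i = 0 := x.1.2
    simp [w, this]
  have hw0 : ∀ i x, w i x ≠ 0 := fun i x h => by
    have := hw i x
    rw [h] at this
    simp at this
  -- With ρ the reflection, vanishing at all `P p * ρ` means L(ρ s) = -c, that is ρ s = k - τ(c)
  -- with k in ker L. Since ρ is an involution, s = ρ(k - τ(c)). The parameters number (n - 1) +
  -- (dim S - n).
  let Φ : ∀ i, W i × K → S := fun i x =>
    frameAct (reflectionMatrix (w i x))
      ((x.2 : S) - τ fun p => c (P p * reflectionMatrix (w i x)))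
  have hrefl : ∀ i a b, ContDiff ℝ 1 fun x => reflectionMatrix (w i x) a b := by
    intro i a b
    refine contDiff_reflectionMatrix ?_ (hw0 i) a b
    exact contDiff_const.add ((W i).subtypeL.contDiff.comp contDiff_fst)
  have hΦ : ∀ i, ContDiff ℝ 1 (Φ i) := by
    intro i
    refine contDiff_frameAct (hrefl i) (ContDiff.sub (K.subtypeL.contDiff.comp contDiff_snd) ?_)
    refine (LinearMap.toContinuousLinearMap τ).contDiff.comp ?_
    rw [contDiff_pi]
    intro p
    refine hc.comp (contDiff_pi.2 fun a => contDiff_pi.2 fun b => ?_)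
    simp only [Matrix.mul_apply]
    exact ContDiff.sum fun k _ => contDiff_const.mul (hrefl i k b)
  have hfin : ∀ i, Module.finrank ℝ (W i × K) < Module.finrank ℝ S := by
    intro i
    have h1 := LinearMap.finrank_range_add_finrank_ker L
    rw [LinearMap.range_eq_top.2 hL, finrank_top, Module.finrank_fin_fun] at h1
    have h2 := LinearMap.finrank_range_add_finrank_ker (LinearMap.proj i : (Fin n → ℝ) →ₗ[ℝ] ℝ)
    rw [LinearMap.range_eq_top.2 (LinearMap.proj_surjective i), finrank_top,
      Module.finrank_fin_fun, Module.finrank_self] at h2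
    rw [Module.finrank_prod]
    change Module.finrank ℝ (W i) + Module.finrank ℝ K < Module.finrank ℝ S
    change 1 + Module.finrank ℝ (W i) = n at h2
    change n + Module.finrank ℝ K = Module.finrank ℝ S at h1
    omega
  have hdim : dimH (⋃ i, Set.range (Φ i)) < Module.finrank ℝ S := by
    rw [dimH_iUnion]
    have : Nonempty (Fin n) := ⟨i₀⟩
    obtain ⟨i, hi⟩ := exists_eq_ciSup_of_finite (f := fun i => dimH (Set.range (Φ i)))
    rw [← hi]
    exact ((hΦ i).dimH_range_le).trans_lt (by exact_mod_cast hfin i)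
  refine (dense_compl_of_dimH_lt_finrank hdim).mono ?_
  intro s hs Q hQ
  by_contra hcon
  push Not at hcon
  apply hs
  -- Only the direction of row `i₀` of `Q` matters, so `Q` can be replaced by a reflection having
  -- that row up to sign. Row `i₀` of ρQᵀ is then supported on the diagonal.
  obtain ⟨w₀, hw₀, hrow⟩ := exists_reflectionMatrix_row i₀ (Q i₀)
    (by rw [orthogonal_row_dotProduct hQ, if_pos rfl])
  obtain ⟨i, hi⟩ := Function.ne_iff.1 hw₀
  rw [Pi.zero_apply] at hi
  set ρ := reflectionMatrix w₀ with hρ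
  have hρρ : ρ * ρ = 1 := reflectionMatrix_mul_self hw₀
  have hρt : ρᵀ = ρ := reflectionMatrix_transpose w₀
  have hQ' : Qᵀ * Q = 1 := mul_eq_one_comm.1 hQ
  have key : ∀ p, c (P p * ρ) + ℓ (frameAct (P p) (frameAct ρ s)) = 0 := by
    intro p
    have h := hcon (P p * (ρ * Qᵀ)) ?_ ?_
    · rwa [mul_assoc, mul_assoc, hQ', mul_one, frameAct_mul] at h
    · rw [transpose_mul, transpose_mul, transpose_transpose, hρt]
      calc P p * (ρ * Qᵀ) * (Q * ρ * (P p)ᵀ) = P p * (ρ * (Qᵀ * Q) * ρ) * (P p)ᵀ := by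
            simp only [mul_assoc]
        _ = 1 := by rw [hQ', mul_one, hρρ, mul_one, hP]
    · intro j hj
      rw [Matrix.mul_apply, Finset.sum_eq_single i₀]
      · have : (ρ * Qᵀ) i₀ j = 0 := by
          have h1 : (ρ * Qᵀ) i₀ j = ρ i₀ ⬝ᵥ Q j := rfl
          rw [h1]
          rcases hrow with h | h
          · rw [h, orthogonal_row_dotProduct hQ, if_neg (Ne.symm hj)]
          · rw [h, neg_dotProduct, orthogonal_row_dotProduct hQ, if_neg (Ne.symm hj), neg_zero]
        rw [this, mul_zero]
      · intro k _ hk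
        rw [hP₀ p k hk, zero_mul]
      · simp
  refine Set.mem_iUnion.2 ⟨i, ?_⟩
  have hwi : (w₀ i)⁻¹ • w₀ - Pi.single i 1 ∈ W i := by
    simp [W, hi]
  let k : S := frameAct ρ s + τ fun p => c (P p * ρ)
  have hk : k ∈ K := by
    rw [LinearMap.mem_ker, map_add, hτ']
    ext p
    have := key p
    simp only [Pi.add_apply, Pi.zero_apply, L, LinearMap.pi_apply, LinearMap.comp_apply]
    linarith
  refine ⟨(⟨_, hwi⟩, ⟨k, hk⟩), ?_⟩
  have hwe : w i (⟨_, hwi⟩, ⟨k, hk⟩) = (w₀ i)⁻¹ • w₀ := by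
    simp [w]
  change frameAct (reflectionMatrix (w i _)) (k - τ fun p => c (P p * reflectionMatrix (w i _))) = s
  rw [hwe, reflectionMatrix_smul (inv_ne_zero hi), ← hρ]
  simp only [k, add_sub_cancel_right]
  rw [← frameAct_mul, hρρ, frameAct_one]

end FrameAction

end CarlemanWeights

end

noncomputable section

namespace CarlemanWeights

set_option maxSynthPendingDepth 3

/-! ### Levi-Civita connection and curvature on an open set of a vector space -/

section Calculus

variable {E F G H : Type*} [NormedAddCommGroup E] [NormedSpace ℝ E] [NormedAddCommGroup F]
  [NormedSpace ℝ F] [NormedAddCommGroup G] [NormedSpace ℝ G] [NormedAddCommGroup H]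
  [NormedSpace ℝ H]

lemma fderiv_clm_apply_apply {f : E → F →L[ℝ] G} {u : E → F} {x : E}
    (hf : DifferentiableAt ℝ f x) (hu : DifferentiableAt ℝ u x) (c : E) :
    fderiv ℝ (fun y => f y (u y)) x c = fderiv ℝ f x c (u x) + f x (fderiv ℝ u x c) := by
  rw [fderiv_clm_apply hf hu]
  simp [add_comm]

lemma fderiv_clm_apply_const {f : E → F →L[ℝ] G} {x : E}
    (hf : DifferentiableAt ℝ f x) (u : F) (c : E) :
    fderiv ℝ (fun y => f y u) x c = fderiv ℝ f x c u := by
  rw [fderiv_clm_apply_apply hf (differentiableAt_const u)]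
  simp

lemma fderiv_clm_apply₂ {f : E → F →L[ℝ] G →L[ℝ] H} {u : E → F} {w : E → G} {x : E}
    (hf : DifferentiableAt ℝ f x) (hu : DifferentiableAt ℝ u x) (hw : DifferentiableAt ℝ w x)
    (c : E) : fderiv ℝ (fun y => f y (u y) (w y)) x c =
      fderiv ℝ f x c (u x) (w x) + f x (fderiv ℝ u x c) (w x) + f x (u x) (fderiv ℝ w x c) := by
  rw [fderiv_clm_apply_apply (hf.clm_apply hu) hw, fderiv_clm_apply_apply hf hu]
  simp

lemma _root_.ContDiffOn.differentiableAt_of_mem {f : E → F} {Ω : Set E}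
    (hf : ContDiffOn ℝ ∞ f Ω) (hΩ : IsOpen Ω) {x : E} (hx : x ∈ Ω) : DifferentiableAt ℝ f x :=
  (hf.contDiffAt (hΩ.mem_nhds hx)).differentiableAt (by simp)

lemma _root_.ContDiffOn.fderiv_infty {f : E → F} {Ω : Set E}
    (hf : ContDiffOn ℝ ∞ f Ω) (hΩ : IsOpen Ω) : ContDiffOn ℝ ∞ (fderiv ℝ f) Ω :=
  hf.fderiv_of_isOpen hΩ (by simp)

lemma _root_.ContDiffOn.fderiv_fderiv_comm {f : E → F} {Ω : Set E}
    (hf : ContDiffOn ℝ ∞ f Ω) (hΩ : IsOpen Ω) {x : E} (hx : x ∈ Ω) (a b : E) :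
    fderiv ℝ (fderiv ℝ f) x a b = fderiv ℝ (fderiv ℝ f) x b a :=
  ((hf.contDiffAt (hΩ.mem_nhds hx)).isSymmSndFDerivAt
    (by simp only [minSmoothness_of_isRCLikeNormedField]; exact ENat.LEInfty.out)) a b

lemma fderiv_congr_of_isOpen {f₁ f₂ : E → F} {Ω : Set E} (hΩ : IsOpen Ω) {x : E} (hx : x ∈ Ω)
    (h : ∀ y ∈ Ω, f₁ y = f₂ y) : fderiv ℝ f₁ x = fderiv ℝ f₂ x :=
  Filter.EventuallyEq.fderiv_eq (Filter.eventually_of_mem (hΩ.mem_nhds hx) h)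

/-- The Christoffel symbols of the first kind, in terms of the first derivative of a metric. -/
def christoffel (g₁ : E →L[ℝ] E →L[ℝ] E →L[ℝ] ℝ) (a b c : E) : ℝ :=
  (g₁ a b c + g₁ b a c - g₁ c a b) / 2

/-- `Γ` is the Levi-Civita connection of the metric `g`, both smooth on the open set `Ω`. -/
structure IsLeviCivitaOn (Ω : Set E) (g : E → E →L[ℝ] E →L[ℝ] ℝ) (Γ : E → E →L[ℝ] E →L[ℝ] E) :
    Prop where
  isOpen : IsOpen Ω
  metric_smooth : ContDiffOn ℝ ∞ g Ω
  smooth : ContDiffOn ℝ ∞ Γ Ω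
  metric_symm : ∀ x ∈ Ω, ∀ a b, g x a b = g x b a
  nondegenerate : ∀ x ∈ Ω, ∀ a, (∀ b, g x a b = 0) → a = 0
  metric_apply : ∀ x ∈ Ω, ∀ a b c, g x (Γ x a b) c = christoffel (fderiv ℝ g x) a b c

/-- The curvature operator of the connection with Christoffel symbols `Γ`. -/
def curvature (Γ : E → E →L[ℝ] E →L[ℝ] E) (x c a : E) : E →L[ℝ] E :=
  fderiv ℝ Γ x c a - fderiv ℝ Γ x a c + (Γ x c).comp (Γ x a) - (Γ x a).comp (Γ x c)

/-- The covariant derivative of the curvature operator. -/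
def covCurvature (Γ : E → E →L[ℝ] E →L[ℝ] E) (x y c a z : E) : E :=
  fderiv ℝ (fun x' => curvature Γ x' c a) x y z + Γ x y (curvature Γ x c a z)
    - curvature Γ x (Γ x y c) a z - curvature Γ x c (Γ x y a) z - curvature Γ x c a (Γ x y z)

lemma curvature_apply (Γ : E → E →L[ℝ] E →L[ℝ] E) (x c a z : E) :
    curvature Γ x c a z = fderiv ℝ Γ x c a z - fderiv ℝ Γ x a c z + Γ x c (Γ x a z)
      - Γ x a (Γ x c z) := rfl

lemma curvature_swap (Γ : E → E →L[ℝ] E →L[ℝ] E) (x c a z : E) :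
    curvature Γ x c a z = - curvature Γ x a c z := by
  simp only [curvature_apply]
  abel

namespace IsLeviCivitaOn

variable {Ω : Set E} {g : E → E →L[ℝ] E →L[ℝ] ℝ} {Γ : E → E →L[ℝ] E →L[ℝ] E}

lemma metric_ext (h : IsLeviCivitaOn Ω g Γ) {x : E} (hx : x ∈ Ω) {a b : E}
    (hab : ∀ c, g x a c = g x b c) : a = b := by
  rw [← sub_eq_zero]
  refine h.nondegenerate x hx _ fun c => ?_
  rw [map_sub, sub_apply, hab, sub_self]

lemma fderiv_metric_symm (h : IsLeviCivitaOn Ω g Γ) {x : E} (hx : x ∈ Ω) (u a b : E) :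
    fderiv ℝ g x u a b = fderiv ℝ g x u b a := by
  have hd := h.metric_smooth.differentiableAt_of_mem h.isOpen hx
  rw [← fderiv_clm_apply_const hd, ← fderiv_clm_apply_const hd,
    ← fderiv_clm_apply_const (hd.clm_apply (differentiableAt_const _)),
    ← fderiv_clm_apply_const (hd.clm_apply (differentiableAt_const _))]
  exact congrFun (congrArg _ (fderiv_congr_of_isOpen h.isOpen hx fun y hy => h.metric_symm y hy _ _)) _

lemma symm (h : IsLeviCivitaOn Ω g Γ) {x : E} (hx : x ∈ Ω) (a b : E) : Γ x a b = Γ x b a := by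
  refine h.metric_ext hx fun c => ?_
  rw [h.metric_apply x hx, h.metric_apply x hx, christoffel, christoffel,
    h.fderiv_metric_symm hx c a b]
  ring

lemma fderiv_metric (h : IsLeviCivitaOn Ω g Γ) {x : E} (hx : x ∈ Ω) (u a b : E) :
    fderiv ℝ g x u a b = g x (Γ x u a) b + g x a (Γ x u b) := by
  rw [h.metric_symm x hx a, h.metric_apply x hx, h.metric_apply x hx, christoffel, christoffel,
    h.fderiv_metric_symm hx u b a, h.fderiv_metric_symm hx a u b, h.fderiv_metric_symm hx b u a]
  ring

lemma fderiv_fderiv_metric_symm (h : IsLeviCivitaOn Ω g Γ) {x : E} (hx : x ∈ Ω) (u w a b : E) :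
    fderiv ℝ (fderiv ℝ g) x u w a b = fderiv ℝ (fderiv ℝ g) x u w b a := by
  have hd := (h.metric_smooth.fderiv_infty h.isOpen).differentiableAt_of_mem h.isOpen hx
  have hd1 := hd.clm_apply (differentiableAt_const w)
  rw [← fderiv_clm_apply_const hd, ← fderiv_clm_apply_const hd1, ← fderiv_clm_apply_const hd1,
    ← fderiv_clm_apply_const (hd1.clm_apply (differentiableAt_const _)),
    ← fderiv_clm_apply_const (hd1.clm_apply (differentiableAt_const _))]
  exact congrFun (congrArg _ (fderiv_congr_of_isOpen h.isOpen hx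
    fun y hy => h.fderiv_metric_symm hy _ _ _)) _

lemma fderiv_christoffel (h : IsLeviCivitaOn Ω g Γ) {x : E} (hx : x ∈ Ω) (u a b c : E) :
    fderiv ℝ (fun x => christoffel (fderiv ℝ g x) a b c) x u
      = christoffel (fderiv ℝ (fderiv ℝ g) x u) a b c := by
  have hd := (h.metric_smooth.fderiv_infty h.isOpen).differentiableAt_of_mem h.isOpen hx
  have key : ∀ a b c, HasFDerivAt (fun x => fderiv ℝ g x a b c)
      (fderiv ℝ (fun x => fderiv ℝ g x a b c) x) x := fun a b c => by
    refine DifferentiableAt.hasFDerivAt ?_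
    fun_prop
  have hval : ∀ a b c, fderiv ℝ (fun x => fderiv ℝ g x a b c) x u
      = fderiv ℝ (fderiv ℝ g) x u a b c := fun a b c => by
    rw [fderiv_clm_apply_const (by fun_prop), fderiv_clm_apply_const (by fun_prop),
      fderiv_clm_apply_const hd]
  have hh := ((((key a b c).add (key b a c)).sub (key c a b)).mul_const (1 / 2 : ℝ)).fderiv
  have : (fun x => christoffel (fderiv ℝ g x) a b c)
      = fun x => (fderiv ℝ g x a b c + fderiv ℝ g x b a c - fderiv ℝ g x c a b) * (1 / 2 : ℝ) := by
    ext; simp only [christoffel]; ring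
  rw [this]
  refine (congrFun (congrArg _ hh) u).trans ?_
  simp only [smul_apply, sub_apply, add_apply, smul_eq_mul, hval, christoffel]
  ring

/-- Differentiating the relation that defines Γ trades ∂Γ for second derivatives of the metric. It
is through this that curvature becomes an explicit expression in the jet. -/
lemma metric_fderiv_apply (h : IsLeviCivitaOn Ω g Γ) {x : E} (hx : x ∈ Ω) (u a b c : E) :
    g x (fderiv ℝ Γ x u a b) c = christoffel (fderiv ℝ (fderiv ℝ g) x u) a b c
      - fderiv ℝ g x u (Γ x a b) c := by
  have hg := h.metric_smooth.differentiableAt_of_mem h.isOpen hx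
  have hΓ := h.smooth.differentiableAt_of_mem h.isOpen hx
  have h1 := congrFun (congrArg DFunLike.coe (fderiv_congr_of_isOpen h.isOpen hx
    fun y hy => h.metric_apply y hy a b c)) u
  rw [h.fderiv_christoffel hx, fderiv_clm_apply₂ hg (by fun_prop) (by fun_prop),
    fderiv_clm_apply_const (by fun_prop), fderiv_clm_apply_const hΓ] at h1
  simp only [fderiv_fun_const, Pi.zero_apply, zero_apply, map_zero, add_zero] at h1
  linarith

/-- The curvature tensor in terms of the second derivatives of the metric. -/
lemma metric_curvature (h : IsLeviCivitaOn Ω g Γ) {x : E} (hx : x ∈ Ω) (c a z t : E) :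
    g x (curvature Γ x c a z) t = christoffel (fderiv ℝ (fderiv ℝ g) x c) a z t
      - christoffel (fderiv ℝ (fderiv ℝ g) x a) c z t
      - g x (Γ x a z) (Γ x c t) + g x (Γ x c z) (Γ x a t) := by
  rw [curvature_apply]
  simp only [map_sub, map_add, sub_apply, add_apply, h.metric_fderiv_apply hx,
    h.fderiv_metric hx]
  ring

lemma metric_curvature_antisymm (h : IsLeviCivitaOn Ω g Γ) {x : E} (hx : x ∈ Ω) (c a z t : E) :
    g x (curvature Γ x c a z) t = - g x (curvature Γ x c a t) z := by
  rw [h.metric_curvature hx, h.metric_curvature hx]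
  have e1 := fun u w a b => h.fderiv_fderiv_metric_symm hx u w a b
  have e2 := fun u w a b => congrFun (congrArg DFunLike.coe (congrFun (congrArg DFunLike.coe
    (h.metric_smooth.fderiv_fderiv_comm h.isOpen hx u w)) a)) b
  rw [h.metric_symm x hx (Γ x a z), h.metric_symm x hx (Γ x a t)]
  simp only [christoffel]
  rw [e2 c a z t, e2 c a t z, e1 a c z t, e1 a z c t, e1 a t c z, e1 c z a t, e1 c t a z]
  ring

lemma metric_curvature_pair (h : IsLeviCivitaOn Ω g Γ) {x : E} (hx : x ∈ Ω) (c a z t : E) :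
    g x (curvature Γ x c a z) t = g x (curvature Γ x z t c) a := by
  rw [h.metric_curvature hx, h.metric_curvature hx]
  have e1 := fun u w a b => h.fderiv_fderiv_metric_symm hx u w a b
  have e2 := fun u w a b => congrFun (congrArg DFunLike.coe (congrFun (congrArg DFunLike.coe
    (h.metric_smooth.fderiv_fderiv_comm h.isOpen hx u w)) a)) b
  rw [h.symm hx t c, h.symm hx z a, h.symm hx z c, h.symm hx t a,
    h.metric_symm x hx (Γ x c t)]
  simp only [christoffel]
  rw [e2 z t c a, e2 z c t a, e2 z a t c, e2 t c z a, e2 t a z c, e2 a c z t,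
    e1 c z t a, e1 a z t c, e1 c t z a, e1 a t z c]
  ring

lemma contDiffOn_curvature (h : IsLeviCivitaOn Ω g Γ) (c a : E) :
    ContDiffOn ℝ ∞ (fun x => curvature Γ x c a) Ω := by
  have h1 := h.smooth.fderiv_infty h.isOpen
  have h2 := h.smooth
  unfold curvature
  fun_prop

/-- The covariant derivative of the curvature tensor in terms of derivatives of the metric. -/
lemma metric_covCurvature (h : IsLeviCivitaOn Ω g Γ) {x : E} (hx : x ∈ Ω) (y c a z t : E) :
    g x (covCurvature Γ x y c a z) t =
      christoffel (fderiv ℝ (fderiv ℝ (fderiv ℝ g)) x y c) a z t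
      - christoffel (fderiv ℝ (fderiv ℝ (fderiv ℝ g)) x y a) c z t
      - (christoffel (fderiv ℝ (fderiv ℝ g) x y) a z (Γ x c t)
        + christoffel (fderiv ℝ (fderiv ℝ g) x y) c t (Γ x a z)
        - fderiv ℝ g x y (Γ x a z) (Γ x c t))
      + (christoffel (fderiv ℝ (fderiv ℝ g) x y) c z (Γ x a t)
        + christoffel (fderiv ℝ (fderiv ℝ g) x y) a t (Γ x c z)
        - fderiv ℝ g x y (Γ x c z) (Γ x a t))
      - g x (curvature Γ x (Γ x y c) a z) t - g x (curvature Γ x c (Γ x y a) z) t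
      - g x (curvature Γ x c a (Γ x y z)) t - g x (curvature Γ x c a z) (Γ x y t) := by
  have hg := h.metric_smooth.differentiableAt_of_mem h.isOpen hx
  have hg1 := (h.metric_smooth.fderiv_infty h.isOpen).differentiableAt_of_mem h.isOpen hx
  have hg2 := ((h.metric_smooth.fderiv_infty h.isOpen).fderiv_infty
    h.isOpen).differentiableAt_of_mem h.isOpen hx
  have hΓ := h.smooth.differentiableAt_of_mem h.isOpen hx
  have hR := (h.contDiffOn_curvature c a).differentiableAt_of_mem h.isOpen hx
  have hchr : ∀ c a z t, DifferentiableAt ℝ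
      (fun x => christoffel (fderiv ℝ (fderiv ℝ g) x c) a z t) x := by
    intro c a z t
    simp only [christoffel]
    fun_prop
  have hchr' : ∀ c a z t, fderiv ℝ (fun x => christoffel (fderiv ℝ (fderiv ℝ g) x c) a z t) x y
      = christoffel (fderiv ℝ (fderiv ℝ (fderiv ℝ g)) x y c) a z t := by
    intro c a z t
    have key : ∀ a b d, HasFDerivAt (fun x => fderiv ℝ (fderiv ℝ g) x c a b d)
        (fderiv ℝ (fun x => fderiv ℝ (fderiv ℝ g) x c a b d) x) x := fun a b d => by
      refine DifferentiableAt.hasFDerivAt ?_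
      fun_prop
    have hval : ∀ a b d, fderiv ℝ (fun x => fderiv ℝ (fderiv ℝ g) x c a b d) x y
        = fderiv ℝ (fderiv ℝ (fderiv ℝ g)) x y c a b d := fun a b d => by
      rw [fderiv_clm_apply_const (by fun_prop), fderiv_clm_apply_const (by fun_prop),
        fderiv_clm_apply_const (by fun_prop), fderiv_clm_apply_const hg2]
    have hh := ((((key a z t).add (key z a t)).sub (key t a z)).mul_const (1 / 2 : ℝ)).fderiv
    have : (fun x => christoffel (fderiv ℝ (fderiv ℝ g) x c) a z t)
        = fun x => (fderiv ℝ (fderiv ℝ g) x c a z t + fderiv ℝ (fderiv ℝ g) x c z a t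
          - fderiv ℝ (fderiv ℝ g) x c t a z) * (1 / 2 : ℝ) := by
      ext; simp only [christoffel]; ring
    rw [this]
    refine (congrFun (congrArg _ hh) y).trans ?_
    simp only [smul_apply, sub_apply, add_apply, smul_eq_mul, hval, christoffel]
    ring
  -- In g(Γ,Γ) the derivatives of Γ are again eliminated. Each of the two factors contributes a term
  -- with -∂g(Γ,Γ) and the metric itself contributes +∂g(Γ,Γ), so one such term remains, with sign
  -- minus.
  have hq : ∀ a b c d, fderiv ℝ (fun x => g x (Γ x a b) (Γ x c d)) x y
      = christoffel (fderiv ℝ (fderiv ℝ g) x y) a b (Γ x c d)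
        + christoffel (fderiv ℝ (fderiv ℝ g) x y) c d (Γ x a b)
        - fderiv ℝ g x y (Γ x a b) (Γ x c d) := by
    intro a b c d
    rw [fderiv_clm_apply₂ hg (by fun_prop) (by fun_prop),
      fderiv_clm_apply_const (by fun_prop), fderiv_clm_apply_const hΓ,
      fderiv_clm_apply_const (by fun_prop), fderiv_clm_apply_const hΓ,
      h.metric_symm x hx (Γ x a b) (fderiv ℝ Γ x y c d),
      h.metric_fderiv_apply hx, h.metric_fderiv_apply hx, h.fderiv_metric_symm hx y (Γ x c d)]
    ring
  have h1 := congrFun (congrArg DFunLike.coe (fderiv_congr_of_isOpen h.isOpen hx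
    fun y hy => h.metric_curvature hy c a z t)) y
  rw [fderiv_clm_apply₂ hg (by fun_prop) (by fun_prop), fderiv_clm_apply_const hR,
    fderiv_fun_add (by fun_prop) (by fun_prop), fderiv_fun_sub (by fun_prop) (by fun_prop),
    fderiv_fun_sub (by fun_prop) (by fun_prop)] at h1
  simp only [fderiv_fun_const, Pi.zero_apply, zero_apply, map_zero, add_zero, add_apply,
    sub_apply, hchr', hq] at h1
  rw [h.fderiv_metric hx y (curvature Γ x c a z) t] at h1
  simp only [covCurvature, map_sub, map_add, sub_apply, add_apply]
  linarith

end IsLeviCivitaOn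

end Calculus

end CarlemanWeights

end

noncomputable section

namespace CarlemanWeights

set_option maxSynthPendingDepth 3

/-! ### Integrability conditions of a Carleman field -/

section CarlemanField

variable {E : Type*} [NormedAddCommGroup E] [NormedSpace ℝ E]

/-- The equations satisfied by the gradient `V` of a limiting Carleman weight and the gradient `A`
of the logarithm of its length: `V` is parallel for the conformal metric which makes it a unit
field. -/
structure IsCarlemanField (Ω : Set E) (g : E → E →L[ℝ] E →L[ℝ] ℝ) (Γ : E → E →L[ℝ] E →L[ℝ] E)
    (V A : E → E) (μ : E → ℝ) : Prop extends IsLeviCivitaOn Ω g Γ where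
  field_smooth : ContDiffOn ℝ ∞ V Ω
  log_smooth : ContDiffOn ℝ ∞ A Ω
  scalar_smooth : ContDiffOn ℝ ∞ μ Ω
  fderiv_field : ∀ x ∈ Ω, ∀ a, fderiv ℝ V x a =
    - Γ x a (V x) + μ x • a + g x (A x) a • V x + g x (V x) a • A x
  field_closed : ∀ x ∈ Ω, ∀ a c, fderiv ℝ (fun y => g y (V y) a) x c
    = fderiv ℝ (fun y => g y (V y) c) x a
  log_closed : ∀ x ∈ Ω, ∀ a c, fderiv ℝ (fun y => g y (A y) a) x c
    = fderiv ℝ (fun y => g y (A y) c) x a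
  metric_log_field : ∀ x ∈ Ω, g x (A x) (V x) = - μ x

/-- The trace-modified Hessian `∇A - A ⊗ A`. -/
def logHessian (g : E → E →L[ℝ] E →L[ℝ] ℝ) (Γ : E → E →L[ℝ] E →L[ℝ] E) (A : E → E) (x c : E) : E :=
  fderiv ℝ A x c + Γ x c (A x) - g x (A x) c • A x

/-- The covariant derivative of `logHessian`. -/
def covLogHessian (g : E → E →L[ℝ] E →L[ℝ] ℝ) (Γ : E → E →L[ℝ] E →L[ℝ] E) (A : E → E)
    (x y c : E) : E :=
  fderiv ℝ (fun x' => logHessian g Γ A x' c) x y + Γ x y (logHessian g Γ A x c)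
    - logHessian g Γ A x (Γ x y c)

namespace IsCarlemanField

variable {Ω : Set E} {g : E → E →L[ℝ] E →L[ℝ] ℝ} {Γ : E → E →L[ℝ] E →L[ℝ] E} {V A : E → E}
  {μ : E → ℝ}

lemma fderiv_metric_log (h : IsCarlemanField Ω g Γ V A μ) {x : E} (hx : x ∈ Ω) (a c : E) :
    fderiv ℝ (fun y => g y (A y) a) x c
      = g x (logHessian g Γ A x c) a + g x (A x) c * g x (A x) a + g x (A x) (Γ x c a) := by
  have hg := h.metric_smooth.differentiableAt_of_mem h.isOpen hx
  have hA := h.log_smooth.differentiableAt_of_mem h.isOpen hx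
  rw [fderiv_clm_apply₂ hg hA (differentiableAt_const a), h.fderiv_metric hx]
  simp only [fderiv_fun_const, Pi.zero_apply, zero_apply, map_zero, add_zero, logHessian, map_add,
    map_sub, add_apply, sub_apply, map_smul, smul_apply, smul_eq_mul]
  ring

lemma logHessian_symm (h : IsCarlemanField Ω g Γ V A μ) {x : E} (hx : x ∈ Ω) (a c : E) :
    g x (logHessian g Γ A x c) a = g x (logHessian g Γ A x a) c := by
  have h1 := h.log_closed x hx a c
  rw [h.fderiv_metric_log hx, h.fderiv_metric_log hx, h.symm hx c a] at h1
  linarith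

/-- The scalar is -g(A,V), so its derivative follows from those of A and V. This closes the system:
second derivatives of V involve no new unknown beyond ∇A. -/
lemma fderiv_scalar (h : IsCarlemanField Ω g Γ V A μ) {x : E} (hx : x ∈ Ω) (c : E) :
    fderiv ℝ μ x c = - g x (logHessian g Γ A x c) (V x) + μ x * g x (A x) c
      - g x (A x) (A x) * g x (V x) c := by
  have hg := h.metric_smooth.differentiableAt_of_mem h.isOpen hx
  have hA := h.log_smooth.differentiableAt_of_mem h.isOpen hx
  have hV := h.field_smooth.differentiableAt_of_mem h.isOpen hx
  have h1 : fderiv ℝ (fun y => - g y (A y) (V y)) x = fderiv ℝ μ x :=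
    fderiv_congr_of_isOpen h.isOpen hx fun y hy => by rw [h.metric_log_field y hy, neg_neg]
  rw [← h1, fderiv_fun_neg, neg_apply, fderiv_clm_apply₂ hg hA hV, h.fderiv_metric hx,
    h.fderiv_field x hx]
  simp only [logHessian, map_add, map_neg, map_sub, add_apply, sub_apply, map_smul, smul_apply,
    smul_eq_mul, h.metric_log_field x hx]
  ring

/-- This is the integrability condition of the equation for ∇V. Antisymmetrizing its derivative
removes the derivatives of g(A,·) and g(V,·), which are closed forms, and leaves the curvature
against `logHessian`. -/
lemma curvature_field (h : IsCarlemanField Ω g Γ V A μ) {x : E} (hx : x ∈ Ω) (c a : E) :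
    curvature Γ x c a (V x) =
      - (g x (logHessian g Γ A x c) (V x) + g x (A x) (A x) * g x (V x) c) • a
      + (g x (logHessian g Γ A x a) (V x) + g x (A x) (A x) * g x (V x) a) • c
      + g x (V x) a • logHessian g Γ A x c - g x (V x) c • logHessian g Γ A x a := by
  have hg := h.metric_smooth.differentiableAt_of_mem h.isOpen hx
  have hA := h.log_smooth.differentiableAt_of_mem h.isOpen hx
  have hV := h.field_smooth.differentiableAt_of_mem h.isOpen hx
  have hV1 := (h.field_smooth.fderiv_infty h.isOpen).differentiableAt_of_mem h.isOpen hx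
  have hμ := h.scalar_smooth.differentiableAt_of_mem h.isOpen hx
  have hΓ := h.smooth.differentiableAt_of_mem h.isOpen hx
  have key : ∀ a c, fderiv ℝ (fderiv ℝ V) x c a = - (fderiv ℝ Γ x c a (V x)
      + Γ x a (fderiv ℝ V x c)) + fderiv ℝ μ x c • a
      + (g x (A x) a • fderiv ℝ V x c + fderiv ℝ (fun y => g y (A y) a) x c • V x)
      + (g x (V x) a • fderiv ℝ A x c + fderiv ℝ (fun y => g y (V y) a) x c • A x) := by
    intro a c
    have h1 := congrFun (congrArg DFunLike.coe (fderiv_congr_of_isOpen h.isOpen hx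
      fun y hy => h.fderiv_field y hy a)) c
    rw [fderiv_clm_apply_const hV1, fderiv_fun_add (by fun_prop) (by fun_prop),
      fderiv_fun_add (by fun_prop) (by fun_prop), fderiv_fun_add (by fun_prop) (by fun_prop),
      fderiv_fun_neg, fderiv_fun_smul (by fun_prop) (by fun_prop),
      fderiv_fun_smul (by fun_prop) (by fun_prop),
      fderiv_fun_smul (by fun_prop) (by fun_prop)] at h1
    simp only [add_apply, neg_apply, smul_apply, fderiv_fun_const, Pi.zero_apply,
      smul_zero, zero_add, ContinuousLinearMap.smulRight_apply] at h1
    rw [fderiv_clm_apply_apply (by fun_prop) hV, fderiv_clm_apply_const hΓ] at h1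
    rw [h1]
  -- Symmetry of the second derivative of V is the only source of the identity; everything else is
  -- substitution of first derivatives.
  have h2 := h.field_smooth.fderiv_fderiv_comm h.isOpen hx c a
  rw [key a c, key c a, h.log_closed x hx a c, h.field_closed x hx a c] at h2
  simp only [h.fderiv_field x hx, h.fderiv_scalar hx] at h2
  rw [curvature_apply]
  simp only [map_add, map_neg, map_smul, h.symm hx a c] at h2
  simp only [logHessian] at h2 ⊢
  linear_combination (norm := skip) -h2
  module

/-- All surviving terms of R(a,b)V are multiples of a and b. The components along `logHessian` carry
the factors g(V,a) and g(V,b). -/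
lemma metric_curvature_field_eq_zero (h : IsCarlemanField Ω g Γ V A μ) {x : E} (hx : x ∈ Ω)
    {a b c : E} (ha : g x (V x) a = 0) (hb : g x (V x) b = 0) (hac : g x a c = 0)
    (hbc : g x b c = 0) : g x (curvature Γ x a b (V x)) c = 0 := by
  rw [h.curvature_field hx, ha, hb]
  simp [hac, hbc]

lemma contDiffOn_logHessian (h : IsCarlemanField Ω g Γ V A μ) (c : E) :
    ContDiffOn ℝ ∞ (fun x => logHessian g Γ A x c) Ω := by
  have h1 := h.log_smooth.fderiv_infty h.isOpen
  have h2 := h.smooth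
  have h3 := h.metric_smooth
  have h4 := h.log_smooth
  exact ((h1.clm_apply contDiffOn_const).add ((h2.clm_apply contDiffOn_const).clm_apply h4)).sub
    (((h3.clm_apply h4).clm_apply contDiffOn_const).smul h4)

lemma covLogHessian_symm (h : IsCarlemanField Ω g Γ V A μ) {x : E} (hx : x ∈ Ω) (y a c : E) :
    g x (covLogHessian g Γ A x y c) a = g x (covLogHessian g Γ A x y a) c := by
  have hg := h.metric_smooth.differentiableAt_of_mem h.isOpen hx
  have hB := fun c => (h.contDiffOn_logHessian c).differentiableAt_of_mem h.isOpen hx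
  have h1 := congrFun (congrArg DFunLike.coe (fderiv_congr_of_isOpen h.isOpen hx
    fun y hy => h.logHessian_symm hy a c)) y
  rw [fderiv_clm_apply₂ hg (hB c) (differentiableAt_const a),
    fderiv_clm_apply₂ hg (hB a) (differentiableAt_const c), h.fderiv_metric hx,
    h.fderiv_metric hx] at h1
  simp only [fderiv_fun_const, Pi.zero_apply, zero_apply, map_zero, add_zero] at h1
  simp only [covLogHessian, map_add, map_sub, add_apply, sub_apply]
  rw [h.logHessian_symm hx a (Γ x y c), h.logHessian_symm hx c (Γ x y a)]
  linarith

/-- The covariant derivative of a Carleman field. -/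
def covField (g : E → E →L[ℝ] E →L[ℝ] ℝ) (V A : E → E) (μ : E → ℝ) (x y : E) : E :=
  μ x • y + g x (A x) y • V x + g x (V x) y • A x

/-- The covariant derivative of `curvature_field`. It is needed in dimension three, where the
undifferentiated identity gives no condition of the kind used for n ≥ 4. -/
lemma covCurvature_field (h : IsCarlemanField Ω g Γ V A μ) {x : E} (hx : x ∈ Ω) (y c a : E) :
    covCurvature Γ x y c a (V x) = - curvature Γ x c a (covField g V A μ x y)
      - (g x (covLogHessian g Γ A x y c) (V x)
        + g x (logHessian g Γ A x c) (covField g V A μ x y)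
        + 2 * g x (fderiv ℝ A x y + Γ x y (A x)) (A x) * g x (V x) c
        + g x (A x) (A x) * g x (covField g V A μ x y) c) • a
      + (g x (covLogHessian g Γ A x y a) (V x)
        + g x (logHessian g Γ A x a) (covField g V A μ x y)
        + 2 * g x (fderiv ℝ A x y + Γ x y (A x)) (A x) * g x (V x) a
        + g x (A x) (A x) * g x (covField g V A μ x y) a) • c
      + g x (covField g V A μ x y) a • logHessian g Γ A x c
      + g x (V x) a • covLogHessian g Γ A x y c
      - g x (covField g V A μ x y) c • logHessian g Γ A x a
      - g x (V x) c • covLogHessian g Γ A x y a := by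
  have hg := h.metric_smooth.differentiableAt_of_mem h.isOpen hx
  have hA := h.log_smooth.differentiableAt_of_mem h.isOpen hx
  have hV := h.field_smooth.differentiableAt_of_mem h.isOpen hx
  have hB := fun c => (h.contDiffOn_logHessian c).differentiableAt_of_mem h.isOpen hx
  have hR := (h.contDiffOn_curvature c a).differentiableAt_of_mem h.isOpen hx
  have hVy : fderiv ℝ V x y = covField g V A μ x y - Γ x y (V x) := by
    rw [h.fderiv_field x hx, covField]; abel
  have e1 : ∀ c, fderiv ℝ (fun x => g x (V x) c) x y
      = g x (covField g V A μ x y) c + g x (V x) (Γ x y c) := by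
    intro c
    rw [fderiv_clm_apply₂ hg hV (differentiableAt_const c), h.fderiv_metric hx, hVy]
    simp only [fderiv_fun_const, Pi.zero_apply, zero_apply, map_zero, add_zero, map_sub, sub_apply]
    ring
  have e2 : ∀ c, fderiv ℝ (fun x => g x (logHessian g Γ A x c) (V x)) x y
      = g x (covLogHessian g Γ A x y c) (V x) + g x (logHessian g Γ A x (Γ x y c)) (V x)
        + g x (logHessian g Γ A x c) (covField g V A μ x y) := by
    intro c
    rw [fderiv_clm_apply₂ hg (hB c) hV, h.fderiv_metric hx, hVy]
    simp only [covLogHessian, map_add, map_sub, add_apply, sub_apply]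
    ring
  have e3 : fderiv ℝ (fun x => g x (A x) (A x)) x y
      = 2 * g x (fderiv ℝ A x y + Γ x y (A x)) (A x) := by
    rw [fderiv_clm_apply₂ hg hA hA, h.fderiv_metric hx, h.metric_symm x hx (A x) (fderiv ℝ A x y),
      h.metric_symm x hx (A x) (Γ x y (A x))]
    simp only [map_add, add_apply]
    ring
  have h1 := congrFun (congrArg DFunLike.coe (fderiv_congr_of_isOpen h.isOpen hx
    fun y hy => h.curvature_field hy c a)) y
  rw [fderiv_clm_apply_apply hR hV, fderiv_fun_sub (by fun_prop) (by fun_prop),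
    fderiv_fun_add (by fun_prop) (by fun_prop), fderiv_fun_add (by fun_prop) (by fun_prop),
    fderiv_fun_smul (by fun_prop) (by fun_prop), fderiv_fun_smul (by fun_prop) (by fun_prop),
    fderiv_fun_smul (by fun_prop) (by fun_prop), fderiv_fun_smul (by fun_prop) (by fun_prop),
    fderiv_fun_neg, fderiv_fun_add (by fun_prop) (by fun_prop),
    fderiv_fun_add (by fun_prop) (by fun_prop), fderiv_fun_mul (by fun_prop) (by fun_prop),
    fderiv_fun_mul (by fun_prop) (by fun_prop)] at h1
  simp only [add_apply, sub_apply, neg_apply, smul_apply, fderiv_fun_const, Pi.zero_apply,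
    smul_zero, zero_add, ContinuousLinearMap.smulRight_apply, smul_eq_mul, e1, e2, e3,
    hVy] at h1
  have hD : ∀ c, fderiv ℝ (fun x' => logHessian g Γ A x' c) x y
      = covLogHessian g Γ A x y c - Γ x y (logHessian g Γ A x c)
        + logHessian g Γ A x (Γ x y c) := by
    intro c
    rw [covLogHessian]; abel
  rw [hD, hD, map_sub] at h1
  -- The undifferentiated identity, with the arguments moved by Γ, supplies the connection terms
  -- that turn ordinary derivatives into covariant ones.
  have h2 := h.curvature_field hx (Γ x y c) a
  have h3 := h.curvature_field hx c (Γ x y a)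
  have h4 := congrArg (Γ x y) (h.curvature_field hx c a)
  simp only [map_add, map_sub, map_smul] at h4
  rw [covCurvature]
  linear_combination (norm := skip) h1 - h2 - h3 + h4
  module

/-- The Ricci identity for A, corrected by the derivative of A ⊗ A. In that derivative the terms
along A cancel because A is closed. Only first derivatives of A and the curvature remain. -/
lemma covLogHessian_curl (h : IsCarlemanField Ω g Γ V A μ) {x : E} (hx : x ∈ Ω) (b v : E) :
    covLogHessian g Γ A x b v - covLogHessian g Γ A x v b = curvature Γ x b v (A x)
      - g x (A x) v • (fderiv ℝ A x b + Γ x b (A x))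
      + g x (A x) b • (fderiv ℝ A x v + Γ x v (A x)) := by
  have hg := h.metric_smooth.differentiableAt_of_mem h.isOpen hx
  have hA := h.log_smooth.differentiableAt_of_mem h.isOpen hx
  have hA1 := (h.log_smooth.fderiv_infty h.isOpen).differentiableAt_of_mem h.isOpen hx
  have hΓ := h.smooth.differentiableAt_of_mem h.isOpen hx
  have key : ∀ b v, fderiv ℝ (fun x' => logHessian g Γ A x' v) x b
      = fderiv ℝ (fderiv ℝ A) x b v + (fderiv ℝ Γ x b v (A x) + Γ x v (fderiv ℝ A x b))
        - (g x (A x) v • fderiv ℝ A x b + fderiv ℝ (fun x => g x (A x) v) x b • A x) := by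
    intro b v
    simp only [logHessian]
    rw [fderiv_fun_sub (by fun_prop) (by fun_prop), fderiv_fun_add (by fun_prop) (by fun_prop),
      fderiv_fun_smul (by fun_prop) (by fun_prop)]
    simp only [add_apply, sub_apply, smul_apply, ContinuousLinearMap.smulRight_apply]
    rw [fderiv_clm_apply_const hA1, fderiv_clm_apply_apply (by fun_prop) hA,
      fderiv_clm_apply_const hΓ]
  simp only [covLogHessian]
  rw [key b v, key v b, h.log_closed x hx v b, h.log_smooth.fderiv_fderiv_comm h.isOpen hx b v,
    curvature_apply, h.symm hx b v]
  simp only [logHessian, map_add, map_sub, map_smul]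
  module

/-- In dimension three, the Cotton tensor vanishes on orthogonal frames which contain the
Carleman field. -/
lemma cotton_eq_zero (h : IsCarlemanField Ω g Γ V A μ) {x : E} (hx : x ∈ Ω) {a b : E}
    (ha : g x (V x) a = 0) (hb : g x (V x) b = 0) (hab : g x a b = 0)
    (hspan : ∃ r s t : ℝ, A x = r • V x + s • a + t • b) :
    g x b b * g x (covCurvature Γ x (V x) (V x) b (V x)) a
      = g x (V x) (V x) * g x (covCurvature Γ x b a b (V x)) b := by
  obtain ⟨r, s, t, hA⟩ := hspan
  set v := V x with hv
  have hav : g x a v = 0 := by rw [h.metric_symm x hx, ha]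
  have hbv : g x b v = 0 := by rw [h.metric_symm x hx, hb]
  have hba : g x b a = 0 := by rw [h.metric_symm x hx, hab]
  have hμ := h.metric_log_field x hx
  rw [← hv] at hμ
  have hAv : g x (A x) v = r * g x v v := by rw [hA]; simp [hav, hbv]
  have hAb : g x (A x) b = t * g x b b := by rw [hA]; simp [hab, hb]
  -- Apart from lower order terms, the two components of ∇R reduce to -|V|² g((∇_V B)b,a) and -|b|²
  -- g((∇_b B)a,V), with B the `logHessian`. Symmetry of ∇_b B and the curl formula exchange them,
  -- and the undifferentiated curvature identities remove the remainder.
  have hE1 := congrArg (fun X => g x X a) (h.covCurvature_field hx v v b)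
  have hE2 := congrArg (fun X => g x X b) (h.covCurvature_field hx b a b)
  have hcurl := congrArg (fun X => g x X a) (h.covLogHessian_curl hx b v)
  have hsym := h.covLogHessian_symm hx b a v
  have hT1 := congrArg (fun X => g x X a) (h.curvature_field hx v b)
  have hT2 := congrArg (fun X => g x X b) (h.curvature_field hx b a)
  have hT3 := congrArg (fun X => g x X b) (h.curvature_field hx a b)
  have hpair := h.metric_curvature_pair hx v b b a
  have hanti : g x (curvature Γ x a b b) b = 0 := by
    have := h.metric_curvature_antisymm hx a b b b; linarith
  have hanti' : g x (curvature Γ x v b a) a = 0 := by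
    have := h.metric_curvature_antisymm hx v b a a; linarith
  have hRA : g x (curvature Γ x v b (A x)) a
      = r * g x (curvature Γ x v b v) a + t * g x (curvature Γ x v b b) a := by
    rw [hA]; simp [hanti']
  have hswap : g x (curvature Γ x b v (A x)) a = - g x (curvature Γ x v b (A x)) a := by
    rw [curvature_swap]; simp
  have hBsym := h.logHessian_symm hx a v
  have hBsym' := h.logHessian_symm hx a b
  have hnab : ∀ c, fderiv ℝ A x c + Γ x c (A x) = logHessian g Γ A x c + g x (A x) c • A x := by
    intro c; rw [logHessian]; abel
  rw [hnab, hnab] at hcurl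
  simp only [covField, ← hv, map_add, map_sub, map_neg, map_smul, add_apply, sub_apply, neg_apply,
    smul_apply, smul_eq_mul, ha, hb, hab, hba, hanti, mul_zero, add_zero,
    zero_add, sub_zero, zero_smul] at hE1 hE2 hcurl hT1 hT2 hT3
  have hμ' : μ x = - (r * g x v v) := by linarith
  have hcv : g x (covLogHessian g Γ A x v b) a = g x (covLogHessian g Γ A x b a) v
      - (g x (curvature Γ x b v (A x)) a
        - g x (A x) v * (g x (logHessian g Γ A x b) a + g x (A x) b * g x (A x) a)
        + g x (A x) b * (g x (logHessian g Γ A x v) a + g x (A x) v * g x (A x) a)) := by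
    rw [← hsym, ← hcurl]; ring
  rw [hE1, hE2, hcv, hswap, hRA, hT1, hpair, hT2, hT3, hBsym, hBsym', hAv, hAb, hμ']
  ring

end IsCarlemanField

end CarlemanField

end CarlemanWeights

end

noncomputable section

namespace CarlemanWeights

set_option maxSynthPendingDepth 6

lemma two_mod (m : ℕ) : 2 % (m + 4) = 2 := Nat.mod_eq_of_lt (by omega)

lemma three_mod (m : ℕ) : 3 % (m + 4) = 3 := Nat.mod_eq_of_lt (by omega)

lemma fin_ne {m : ℕ} {i j : Fin m} (h : (i : ℕ) ≠ j) : i ≠ j := fun hij => h (by rw [hij])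

/-! ### Orthonormal frames and openness of the nondegeneracy condition -/

section Frames

variable {E : Type*} [NormedAddCommGroup E] [NormedSpace ℝ E] {n : ℕ}

/-- The frame with components `P` in the frame `F`. -/
def frameMul (P : Matrix (Fin n) (Fin n) ℝ) (F : Fin n → E) (i : Fin n) : E := ∑ j, P i j • F j

/-- `F` is orthonormal for the bilinear form `B`. -/
def IsOrthoFrame (B : E →L[ℝ] E →L[ℝ] ℝ) (F : Fin n → E) : Prop :=
  ∀ i j, B (F i) (F j) = if i = j then 1 else 0

lemma frameMul_mul (P Q : Matrix (Fin n) (Fin n) ℝ) (F : Fin n → E) :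
    frameMul (P * Q) F = frameMul P (frameMul Q F) := by
  ext i
  simp only [frameMul, Matrix.mul_apply, Finset.sum_smul, Finset.smul_sum, smul_smul]
  rw [Finset.sum_comm]

lemma IsOrthoFrame.frameMul {B : E →L[ℝ] E →L[ℝ] ℝ} {F : Fin n → E} (hF : IsOrthoFrame B F)
    {P : Matrix (Fin n) (Fin n) ℝ} (hP : P * P.transpose = 1) : IsOrthoFrame B (frameMul P F) := by
  intro i j
  rw [← orthogonal_row_dotProduct hP]
  simp only [CarlemanWeights.frameMul, map_sum, map_smul, sum_apply, smul_apply, hF _ _,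
    smul_eq_mul, mul_ite, mul_one, mul_zero, Finset.sum_ite_eq',
    Finset.mem_univ, if_true, dotProduct]
  exact Finset.sum_congr rfl fun k _ => mul_comm _ _

lemma continuous_frameMul (P : Matrix (Fin n) (Fin n) ℝ) :
    Continuous fun F : Fin n → E => frameMul P F := by
  unfold frameMul
  fun_prop

lemma IsOrthoFrame.linearIndependent {B : E →L[ℝ] E →L[ℝ] ℝ} {F : Fin n → E}
    (hF : IsOrthoFrame B F) : LinearIndependent ℝ F := by
  rw [Fintype.linearIndependent_iff]
  intro c hc i
  have h := congrArg (fun X => B X (F i)) hc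
  simpa [hF _ _] using h

lemma IsOrthoFrame.sum_smul [FiniteDimensional ℝ E] {B : E →L[ℝ] E →L[ℝ] ℝ} {F : Fin n → E}
    (hF : IsOrthoFrame B F) (hn : Module.finrank ℝ E = n) (X : E) :
    ∑ i, B X (F i) • F i = X := by
  have hspan : ⊤ ≤ Submodule.span ℝ (Set.range F) :=
    (hF.linearIndependent.span_eq_top_of_card_eq_finrank' (by simp [hn])).ge
  obtain ⟨c, rfl⟩ := (Submodule.mem_span_range_iff_exists_fun ℝ).1 (hspan (Submodule.mem_top (x := X)))
  simp [hF _ _]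

lemma exists_isOrthoFrame [FiniteDimensional ℝ E] {B : E →L[ℝ] E →L[ℝ] ℝ}
    (hB : ∀ a b, B a b = B b a) (hpos : ∀ a, a ≠ 0 → 0 < B a a)
    (hn : Module.finrank ℝ E = n) : ∃ F : Fin n → E, IsOrthoFrame B F := by
  subst hn
  let B' : LinearMap.BilinForm ℝ E := LinearMap.mk₂ ℝ (fun a b => B a b) (by simp) (by simp)
    (by simp) (by simp)
  obtain ⟨v, hv⟩ := LinearMap.BilinForm.exists_orthogonal_basis (B := B') ⟨fun a b => hB a b⟩
  refine ⟨fun i => (√(B (v i) (v i)))⁻¹ • v i, fun i j => ?_⟩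
  have hp := hpos (v i) (v.ne_zero i)
  have hs : √(B (v i) (v i)) ≠ 0 := (Real.sqrt_pos.2 hp).ne'
  by_cases hij : i = j
  · subst hij
    simp only [map_smul, smul_apply, smul_eq_mul, if_true]
    field_simp
    rw [Real.sq_sqrt hp.le]
  · have h0 : B (v i) (v j) = 0 := hv hij
    simp [h0, hij]

/-- Minimum of the form on the compact unit sphere, extended by homogeneity. -/
lemma exists_pos_mul_norm_sq_le [FiniteDimensional ℝ E] {B : E →L[ℝ] E →L[ℝ] ℝ}
    (hpos : ∀ a, a ≠ 0 → 0 < B a a) : ∃ c > 0, ∀ a, c * ‖a‖ ^ 2 ≤ B a a := by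
  have hK : IsCompact (Metric.sphere (0 : E) 1) := isCompact_sphere 0 1
  have hcont : Continuous fun a => B a a := by fun_prop
  have key : ∃ c > 0, ∀ a ∈ Metric.sphere (0 : E) 1, c ≤ B a a := by
    rcases (Metric.sphere (0 : E) 1).eq_empty_or_nonempty with h | h
    · exact ⟨1, one_pos, by simp [h]⟩
    · obtain ⟨a, ha, hmin⟩ := hK.exists_isMinOn h hcont.continuousOn
      exact ⟨B a a, hpos a (by rintro rfl; simp at ha), fun b hb => hmin hb⟩
  obtain ⟨c, hc, h⟩ := key
  refine ⟨c, hc, fun a => ?_⟩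
  by_cases ha : a = 0
  · simp [ha]
  have hn : ‖a‖ ≠ 0 := norm_ne_zero_iff.2 ha
  have h1 := h (‖a‖⁻¹ • a) (by simp [norm_smul, hn])
  simp only [map_smul, smul_apply, smul_eq_mul] at h1
  calc c * ‖a‖ ^ 2 ≤ ‖a‖⁻¹ * (‖a‖⁻¹ * B a a) * ‖a‖ ^ 2 := by gcongr
    _ = B a a := by field_simp

open Matrix in
/-- Some orthonormal frame annihilates `f`, as do all the orthonormal frames with the same
direction of the vector of index `i₀`. -/
def HasDegenerateFrame (B : E →L[ℝ] E →L[ℝ] ℝ) (f : (Fin n → E) → ℝ) (i₀ : Fin n) : Prop :=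
  ∃ F : Fin n → E, IsOrthoFrame B F ∧ ∀ P : Matrix (Fin n) (Fin n) ℝ, P * Pᵀ = 1 →
    (∀ j, j ≠ i₀ → P i₀ j = 0) → f (frameMul P F) = 0

/-- Being either not orthonormal or not annihilated along the whole family of rotations is open in
the pair (parameter, frame). Compactness of the relevant frames then removes the quantifier over
frames. -/
lemma isOpen_not_hasDegenerateFrame [FiniteDimensional ℝ E] {T : Type*} [TopologicalSpace T]
    {B : T → E →L[ℝ] E →L[ℝ] ℝ} (hB : Continuous B) (hpos : ∀ t a, a ≠ 0 → 0 < B t a a)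
    {f : T → (Fin n → E) → ℝ} (hf : Continuous fun p : T × (Fin n → E) => f p.1 p.2)
    (i₀ : Fin n) : IsOpen {t | ¬ HasDegenerateFrame (B t) (f t) i₀} := by
  rw [isOpen_iff_mem_nhds]
  intro t₀ ht₀
  obtain ⟨c, hc, hle⟩ := exists_pos_mul_norm_sq_le (hpos t₀)
  have hnear : ∀ᶠ t in 𝓝 t₀, ‖B t - B t₀‖ < c / 2 := by
    have : Filter.Tendsto (fun t => ‖B t - B t₀‖) (𝓝 t₀) (𝓝 0) := by
      have h := (hB.tendsto t₀).sub_const (B t₀)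
      rw [sub_self] at h
      simpa using h.norm
    exact this.eventually (gt_mem_nhds (by positivity))
  -- If B t is within c/2 of B t₀, then B t(a,a) ≥ (c/2)‖a‖², so vectors of a B t-orthonormal frame
  -- have norm at most √(2/c).
  have hcomp := (isCompact_closedBall (0 : Fin n → E)
    (√(2 / c))).eventually_forall_of_forall_eventually (x₀ := t₀)
      (P := fun t F => ¬ (IsOrthoFrame (B t) F ∧ ∀ P : Matrix (Fin n) (Fin n) ℝ,
        P * P.transpose = 1 → (∀ j, j ≠ i₀ → P i₀ j = 0) → f t (frameMul P F) = 0)) ?_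
  · filter_upwards [hnear, hcomp] with t ht1 ht2
    rintro ⟨F, hF, hP⟩
    refine ht2 F ?_ ⟨hF, hP⟩
    rw [mem_closedBall_zero_iff, pi_norm_le_iff_of_nonneg (Real.sqrt_nonneg _)]
    intro i
    apply Real.le_sqrt_of_sq_le
    have h1 : B t (F i) (F i) = 1 := by rw [hF, if_pos rfl]
    have h2 := hle (F i)
    have h3 : |(B t - B t₀) (F i) (F i)| ≤ ‖B t - B t₀‖ * ‖F i‖ * ‖F i‖ :=
      (B t - B t₀).le_opNorm₂ (F i) (F i)
    have h4 : ‖B t - B t₀‖ * ‖F i‖ * ‖F i‖ ≤ c / 2 * ‖F i‖ * ‖F i‖ := by gcongr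
    have h5 := abs_le.1 (h3.trans h4)
    simp only [sub_apply, h1] at h5
    rw [le_div_iff₀ hc]
    nlinarith [h5.1]
  · intro F _
    by_cases hF : IsOrthoFrame (B t₀) F
    · have : ∃ P : Matrix (Fin n) (Fin n) ℝ, P * P.transpose = 1 ∧
          (∀ j, j ≠ i₀ → P i₀ j = 0) ∧ f t₀ (frameMul P F) ≠ 0 := by
        by_contra hcon
        push Not at hcon
        exact ht₀ ⟨F, hF, hcon⟩
      obtain ⟨P, hP1, hP2, hP3⟩ := this
      have hcont : Continuous fun p : T × (Fin n → E) => f p.1 (frameMul P p.2) :=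
        hf.comp (continuous_fst.prodMk ((continuous_frameMul P).comp continuous_snd))
      filter_upwards [(hcont.continuousAt (x := (t₀, F))).eventually_ne hP3] with p hp h
      exact hp (h.2 P hP1 hP2)
    · simp only [IsOrthoFrame, not_forall] at hF
      obtain ⟨i, j, hij⟩ := hF
      have hcont : Continuous fun p : T × (Fin n → E) => B p.1 (p.2 i) (p.2 j) := by
        have := hB.comp (continuous_fst (X := T) (Y := Fin n → E))
        fun_prop
      filter_upwards [(hcont.continuousAt (x := (t₀, F))).eventually_ne hij] with p hp h
      exact hp (h.1 i j)

/-- An orthonormal frame, with vectors of index `i₀` in a prescribed direction. -/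
lemma exists_isOrthoFrame_smul_eq [FiniteDimensional ℝ E] {B : E →L[ℝ] E →L[ℝ] ℝ}
    (hB : ∀ a b, B a b = B b a) (hpos : ∀ a, a ≠ 0 → 0 < B a a)
    (hn : Module.finrank ℝ E = n) (i₀ : Fin n) {v : E} (hv : v ≠ 0) :
    ∃ F : Fin n → E, IsOrthoFrame B F ∧ ∃ t : ℝ, t ≠ 0 ∧ F i₀ = t • v := by
  obtain ⟨e, he⟩ := exists_isOrthoFrame hB hpos hn
  have hp := hpos v hv
  have hs : √(B v v) ≠ 0 := (Real.sqrt_pos.2 hp).ne'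
  have hexp := he.sum_smul hn v
  set u : Fin n → ℝ := fun i => (√(B v v))⁻¹ * B v (e i) with hu
  have hsum : ∑ i, B v (e i) * B v (e i) = B v v := by
    have h := congrArg (B v) hexp
    simpa only [map_sum, map_smul, smul_eq_mul] using h
  have huu : u ⬝ᵥ u = 1 := by
    simp only [dotProduct, hu]
    have : ∀ i, (√(B v v))⁻¹ * B v (e i) * ((√(B v v))⁻¹ * B v (e i))
        = (√(B v v))⁻¹ * (√(B v v))⁻¹ * (B v (e i) * B v (e i)) := fun i => by ring
    simp only [this, ← Finset.mul_sum, hsum]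
    rw [← mul_inv, Real.mul_self_sqrt hp.le, inv_mul_cancel₀ hp.ne']
  have hue : ∑ j, u j • e j = (√(B v v))⁻¹ • v := by
    simp only [hu, mul_smul, ← Finset.smul_sum, hexp]
  obtain ⟨w, hw, hrow⟩ := exists_reflectionMatrix_row i₀ u huu
  refine ⟨frameMul (reflectionMatrix w) e, he.frameMul ?_, ?_⟩
  · rw [reflectionMatrix_transpose, reflectionMatrix_mul_self hw]
  · rcases hrow with h | h
    · exact ⟨(√(B v v))⁻¹, inv_ne_zero hs, by rw [frameMul, h, hue]⟩
    · refine ⟨-(√(B v v))⁻¹, neg_ne_zero.2 (inv_ne_zero hs), ?_⟩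
      simp only [frameMul, h, Pi.neg_apply, neg_smul, Finset.sum_neg_distrib, hue]

end Frames

/-! ### Curvature obstructions as functions of the jet and a frame -/

section Jets

variable {E : Type*} [NormedAddCommGroup E] [NormedSpace ℝ E] {n : ℕ}

/-- The Christoffel symbols of the second kind, computed with the orthonormal frame `F`. -/
def jetGamma (g₁ : E →L[ℝ] E →L[ℝ] E →L[ℝ] ℝ) (F : Fin n → E) (a b : E) : E :=
  ∑ i, christoffel g₁ a b (F i) • F i

/-- The curvature tensor, computed from the derivatives of the metric and the orthonormal
frame `F`. -/
def jetCurvature (g₁ : E →L[ℝ] E →L[ℝ] E →L[ℝ] ℝ) (g₂ : E →L[ℝ] E →L[ℝ] E →L[ℝ] E →L[ℝ] ℝ)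
    (F : Fin n → E) (c a z t : E) : ℝ :=
  christoffel (g₂ c) a z t - christoffel (g₂ a) c z t
    - christoffel g₁ a z (jetGamma g₁ F c t) + christoffel g₁ c z (jetGamma g₁ F a t)

/-- The covariant derivative of the curvature tensor, computed from the derivatives of the metric
and the orthonormal frame `F`. -/
def jetCovCurvature (g₁ : E →L[ℝ] E →L[ℝ] E →L[ℝ] ℝ) (g₂ : E →L[ℝ] E →L[ℝ] E →L[ℝ] E →L[ℝ] ℝ)
    (g₃ : E →L[ℝ] E →L[ℝ] E →L[ℝ] E →L[ℝ] E →L[ℝ] ℝ) (F : Fin n → E) (y c a z t : E) : ℝ :=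
  christoffel (g₃ y c) a z t - christoffel (g₃ y a) c z t
    - (christoffel (g₂ y) a z (jetGamma g₁ F c t) + christoffel (g₂ y) c t (jetGamma g₁ F a z)
      - g₁ y (jetGamma g₁ F a z) (jetGamma g₁ F c t))
    + (christoffel (g₂ y) c z (jetGamma g₁ F a t) + christoffel (g₂ y) a t (jetGamma g₁ F c z)
      - g₁ y (jetGamma g₁ F c z) (jetGamma g₁ F a t))
    - jetCurvature g₁ g₂ F (jetGamma g₁ F y c) a z t
    - jetCurvature g₁ g₂ F c (jetGamma g₁ F y a) z t
    - jetCurvature g₁ g₂ F c a (jetGamma g₁ F y z) t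
    - jetCurvature g₁ g₂ F c a z (jetGamma g₁ F y t)

section ContDiff

variable {G : Type*} [NormedAddCommGroup G] [NormedSpace ℝ G]
  {g₁ : G → E →L[ℝ] E →L[ℝ] E →L[ℝ] ℝ} {g₂ : G → E →L[ℝ] E →L[ℝ] E →L[ℝ] E →L[ℝ] ℝ}
  {g₃ : G → E →L[ℝ] E →L[ℝ] E →L[ℝ] E →L[ℝ] E →L[ℝ] ℝ} {F : G → Fin n → E} {y c a z t : G → E}

lemma contDiff_christoffel (h₁ : ContDiff ℝ 1 g₁) (hc : ContDiff ℝ 1 c) (ha : ContDiff ℝ 1 a)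
    (hz : ContDiff ℝ 1 z) : ContDiff ℝ 1 fun x => christoffel (g₁ x) (c x) (a x) (z x) := by
  have key : ∀ {c a z : G → E}, ContDiff ℝ 1 c → ContDiff ℝ 1 a → ContDiff ℝ 1 z →
      ContDiff ℝ 1 fun x => g₁ x (c x) (a x) (z x) := fun hc ha hz =>
    ((h₁.clm_apply hc).clm_apply ha).clm_apply hz
  exact (((key hc ha hz).add (key ha hc hz)).sub (key hz hc ha)).div_const 2

lemma contDiff_jetGamma (h₁ : ContDiff ℝ 1 g₁) (hF : ContDiff ℝ 1 F) (hc : ContDiff ℝ 1 c)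
    (ha : ContDiff ℝ 1 a) : ContDiff ℝ 1 fun x => jetGamma (g₁ x) (F x) (c x) (a x) :=
  ContDiff.sum fun i _ => (contDiff_christoffel h₁ hc ha (contDiff_pi.1 hF i)).smul
    (contDiff_pi.1 hF i)

lemma contDiff_jetCurvature (h₁ : ContDiff ℝ 1 g₁) (h₂ : ContDiff ℝ 1 g₂) (hF : ContDiff ℝ 1 F)
    (hc : ContDiff ℝ 1 c) (ha : ContDiff ℝ 1 a) (hz : ContDiff ℝ 1 z) (ht : ContDiff ℝ 1 t) :
    ContDiff ℝ 1 fun x => jetCurvature (g₁ x) (g₂ x) (F x) (c x) (a x) (z x) (t x) :=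
  (((contDiff_christoffel (h₂.clm_apply hc) ha hz ht).sub
    (contDiff_christoffel (h₂.clm_apply ha) hc hz ht)).sub
    (contDiff_christoffel h₁ ha hz (contDiff_jetGamma h₁ hF hc ht))).add
    (contDiff_christoffel h₁ hc hz (contDiff_jetGamma h₁ hF ha ht))

lemma contDiff_jetCovCurvature (h₁ : ContDiff ℝ 1 g₁) (h₂ : ContDiff ℝ 1 g₂)
    (h₃ : ContDiff ℝ 1 g₃) (hF : ContDiff ℝ 1 F) (hy : ContDiff ℝ 1 y) (hc : ContDiff ℝ 1 c)
    (ha : ContDiff ℝ 1 a) (hz : ContDiff ℝ 1 z) (ht : ContDiff ℝ 1 t) :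
    ContDiff ℝ 1 fun x =>
      jetCovCurvature (g₁ x) (g₂ x) (g₃ x) (F x) (y x) (c x) (a x) (z x) (t x) := by
  have hG : ∀ {u w : G → E}, ContDiff ℝ 1 u → ContDiff ℝ 1 w →
      ContDiff ℝ 1 fun x => jetGamma (g₁ x) (F x) (u x) (w x) := fun hu hw =>
    contDiff_jetGamma h₁ hF hu hw
  have h₂y := h₂.clm_apply hy
  have h₃y := h₃.clm_apply hy
  have hQ : ∀ {a z c t : G → E}, ContDiff ℝ 1 a → ContDiff ℝ 1 z → ContDiff ℝ 1 c →
      ContDiff ℝ 1 t → ContDiff ℝ 1 fun x =>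
        christoffel (g₂ x (y x)) (a x) (z x) (jetGamma (g₁ x) (F x) (c x) (t x))
        + christoffel (g₂ x (y x)) (c x) (t x) (jetGamma (g₁ x) (F x) (a x) (z x))
        - g₁ x (y x) (jetGamma (g₁ x) (F x) (a x) (z x)) (jetGamma (g₁ x) (F x) (c x) (t x)) :=
    fun ha hz hc ht => ((contDiff_christoffel h₂y ha hz (hG hc ht)).add
      (contDiff_christoffel h₂y hc ht (hG ha hz))).sub
      (((h₁.clm_apply hy).clm_apply (hG ha hz)).clm_apply (hG hc ht))
  exact (((((((contDiff_christoffel (h₃y.clm_apply hc) ha hz ht).sub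
    (contDiff_christoffel (h₃y.clm_apply ha) hc hz ht)).sub (hQ ha hz hc ht)).add
    (hQ hc hz ha ht)).sub (contDiff_jetCurvature h₁ h₂ hF (hG hy hc) ha hz ht)).sub
    (contDiff_jetCurvature h₁ h₂ hF hc (hG hy ha) hz ht)).sub
    (contDiff_jetCurvature h₁ h₂ hF hc ha (hG hy hz) ht)).sub
    (contDiff_jetCurvature h₁ h₂ hF hc ha hz (hG hy ht))

end ContDiff

/-- The component of the curvature tensor which obstructs Carleman weights in dimension at
least four. -/
def weylObstruction {m : ℕ} (g₁ : E →L[ℝ] E →L[ℝ] E →L[ℝ] ℝ)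
    (g₂ : E →L[ℝ] E →L[ℝ] E →L[ℝ] E →L[ℝ] ℝ) (F : Fin (m + 4) → E) : ℝ :=
  jetCurvature g₁ g₂ F (F 1) (F 2) (F 0) (F 3)

/-- The component of the Cotton tensor which obstructs Carleman weights in dimension three. -/
def cottonObstruction (g₁ : E →L[ℝ] E →L[ℝ] E →L[ℝ] ℝ)
    (g₂ : E →L[ℝ] E →L[ℝ] E →L[ℝ] E →L[ℝ] ℝ) (g₃ : E →L[ℝ] E →L[ℝ] E →L[ℝ] E →L[ℝ] E →L[ℝ] ℝ)
    (F : Fin 3 → E) : ℝ :=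
  jetCovCurvature g₁ g₂ g₃ F (F 0) (F 0) (F 2) (F 0) (F 1)
    - jetCovCurvature g₁ g₂ g₃ F (F 2) (F 1) (F 2) (F 0) (F 2)

lemma contDiff_weylObstruction {m : ℕ} (g₁ : E →L[ℝ] E →L[ℝ] E →L[ℝ] ℝ)
    (g₂ : E →L[ℝ] E →L[ℝ] E →L[ℝ] E →L[ℝ] ℝ) :
    ContDiff ℝ 1 fun F : Fin (m + 4) → E => weylObstruction g₁ g₂ F :=
  contDiff_jetCurvature contDiff_const contDiff_const contDiff_id (contDiff_apply ℝ E 1)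
    (contDiff_apply ℝ E 2) (contDiff_apply ℝ E 0) (contDiff_apply ℝ E 3)

lemma contDiff_cottonObstruction (g₁ : E →L[ℝ] E →L[ℝ] E →L[ℝ] ℝ)
    (g₂ : E →L[ℝ] E →L[ℝ] E →L[ℝ] E →L[ℝ] ℝ)
    (g₃ : E →L[ℝ] E →L[ℝ] E →L[ℝ] E →L[ℝ] E →L[ℝ] ℝ) :
    ContDiff ℝ 1 fun F : Fin 3 → E => cottonObstruction g₁ g₂ g₃ F := by
  have h₁ : ContDiff ℝ 1 fun _ : Fin 3 → E => g₁ := contDiff_const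
  have h₂ : ContDiff ℝ 1 fun _ : Fin 3 → E => g₂ := contDiff_const
  have h₃ : ContDiff ℝ 1 fun _ : Fin 3 → E => g₃ := contDiff_const
  have h (i : Fin 3) : ContDiff ℝ 1 fun F : Fin 3 → E => F i := contDiff_apply ℝ E i
  exact (contDiff_jetCovCurvature h₁ h₂ h₃ contDiff_id (h 0) (h 0) (h 2) (h 0) (h 1)).sub
    (contDiff_jetCovCurvature h₁ h₂ h₃ contDiff_id (h 2) (h 1) (h 2) (h 0) (h 2))

section Continuous

variable {X : Type*} [TopologicalSpace X] {g₁ : X → E →L[ℝ] E →L[ℝ] E →L[ℝ] ℝ}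
  {g₂ : X → E →L[ℝ] E →L[ℝ] E →L[ℝ] E →L[ℝ] ℝ}
  {g₃ : X → E →L[ℝ] E →L[ℝ] E →L[ℝ] E →L[ℝ] E →L[ℝ] ℝ} {F : X → Fin n → E}
  {y c a z t : X → E}

lemma continuous_christoffel (h₁ : Continuous g₁) (hc : Continuous c) (ha : Continuous a)
    (hz : Continuous z) : Continuous fun x => christoffel (g₁ x) (c x) (a x) (z x) := by
  have key : ∀ {c a z : X → E}, Continuous c → Continuous a → Continuous z →
      Continuous fun x => g₁ x (c x) (a x) (z x) := fun hc ha hz =>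
    ((h₁.clm_apply hc).clm_apply ha).clm_apply hz
  exact (((key hc ha hz).add (key ha hc hz)).sub (key hz hc ha)).div_const 2

lemma continuous_jetGamma (h₁ : Continuous g₁) (hF : Continuous F) (hc : Continuous c)
    (ha : Continuous a) : Continuous fun x => jetGamma (g₁ x) (F x) (c x) (a x) :=
  continuous_finsetSum _ fun i _ => (continuous_christoffel h₁ hc ha
    (continuous_pi_iff.1 hF i)).smul (continuous_pi_iff.1 hF i)

lemma continuous_jetCurvature (h₁ : Continuous g₁) (h₂ : Continuous g₂) (hF : Continuous F)
    (hc : Continuous c) (ha : Continuous a) (hz : Continuous z) (ht : Continuous t) :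
    Continuous fun x => jetCurvature (g₁ x) (g₂ x) (F x) (c x) (a x) (z x) (t x) :=
  (((continuous_christoffel (h₂.clm_apply hc) ha hz ht).sub
    (continuous_christoffel (h₂.clm_apply ha) hc hz ht)).sub
    (continuous_christoffel h₁ ha hz (continuous_jetGamma h₁ hF hc ht))).add
    (continuous_christoffel h₁ hc hz (continuous_jetGamma h₁ hF ha ht))

lemma continuous_jetCovCurvature (h₁ : Continuous g₁) (h₂ : Continuous g₂)
    (h₃ : Continuous g₃) (hF : Continuous F) (hy : Continuous y) (hc : Continuous c)
    (ha : Continuous a) (hz : Continuous z) (ht : Continuous t) :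
    Continuous fun x =>
      jetCovCurvature (g₁ x) (g₂ x) (g₃ x) (F x) (y x) (c x) (a x) (z x) (t x) := by
  have hG : ∀ {u w : X → E}, Continuous u → Continuous w →
      Continuous fun x => jetGamma (g₁ x) (F x) (u x) (w x) := fun hu hw =>
    continuous_jetGamma h₁ hF hu hw
  have h₂y := h₂.clm_apply hy
  have h₃y := h₃.clm_apply hy
  have hQ : ∀ {a z c t : X → E}, Continuous a → Continuous z → Continuous c →
      Continuous t → Continuous fun x =>
        christoffel (g₂ x (y x)) (a x) (z x) (jetGamma (g₁ x) (F x) (c x) (t x))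
        + christoffel (g₂ x (y x)) (c x) (t x) (jetGamma (g₁ x) (F x) (a x) (z x))
        - g₁ x (y x) (jetGamma (g₁ x) (F x) (a x) (z x)) (jetGamma (g₁ x) (F x) (c x) (t x)) :=
    fun ha hz hc ht => ((continuous_christoffel h₂y ha hz (hG hc ht)).add
      (continuous_christoffel h₂y hc ht (hG ha hz))).sub
      (((h₁.clm_apply hy).clm_apply (hG ha hz)).clm_apply (hG hc ht))
  exact (((((((continuous_christoffel (h₃y.clm_apply hc) ha hz ht).sub
    (continuous_christoffel (h₃y.clm_apply ha) hc hz ht)).sub (hQ ha hz hc ht)).add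
    (hQ hc hz ha ht)).sub (continuous_jetCurvature h₁ h₂ hF (hG hy hc) ha hz ht)).sub
    (continuous_jetCurvature h₁ h₂ hF hc (hG hy ha) hz ht)).sub
    (continuous_jetCurvature h₁ h₂ hF hc ha (hG hy hz) ht)).sub
    (continuous_jetCurvature h₁ h₂ hF hc ha hz (hG hy ht))

lemma continuous_weylObstruction {m : ℕ} {F : X → Fin (m + 4) → E} (h₁ : Continuous g₁)
    (h₂ : Continuous g₂) (hF : Continuous F) :
    Continuous fun x => weylObstruction (g₁ x) (g₂ x) (F x) :=
  continuous_jetCurvature h₁ h₂ hF (continuous_pi_iff.1 hF 1) (continuous_pi_iff.1 hF 2)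
    (continuous_pi_iff.1 hF 0) (continuous_pi_iff.1 hF 3)

lemma continuous_cottonObstruction {F : X → Fin 3 → E} (h₁ : Continuous g₁) (h₂ : Continuous g₂)
    (h₃ : Continuous g₃) (hF : Continuous F) :
    Continuous fun x => cottonObstruction (g₁ x) (g₂ x) (g₃ x) (F x) :=
  have hi := fun i => continuous_pi_iff.1 hF i
  (continuous_jetCovCurvature h₁ h₂ h₃ hF (hi 0) (hi 0) (hi 2) (hi 0) (hi 1)).sub
    (continuous_jetCovCurvature h₁ h₂ h₃ hF (hi 2) (hi 1) (hi 2) (hi 0) (hi 2))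

end Continuous

variable {Ω : Set E} {g : E → E →L[ℝ] E →L[ℝ] ℝ} {Γ : E → E →L[ℝ] E →L[ℝ] E}

/-- Expanding in an orthonormal frame replaces the inverse metric. The jet expressions are thus
polynomial in the derivatives and the frame, and make sense and are smooth even off orthonormal
frames. -/
lemma IsLeviCivitaOn.jetGamma_eq [FiniteDimensional ℝ E] (h : IsLeviCivitaOn Ω g Γ) {x : E}
    (hx : x ∈ Ω) {F : Fin n → E} (hF : IsOrthoFrame (g x) F) (hn : Module.finrank ℝ E = n)
    (a b : E) : jetGamma (fderiv ℝ g x) F a b = Γ x a b := by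
  simp only [jetGamma, ← h.metric_apply x hx]
  exact hF.sum_smul hn _

lemma IsLeviCivitaOn.jetCurvature_eq [FiniteDimensional ℝ E] (h : IsLeviCivitaOn Ω g Γ) {x : E}
    (hx : x ∈ Ω) {F : Fin n → E} (hF : IsOrthoFrame (g x) F) (hn : Module.finrank ℝ E = n)
    (c a z t : E) : jetCurvature (fderiv ℝ g x) (fderiv ℝ (fderiv ℝ g) x) F c a z t
      = g x (curvature Γ x c a z) t := by
  rw [h.metric_curvature hx, jetCurvature, h.jetGamma_eq hx hF hn, h.jetGamma_eq hx hF hn,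
    ← h.metric_apply x hx, ← h.metric_apply x hx]

lemma IsLeviCivitaOn.jetCovCurvature_eq [FiniteDimensional ℝ E] (h : IsLeviCivitaOn Ω g Γ)
    {x : E} (hx : x ∈ Ω) {F : Fin n → E} (hF : IsOrthoFrame (g x) F)
    (hn : Module.finrank ℝ E = n) (y c a z t : E) :
    jetCovCurvature (fderiv ℝ g x) (fderiv ℝ (fderiv ℝ g) x)
      (fderiv ℝ (fderiv ℝ (fderiv ℝ g)) x) F y c a z t = g x (covCurvature Γ x y c a z) t := by
  rw [h.metric_covCurvature hx, jetCovCurvature]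
  simp only [h.jetGamma_eq hx hF hn, h.jetCurvature_eq hx hF hn]

variable {V A : E → E} {μ : E → ℝ}

lemma IsCarlemanField.weylObstruction_eq_zero [FiniteDimensional ℝ E] {m : ℕ}
    (h : IsCarlemanField Ω g Γ V A μ) {x : E} (hx : x ∈ Ω) {F : Fin (m + 4) → E}
    (hF : IsOrthoFrame (g x) F) (hn : Module.finrank ℝ E = m + 4) {t : ℝ} (hV : F 0 = t • V x)
    (ht : t ≠ 0) : weylObstruction (fderiv ℝ g x) (fderiv ℝ (fderiv ℝ g) x) F = 0 := by
  have h0 : ∀ i, i ≠ 0 → g x (V x) (F i) = 0 := by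
    intro i hi
    have := hF 0 i
    rw [hV, if_neg (Ne.symm hi), map_smul, smul_apply, smul_eq_mul] at this
    exact (mul_eq_zero.1 this).resolve_left ht
  rw [weylObstruction, h.jetCurvature_eq hx hF hn, hV, map_smul, map_smul, smul_apply,
    h.metric_curvature_field_eq_zero hx (h0 1 ?_) (h0 2 ?_) ?_ ?_, smul_zero]
  · simp
  · exact fin_ne (by simp [two_mod])
  · rw [hF, if_neg (fin_ne (by simp [three_mod]))]
  · rw [hF, if_neg (fin_ne (by simp [two_mod, three_mod]))]

/-- The two components in `cotton_eq_zero` are cubic and linear in V. Its weight |V|² makes both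
sides scale alike once t²|V|² = 1. -/
lemma IsCarlemanField.cottonObstruction_eq_zero [FiniteDimensional ℝ E]
    (h : IsCarlemanField Ω g Γ V A μ) {x : E} (hx : x ∈ Ω) {F : Fin 3 → E}
    (hF : IsOrthoFrame (g x) F) (hn : Module.finrank ℝ E = 3) {t : ℝ} (hV : F 0 = t • V x)
    (ht : t ≠ 0) : cottonObstruction (fderiv ℝ g x) (fderiv ℝ (fderiv ℝ g) x)
      (fderiv ℝ (fderiv ℝ (fderiv ℝ g)) x) F = 0 := by
  have h0 : ∀ i, i ≠ 0 → g x (V x) (F i) = 0 := by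
    intro i hi
    have := hF 0 i
    rw [hV, if_neg (Ne.symm hi), map_smul, smul_apply, smul_eq_mul] at this
    exact (mul_eq_zero.1 this).resolve_left ht
  have h1 : t * (t * g x (V x) (V x)) = 1 := by
    have := hF 0 0
    rwa [hV, if_pos rfl, map_smul, map_smul, smul_apply, smul_eq_mul, smul_eq_mul] at this
  have h2 : g x (F 2) (F 2) = 1 := by rw [hF, if_pos rfl]
  have hcot := h.cotton_eq_zero hx (h0 1 (by decide)) (h0 2 (by decide))
    (by rw [hF, if_neg (by decide)]) ⟨g x (A x) (F 0) * t, g x (A x) (F 1), g x (A x) (F 2), by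
      conv_lhs => rw [← hF.sum_smul hn (A x)]
      rw [Fin.sum_univ_three, mul_smul, ← hV]⟩
  rw [h2, one_mul] at hcot
  rw [cottonObstruction, h.jetCovCurvature_eq hx hF hn, h.jetCovCurvature_eq hx hF hn, hV]
  -- `covCurvature` is not bundled as a multilinear map, so homogeneity is checked slot by slot,
  -- including inside the derivative, where the direction is frozen at the point.
  have hlin : covCurvature Γ x (t • V x) (t • V x) (F 2) (t • V x)
      = (t * t * t) • covCurvature Γ x (V x) (V x) (F 2) (V x) := by
    have hcl : ∀ c, curvature Γ x (t • c) (F 2) = t • curvature Γ x c (F 2) := by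
      intro c
      ext z
      simp only [curvature_apply, smul_apply, map_smul]
      module
    have hcl2 : ∀ a, curvature Γ x (t • V x) a = t • curvature Γ x (V x) a := by
      intro a
      ext z
      simp only [curvature_apply, smul_apply, map_smul]
      module
    have hcr : ∀ a, curvature Γ x (V x) (t • a) = t • curvature Γ x (V x) a := by
      intro a
      ext z
      simp only [curvature_apply, smul_apply, map_smul]
      module
    have hd : fderiv ℝ (fun x' => curvature Γ x' (t • V x) (F 2)) x
        = t • fderiv ℝ (fun x' => curvature Γ x' (V x) (F 2)) x := by
      rw [← fderiv_fun_const_smul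
        ((h.contDiffOn_curvature (V x) (F 2)).differentiableAt_of_mem h.isOpen hx)]
      congr 1
      ext x' z
      simp only [curvature_apply, smul_apply, map_smul]
      module
    simp only [covCurvature, hd, smul_apply, map_smul, hcl, hcl2, hcr]
    module
  have hlin2 : covCurvature Γ x (F 2) (F 1) (F 2) (t • V x)
      = t • covCurvature Γ x (F 2) (F 1) (F 2) (V x) := by
    simp only [covCurvature, map_smul]
    module
  rw [hlin, hlin2]
  simp only [map_smul, smul_apply, smul_eq_mul, hcot]
  linear_combination (t * g x (covCurvature Γ x (F 2) (F 1) (F 2) (V x)) (F 2)) * h1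

end Jets

end CarlemanWeights

end

noncomputable section

namespace CarlemanWeights

set_option maxSynthPendingDepth 6

/-! ### The algebraic consequence of the bracket condition -/

section Algebra

variable {E : Type*} [NormedAddCommGroup E] [NormedSpace ℝ E]

/-- The form of a symmetric bilinear map which is, on the sphere of radius `|V|` in the orthogonal
complement of `V`, equal to the opposite of its value at `V`. -/
lemma bilinear_eq_of_orthogonal {B H : E → E →L[ℝ] ℝ} {V : E}
    (hBadd : ∀ a b c, B (a + b) c = B a c + B b c) (hBsmul : ∀ (t : ℝ) a c, B (t • a) c = t * B a c)
    (hHadd : ∀ a b c, H (a + b) c = H a c + H b c) (hHsmul : ∀ (t : ℝ) a c, H (t • a) c = t * H a c)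
    (hB : ∀ a b, B a b = B b a) (hH : ∀ a b, H a b = H b a) (hpos : ∀ a, a ≠ 0 → 0 < B a a)
    (hV : V ≠ 0) (h : ∀ X, B V X = 0 → B X X = B V V → H X X + H V V = 0) (a b : E) :
    H a b = - (H V V / B V V) * B a b + H a V / B V V * B V b + B V a * (H b V / B V V) := by
  have hN := hpos V hV
  set N := B V V
  -- Rescaling X to the length of V turns the hypothesis into a homogeneous identity on the
  -- orthogonal complement of V. It is then polarized, and the general case follows by projecting
  -- off V.
  have key : ∀ X, B V X = 0 → H X X = - (H V V / N) * B X X := by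
    intro X hX
    by_cases h0 : X = 0
    · subst h0; simp
    have hXX := hpos X h0
    have hs : 0 < √(N / B X X) := Real.sqrt_pos.2 (by positivity)
    have hss : √(N / B X X) * √(N / B X X) = N / B X X := Real.mul_self_sqrt (by positivity)
    have h1 := h (√(N / B X X) • X) (by simp [hX]) (by
      rw [hBsmul, map_smul, smul_eq_mul, ← mul_assoc, hss]; field_simp)
    rw [hHsmul, map_smul, smul_eq_mul, ← mul_assoc, hss] at h1
    field_simp at h1 ⊢
    linarith
  have key2 : ∀ X Y, B V X = 0 → B V Y = 0 → H X Y = - (H V V / N) * B X Y := by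
    intro X Y hX hY
    have h1 := key (X + Y) (by rw [map_add, hX, hY, add_zero])
    have h2 := key X hX
    have h3 := key Y hY
    simp only [hHadd, hBadd, map_add, hH Y X, hB Y X] at h1
    linarith
  have hproj : ∀ X, B V (X + (-(B V X / N)) • V) = 0 := by
    intro X
    rw [map_add, map_smul, smul_eq_mul]
    change B V X + -(B V X / N) * N = 0
    field_simp
    ring
  have h1 := key2 _ _ (hproj a) (hproj b)
  simp only [hHadd, hHsmul, hBadd, hBsmul, map_add, map_smul, smul_eq_mul, hH V b, hB a V] at h1
  change _ = -(H V V / N) * (_ + _ + _ * (_ + _ * N)) at h1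
  have e : H a b = H a b + -(B V b / N) * H a V + -(B V a / N) * (H b V + -(B V b / N) * H V V)
      + (B V b / N) * H a V + (B V a / N) * (H b V + -(B V b / N) * H V V) := by ring
  rw [e, h1]
  field_simp
  ring

end Algebra

/-! ### Metrics given by matrices of functions -/

section Coordinates

variable {n : ℕ}

/-- The bilinear form on the coordinate space with matrix `m`. -/
def coordBil (m : Matrix (Fin n) (Fin n) ℝ) : Coord n →L[ℝ] Coord n →L[ℝ] ℝ :=
  ∑ i, ∑ j, m i j • (EuclideanSpace.proj i : Coord n →L[ℝ] ℝ).smulRight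
    (EuclideanSpace.proj j : Coord n →L[ℝ] ℝ)

lemma coordBil_apply (m : Matrix (Fin n) (Fin n) ℝ) (a b : Coord n) :
    coordBil m a b = ∑ i, ∑ j, m i j * (a i * b j) := by
  simp [coordBil, sum_apply]

/-- The linear map from covectors to vectors with matrix `m`. -/
def coordSharp (m : Matrix (Fin n) (Fin n) ℝ) : (Coord n →L[ℝ] ℝ) →L[ℝ] Coord n :=
  ∑ i, ∑ j, m i j • (ContinuousLinearMap.apply ℝ ℝ (EuclideanSpace.single j (1 : ℝ))).smulRight
    (EuclideanSpace.single i (1 : ℝ) : Coord n)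

lemma coordSharp_apply (m : Matrix (Fin n) (Fin n) ℝ) (θ : Coord n →L[ℝ] ℝ) :
    coordSharp m θ = ∑ i, ∑ j, (m i j * θ (EuclideanSpace.single j (1 : ℝ))) •
      (EuclideanSpace.single i (1 : ℝ) : Coord n) := by
  simp [coordSharp, sum_apply, smul_smul]

lemma coordSharp_coord (m : Matrix (Fin n) (Fin n) ℝ) (θ : Coord n →L[ℝ] ℝ) (k : Fin n) :
    coordSharp m θ k = ∑ j, m k j * θ (EuclideanSpace.single j (1 : ℝ)) := by
  simp [coordSharp_apply, Pi.single_apply]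

lemma coord_eq_sum (a : Coord n) :
    a = ∑ i, a i • (EuclideanSpace.single i (1 : ℝ) : Coord n) := by
  ext k
  simp [Pi.single_apply]

lemma clm_apply_eq_sum (θ : Coord n →L[ℝ] ℝ) (a : Coord n) :
    θ a = ∑ i, a i * θ (EuclideanSpace.single i (1 : ℝ)) := by
  conv_lhs => rw [coord_eq_sum a]
  simp

lemma apply_coordSharp (m : Matrix (Fin n) (Fin n) ℝ) (θ η : Coord n →L[ℝ] ℝ) :
    η (coordSharp m θ) = ∑ i, ∑ j, m i j *
      (η (EuclideanSpace.single i (1 : ℝ)) * θ (EuclideanSpace.single j (1 : ℝ))) := by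
  rw [clm_apply_eq_sum]
  simp only [coordSharp_coord, Finset.sum_mul]
  exact Finset.sum_congr rfl fun i _ => Finset.sum_congr rfl fun j _ => by ring

lemma coordBil_single (m : Matrix (Fin n) (Fin n) ℝ) (a : Coord n) (k : Fin n) :
    coordBil m a (EuclideanSpace.single k (1 : ℝ)) = ∑ i, m i k * a i := by
  simp [coordBil_apply]

lemma coordBil_symm {m : Matrix (Fin n) (Fin n) ℝ} (hm : m.IsSymm) (a b : Coord n) :
    coordBil m a b = coordBil m b a := by
  rw [coordBil_apply, coordBil_apply, Finset.sum_comm]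
  refine Finset.sum_congr rfl fun i _ => Finset.sum_congr rfl fun j _ => ?_
  rw [hm.apply i j]
  ring

lemma coordBil_coordSharp {m : Matrix (Fin n) (Fin n) ℝ} (hm : m.IsSymm) (hdet : m.det ≠ 0)
    (θ : Coord n →L[ℝ] ℝ) (b : Coord n) : coordBil m (coordSharp m⁻¹ θ) b = θ b := by
  rw [clm_apply_eq_sum (coordBil m _) b, clm_apply_eq_sum θ b]
  refine Finset.sum_congr rfl fun k _ => ?_
  congr 1
  rw [coordBil_single]
  simp only [coordSharp_coord, Finset.mul_sum]
  rw [Finset.sum_comm]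
  have h1 : m * m⁻¹ = 1 := Matrix.mul_nonsing_inv m (Ne.isUnit hdet)
  have h2 : ∀ j, ∑ i, m i k * (m⁻¹ i j * θ (EuclideanSpace.single j (1 : ℝ)))
      = (1 : Matrix (Fin n) (Fin n) ℝ) k j * θ (EuclideanSpace.single j (1 : ℝ)) := by
    intro j
    rw [← h1, Matrix.mul_apply, Finset.sum_mul]
    refine Finset.sum_congr rfl fun i _ => ?_
    rw [hm.apply i k]
    ring
  simp only [h2]
  simp [Matrix.one_apply]

/-- A null vector of the matrix would be isotropic. -/
lemma det_ne_zero_of_pos {m : Matrix (Fin n) (Fin n) ℝ}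
    (hpos : ∀ a, a ≠ 0 → 0 < coordBil m a a) : m.det ≠ 0 := by
  intro h
  obtain ⟨v, hv, hmv⟩ := Matrix.exists_mulVec_eq_zero_iff.2 h
  have h1 := hpos (WithLp.toLp 2 v) (by simpa using hv)
  have h2 : coordBil m (WithLp.toLp 2 v) (WithLp.toLp 2 v) = ∑ i, v i * m.mulVec v i := by
    simp only [coordBil_apply, Matrix.mulVec, dotProduct, Finset.mul_sum]
    exact Finset.sum_congr rfl fun i _ => Finset.sum_congr rfl fun j _ => by ring
  rw [h2, hmv] at h1
  simp at h1

/-- A smooth family of symmetric positive definite matrices on an open set. -/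
structure IsMetricOn (Ω : Set (Coord n)) (m : Coord n → Matrix (Fin n) (Fin n) ℝ) : Prop where
  isOpen : IsOpen Ω
  smooth : ∀ i j, ContDiffOn ℝ ∞ (fun x => m x i j) Ω
  symm : ∀ x ∈ Ω, (m x).IsSymm
  pos : ∀ x ∈ Ω, ∀ a, a ≠ 0 → 0 < coordBil (m x) a a

variable {Ω : Set (Coord n)} {m : Coord n → Matrix (Fin n) (Fin n) ℝ}

lemma contDiffOn_det {k : ℕ} {p : Coord n → Matrix (Fin k) (Fin k) ℝ}
    (hp : ∀ i j, ContDiffOn ℝ ∞ (fun x => p x i j) Ω) :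
    ContDiffOn ℝ ∞ (fun x => (p x).det) Ω := by
  simp only [Matrix.det_apply]
  exact ContDiffOn.sum fun σ _ => (contDiffOn_prod fun i _ => hp _ _).const_smul _

namespace IsMetricOn

lemma det_ne_zero (h : IsMetricOn Ω m) {x : Coord n} (hx : x ∈ Ω) : (m x).det ≠ 0 :=
  det_ne_zero_of_pos (h.pos x hx)

lemma smooth_inv (h : IsMetricOn Ω m) (i j : Fin n) :
    ContDiffOn ℝ ∞ (fun x => (m x)⁻¹ i j) Ω := by
  have hdet := contDiffOn_det h.smooth
  have hadj : ContDiffOn ℝ ∞ (fun x => (m x).adjugate i j) Ω := by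
    simp only [Matrix.adjugate_apply]
    refine contDiffOn_det fun k l => ?_
    simp only [Matrix.updateRow_apply]
    split_ifs
    · exact contDiffOn_const
    · exact h.smooth k l
  refine ((hdet.inv fun x hx => h.det_ne_zero hx).mul hadj).congr fun x hx => ?_
  simp [Matrix.inv_def, Ring.inverse_eq_inv']

lemma smooth_coordBil (h : IsMetricOn Ω m) : ContDiffOn ℝ ∞ (fun x => coordBil (m x)) Ω :=
  ContDiffOn.sum fun i _ => ContDiffOn.sum fun j _ => (h.smooth i j).smul contDiffOn_const

lemma smooth_coordSharp (h : IsMetricOn Ω m) : ContDiffOn ℝ ∞ (fun x => coordSharp (m x)⁻¹) Ω :=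
  ContDiffOn.sum fun i _ => ContDiffOn.sum fun j _ => (h.smooth_inv i j).smul contDiffOn_const

lemma coordBil_coordSharp (h : IsMetricOn Ω m) {x : Coord n} (hx : x ∈ Ω) (θ : Coord n →L[ℝ] ℝ)
    (b : Coord n) : coordBil (m x) (coordSharp (m x)⁻¹ θ) b = θ b :=
  CarlemanWeights.coordBil_coordSharp (h.symm x hx) (h.det_ne_zero hx) θ b

end IsMetricOn

/-- The Christoffel symbols of the first kind as a continuous multilinear map. -/
def christoffelL (g₁ : Coord n →L[ℝ] Coord n →L[ℝ] Coord n →L[ℝ] ℝ) :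
    Coord n →L[ℝ] Coord n →L[ℝ] Coord n →L[ℝ] ℝ :=
  (1 / 2 : ℝ) • (g₁ + g₁.flip - (ContinuousLinearMap.flipₗᵢ ℝ (Coord n) (Coord n)
    ℝ).toContinuousLinearEquiv.toContinuousLinearMap.comp g₁.flip)

lemma christoffelL_apply (g₁ : Coord n →L[ℝ] Coord n →L[ℝ] Coord n →L[ℝ] ℝ) (a b c : Coord n) :
    christoffelL g₁ a b c = christoffel g₁ a b c := by
  simp [christoffelL, christoffel]
  ring

/-- The Christoffel symbols of the second kind of the metric with matrix `m`. -/
def coordGamma (m : Coord n → Matrix (Fin n) (Fin n) ℝ) (x : Coord n) :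
    Coord n →L[ℝ] Coord n →L[ℝ] Coord n :=
  (ContinuousLinearMap.compL ℝ (Coord n) (Coord n →L[ℝ] ℝ) (Coord n) (coordSharp (m x)⁻¹)).comp
    (christoffelL (fderiv ℝ (fun y => coordBil (m y)) x))

lemma coordGamma_apply (x a b : Coord n) : coordGamma m x a b
    = coordSharp (m x)⁻¹ (christoffelL (fderiv ℝ (fun y => coordBil (m y)) x) a b) := rfl

lemma IsMetricOn.isLeviCivitaOn (h : IsMetricOn Ω m) :
    IsLeviCivitaOn Ω (fun x => coordBil (m x)) (coordGamma m) where
  isOpen := h.isOpen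
  metric_smooth := h.smooth_coordBil
  smooth := by
    rw [contDiffOn_clm_apply]
    intro a
    rw [contDiffOn_clm_apply]
    intro b
    simp only [coordGamma_apply]
    refine h.smooth_coordSharp.clm_apply ?_
    rw [contDiffOn_clm_apply]
    intro c
    simp only [christoffelL_apply, christoffel]
    have h1 := h.smooth_coordBil.fderiv_infty h.isOpen
    have key : ∀ a b c, ContDiffOn ℝ ∞
        (fun x => fderiv ℝ (fun y => coordBil (m y)) x a b c) Ω := fun a b c =>
      ((h1.clm_apply contDiffOn_const).clm_apply contDiffOn_const).clm_apply contDiffOn_const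
    exact (((key a b c).add (key b a c)).sub (key c a b)).div_const 2
  metric_symm x hx a b := coordBil_symm (h.symm x hx) a b
  nondegenerate x hx a ha := by
    by_contra h0
    exact (h.pos x hx a h0).ne' (ha a)
  metric_apply x hx a b c := by
    rw [coordGamma_apply, h.coordBil_coordSharp hx, christoffelL_apply]

end Coordinates

end CarlemanWeights

end

noncomputable section

namespace CarlemanWeights

set_option maxSynthPendingDepth 6

/-! ### From the bracket condition to a Carleman field -/

section Bracket

variable {n : ℕ}

/-- The real part of the conjugated symbol for the metric with matrix `m`. -/
def localRe (m : Coord n → Matrix (Fin n) (Fin n) ℝ) (φ : Coord n → ℝ) (x ξ : Coord n) : ℝ :=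
  ∑ i, ∑ j, (m x)⁻¹ i j * (ξ i * ξ j - partialDeriv i φ x * partialDeriv j φ x)

/-- The imaginary part of the conjugated symbol for the metric with matrix `m`. -/
def localIm (m : Coord n → Matrix (Fin n) (Fin n) ℝ) (φ : Coord n → ℝ) (x ξ : Coord n) : ℝ :=
  2 * ∑ i, ∑ j, (m x)⁻¹ i j * (ξ i * partialDeriv j φ x)

variable {Ω : Set (Coord n)} {m : Coord n → Matrix (Fin n) (Fin n) ℝ} {φ : Coord n → ℝ}

lemma innerSL_single (ξ : Coord n) (i : Fin n) :
    innerSL ℝ ξ (EuclideanSpace.single i (1 : ℝ)) = ξ i := by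
  simp [EuclideanSpace.inner_single_right]

lemma localRe_eq (x ξ : Coord n) : localRe m φ x ξ =
    innerSL ℝ ξ (coordSharp (m x)⁻¹ (innerSL ℝ ξ))
      - fderiv ℝ φ x (coordSharp (m x)⁻¹ (fderiv ℝ φ x)) := by
  simp only [apply_coordSharp, innerSL_single, localRe, mul_sub, Finset.sum_sub_distrib,
    partialDeriv]

lemma localIm_eq (x ξ : Coord n) : localIm m φ x ξ =
    2 * innerSL ℝ ξ (coordSharp (m x)⁻¹ (fderiv ℝ φ x)) := by
  simp only [apply_coordSharp, innerSL_single, localIm, partialDeriv]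

namespace IsMetricOn

lemma apply_coordSharp_comm (h : IsMetricOn Ω m) {x : Coord n} (hx : x ∈ Ω)
    (θ η : Coord n →L[ℝ] ℝ) :
    η (coordSharp (m x)⁻¹ θ) = θ (coordSharp (m x)⁻¹ η) := by
  rw [← h.coordBil_coordSharp hx η, ← h.coordBil_coordSharp hx θ,
    coordBil_symm (h.symm x hx)]

/-- The derivative of an inverse, ∂(g⁻¹) = -g⁻¹(∂g)g⁻¹, obtained by differentiating g(g⁻¹θ,b) =
θ(b). -/
lemma apply_fderiv_coordSharp (h : IsMetricOn Ω m) {x : Coord n} (hx : x ∈ Ω) (u : Coord n)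
    (θ η : Coord n →L[ℝ] ℝ) :
    η (fderiv ℝ (fun y => coordSharp (m y)⁻¹) x u θ)
      = - fderiv ℝ (fun y => coordBil (m y)) x u (coordSharp (m x)⁻¹ θ)
        (coordSharp (m x)⁻¹ η) := by
  have hg := h.smooth_coordBil.differentiableAt_of_mem h.isOpen hx
  have hS := h.smooth_coordSharp.differentiableAt_of_mem h.isOpen hx
  have h1 := congrFun (congrArg DFunLike.coe (fderiv_congr_of_isOpen h.isOpen hx
    fun y hy => h.coordBil_coordSharp hy θ (coordSharp (m x)⁻¹ η))) u
  rw [fderiv_clm_apply₂ hg (by fun_prop) (by fun_prop), fderiv_clm_apply_const hS] at h1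
  simp only [fderiv_fun_const, Pi.zero_apply, zero_apply, map_zero, add_zero] at h1
  rw [coordBil_symm (h.symm x hx) (fderiv ℝ (fun y => coordSharp (m y)⁻¹) x u θ), h.coordBil_coordSharp hx] at h1
  linarith

/-- The fibre derivatives of the real and imaginary parts are twice the vectors dual to ξ and dφ, so
the bracket becomes two directional derivatives in the base. -/
lemma poissonBracket_eq (h : IsMetricOn Ω m) {x : Coord n} (hx : x ∈ Ω)
    (ξ : Coord n) :
    poissonBracket (localRe m φ) (localIm m φ) x ξ =
      2 * fderiv ℝ (fun y => localIm m φ y ξ) x (coordSharp (m x)⁻¹ (innerSL ℝ ξ))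
        - 2 * fderiv ℝ (fun y => localRe m φ y ξ) x (coordSharp (m x)⁻¹ (fderiv ℝ φ x)) := by
  have dI : DifferentiableAt ℝ (fun η : Coord n => innerSL ℝ η) ξ :=
    (innerSL ℝ : Coord n →L[ℝ] Coord n →L[ℝ] ℝ).differentiableAt
  have dS : DifferentiableAt ℝ (fun η : Coord n => coordSharp (m x)⁻¹ (innerSL ℝ η)) ξ :=
    ((coordSharp (m x)⁻¹).comp (innerSL ℝ : Coord n →L[ℝ] Coord n →L[ℝ] ℝ)).differentiableAt
  have hI : ∀ (i : Fin n) (v : Coord n), innerSL ℝ (EuclideanSpace.single i (1 : ℝ)) v = v i := by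
    intro i v
    rw [innerSL_apply_apply, EuclideanSpace.inner_single_left]
    simp
  have e1 : ∀ i, partialDeriv i (fun η => localRe m φ x η) ξ
      = 2 * coordSharp (m x)⁻¹ (innerSL ℝ ξ) i := by
    intro i
    simp only [partialDeriv, localRe_eq]
    rw [fderiv_sub_const, fderiv_clm_apply_apply dI dS]
    have h1 : fderiv ℝ (fun η : Coord n => innerSL ℝ η) ξ = innerSL ℝ :=
      (innerSL ℝ : Coord n →L[ℝ] Coord n →L[ℝ] ℝ).fderiv
    have h2 : fderiv ℝ (fun η : Coord n => coordSharp (m x)⁻¹ (innerSL ℝ η)) ξ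
        = (coordSharp (m x)⁻¹).comp (innerSL ℝ) :=
      ((coordSharp (m x)⁻¹).comp (innerSL ℝ : Coord n →L[ℝ] Coord n →L[ℝ] ℝ)).fderiv
    rw [h1, h2, ContinuousLinearMap.comp_apply, h.apply_coordSharp_comm hx _ (innerSL ℝ ξ)]
    rw [hI]
    ring
  have e2 : ∀ i, partialDeriv i (fun η => localIm m φ x η) ξ
      = 2 * coordSharp (m x)⁻¹ (fderiv ℝ φ x) i := by
    intro i
    simp only [partialDeriv, localIm_eq]
    rw [fderiv_const_mul (dI.clm_apply (differentiableAt_const _)), smul_apply, smul_eq_mul,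
      fderiv_clm_apply_const dI]
    have h1 : fderiv ℝ (fun η : Coord n => innerSL ℝ η) ξ = innerSL ℝ :=
      (innerSL ℝ : Coord n →L[ℝ] Coord n →L[ℝ] ℝ).fderiv
    rw [h1, hI]
  rw [poissonBracket, Finset.sum_sub_distrib, clm_apply_eq_sum (fderiv ℝ _ x),
    clm_apply_eq_sum (fderiv ℝ (fun y => localRe m φ y ξ) x), Finset.mul_sum, Finset.mul_sum]
  congr 1
  · refine Finset.sum_congr rfl fun i _ => ?_
    rw [e1]
    simp only [partialDeriv]
    ring
  · refine Finset.sum_congr rfl fun i _ => ?_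
    rw [e2]
    simp only [partialDeriv]
    ring

/-- The Hessian of `φ` for the metric with matrix `m`. -/
def hessian (m : Coord n → Matrix (Fin n) (Fin n) ℝ) (φ : Coord n → ℝ) (x a : Coord n) :
    Coord n →L[ℝ] ℝ :=
  fderiv ℝ (fderiv ℝ φ) x a - (fderiv ℝ φ x).comp (coordGamma m x a)

/-- The derivatives of the inverse metric along X = ξ♯ and V combine into Christoffel symbols. They
complete the second derivatives of φ to its covariant Hessian. -/
lemma poissonBracket_eq_hessian (h : IsMetricOn Ω m) (hφ : ContDiffOn ℝ ∞ φ Ω) {x : Coord n}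
    (hx : x ∈ Ω) (ξ : Coord n) :
    poissonBracket (localRe m φ) (localIm m φ) x ξ =
      4 * (hessian m φ x (coordSharp (m x)⁻¹ (innerSL ℝ ξ)) (coordSharp (m x)⁻¹ (innerSL ℝ ξ))
        + hessian m φ x (coordSharp (m x)⁻¹ (fderiv ℝ φ x))
          (coordSharp (m x)⁻¹ (fderiv ℝ φ x))) := by
  rw [h.poissonBracket_eq hx]
  have hS := h.smooth_coordSharp.differentiableAt_of_mem h.isOpen hx
  have hφ1 := (hφ.fderiv_infty h.isOpen).differentiableAt_of_mem h.isOpen hx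
  simp only [localRe_eq, localIm_eq]
  rw [fderiv_const_mul (by fun_prop), fderiv_fun_sub (by fun_prop) (by fun_prop)]
  simp only [smul_apply, sub_apply, smul_eq_mul]
  set X := coordSharp (m x)⁻¹ (innerSL ℝ ξ) with hX
  set V := coordSharp (m x)⁻¹ (fderiv ℝ φ x) with hV
  have d1 : fderiv ℝ (fun y => innerSL ℝ ξ (coordSharp (m y)⁻¹ (fderiv ℝ φ y))) x X
      = - fderiv ℝ (fun y => coordBil (m y)) x X V X + fderiv ℝ (fderiv ℝ φ) x X X := by
    rw [fderiv_clm_apply_apply (by fun_prop) (by fun_prop),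
      fderiv_clm_apply_apply hS hφ1, fderiv_fun_const, Pi.zero_apply, zero_apply, zero_apply,
      zero_add, map_add, h.apply_fderiv_coordSharp hx,
      h.apply_coordSharp_comm hx _ (innerSL ℝ ξ)]
  have d2 : fderiv ℝ (fun y => innerSL ℝ ξ (coordSharp (m y)⁻¹ (innerSL ℝ ξ))) x V
      = - fderiv ℝ (fun y => coordBil (m y)) x V X X := by
    rw [fderiv_clm_apply_apply (by fun_prop) (by fun_prop), fderiv_clm_apply_const hS,
      fderiv_fun_const, Pi.zero_apply, zero_apply, zero_apply, zero_add,
      h.apply_fderiv_coordSharp hx]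
  have d3 : fderiv ℝ (fun y => fderiv ℝ φ y (coordSharp (m y)⁻¹ (fderiv ℝ φ y))) x V
      = 2 * fderiv ℝ (fderiv ℝ φ) x V V - fderiv ℝ (fun y => coordBil (m y)) x V V V := by
    rw [fderiv_clm_apply_apply hφ1 (by fun_prop), fderiv_clm_apply_apply hS hφ1, map_add,
      h.apply_fderiv_coordSharp hx, h.apply_coordSharp_comm hx _ (fderiv ℝ φ x)]
    ring
  rw [d1, d2, d3]
  have hL := h.isLeviCivitaOn
  have dG : ∀ a b, fderiv ℝ φ x (coordGamma m x a b)
      = christoffel (fderiv ℝ (fun y => coordBil (m y)) x) a b V := by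
    intro a b
    rw [← hL.metric_apply x hx, hL.metric_symm x hx, hV, h.coordBil_coordSharp hx]
  simp only [hessian, sub_apply, ContinuousLinearMap.comp_apply, dG, christoffel]
  rw [hL.fderiv_metric_symm hx X X V]
  ring

/-- The gradient of a limiting Carleman weight is a Carleman field. -/
theorem exists_isCarlemanField (h : IsMetricOn Ω m) (hφ : ContDiffOn ℝ ∞ φ Ω)
    (hcrit : ∀ x ∈ Ω, fderiv ℝ φ x ≠ 0)
    (hbr : ∀ x ∈ Ω, ∀ ξ, localRe m φ x ξ = 0 → localIm m φ x ξ = 0 →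
      poissonBracket (localRe m φ) (localIm m φ) x ξ = 0) :
    ∃ V A μ, IsCarlemanField Ω (fun x => coordBil (m x)) (coordGamma m) V A μ ∧
      ∀ x ∈ Ω, V x ≠ 0 := by
  have hL := h.isLeviCivitaOn
  have hφ1 := hφ.fderiv_infty h.isOpen
  set V : Coord n → Coord n := fun x => coordSharp (m x)⁻¹ (fderiv ℝ φ x) with hVdef
  have hVs : ContDiffOn ℝ ∞ V Ω := h.smooth_coordSharp.clm_apply hφ1
  have hVa : ∀ x ∈ Ω, ∀ a, coordBil (m x) (V x) a = fderiv ℝ φ x a := fun x hx a =>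
    h.coordBil_coordSharp hx _ a
  have hV0 : ∀ x ∈ Ω, V x ≠ 0 := by
    intro x hx h0
    apply hcrit x hx
    ext a
    rw [← hVa x hx, h0, map_zero]
  set N : Coord n → ℝ := fun x => coordBil (m x) (V x) (V x) with hN
  have hNs : ContDiffOn ℝ ∞ N Ω := (h.smooth_coordBil.clm_apply hVs).clm_apply hVs
  have hNpos : ∀ x ∈ Ω, 0 < N x := fun x hx => h.pos x hx _ (hV0 x hx)
  -- This is log |V|. Its derivative along a is H(a,V)/|V|², which is what makes the coefficients of
  -- the Hessian formula below derivatives of one function.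
  set f : Coord n → ℝ := fun x => Real.log (N x) / 2 with hf
  have hfs : ContDiffOn ℝ ∞ f Ω := (hNs.log fun x hx => (hNpos x hx).ne').div_const 2
  have hf1 := hfs.fderiv_infty h.isOpen
  set A : Coord n → Coord n := fun x => coordSharp (m x)⁻¹ (fderiv ℝ f x) with hAdef
  have hAs : ContDiffOn ℝ ∞ A Ω := h.smooth_coordSharp.clm_apply hf1
  have hAa : ∀ x ∈ Ω, ∀ a, coordBil (m x) (A x) a = fderiv ℝ f x a := fun x hx a =>
    h.coordBil_coordSharp hx _ a
  have hclosed : ∀ {W : Coord n → Coord n} {ψ : Coord n → ℝ}, ContDiffOn ℝ ∞ ψ Ω →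
      (∀ x ∈ Ω, ∀ a, coordBil (m x) (W x) a = fderiv ℝ ψ x a) → ∀ x ∈ Ω, ∀ a c,
      fderiv ℝ (fun y => coordBil (m y) (W y) a) x c
        = fderiv ℝ (fun y => coordBil (m y) (W y) c) x a := by
    intro W ψ hψ hW x hx a c
    have hd := (hψ.fderiv_infty h.isOpen).differentiableAt_of_mem h.isOpen hx
    rw [fderiv_congr_of_isOpen h.isOpen hx fun y hy => hW y hy a,
      fderiv_congr_of_isOpen h.isOpen hx fun y hy => hW y hy c, fderiv_clm_apply_const hd,
      fderiv_clm_apply_const hd, hψ.fderiv_fderiv_comm h.isOpen hx]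
  have hcov : ∀ x ∈ Ω, ∀ a b,
      coordBil (m x) (fderiv ℝ V x a + coordGamma m x a (V x)) b = hessian m φ x a b := by
    intro x hx a b
    have hg := h.smooth_coordBil.differentiableAt_of_mem h.isOpen hx
    have hV := hVs.differentiableAt_of_mem h.isOpen hx
    have h1 := congrFun (congrArg DFunLike.coe (fderiv_congr_of_isOpen h.isOpen hx
      fun y hy => hVa y hy b)) a
    rw [fderiv_clm_apply₂ hg hV (by fun_prop),
      fderiv_clm_apply_const (hφ1.differentiableAt_of_mem h.isOpen hx), hL.fderiv_metric hx] at h1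
    simp only [fderiv_fun_const, Pi.zero_apply, zero_apply, map_zero, add_zero] at h1
    rw [hVa x hx] at h1
    simp only [hessian, map_add, add_apply, sub_apply, ContinuousLinearMap.comp_apply]
    linarith
  have hfd : ∀ x ∈ Ω, ∀ a, fderiv ℝ f x a = hessian m φ x a (V x) / N x := by
    intro x hx a
    have hg := h.smooth_coordBil.differentiableAt_of_mem h.isOpen hx
    have hV := hVs.differentiableAt_of_mem h.isOpen hx
    have hNd := hNs.differentiableAt_of_mem h.isOpen hx
    have h1 : fderiv ℝ f x = (2 : ℝ)⁻¹ • ((N x)⁻¹ • fderiv ℝ N x) := by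
      have := ((hNd.hasFDerivAt.log (hNpos x hx).ne').mul_const (2 : ℝ)⁻¹).fderiv
      rw [← this]
      rfl
    have h2 : fderiv ℝ N x a = 2 * hessian m φ x a (V x) := by
      rw [hN, fderiv_clm_apply₂ hg hV hV, hL.fderiv_metric hx, ← hcov x hx,
        hL.metric_symm x hx (V x) (fderiv ℝ V x a),
        hL.metric_symm x hx (V x) (coordGamma m x a (V x))]
      simp only [map_add, add_apply]
      ring
    rw [h1, smul_apply, smul_apply, h2, smul_eq_mul, smul_eq_mul]
    field_simp
  have hHsymm : ∀ x ∈ Ω, ∀ a b, hessian m φ x a b = hessian m φ x b a := by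
    intro x hx a b
    simp only [hessian, sub_apply, ContinuousLinearMap.comp_apply]
    rw [hφ.fderiv_fderiv_comm h.isOpen hx, hL.symm hx]
  have hHess : ∀ x ∈ Ω, ∀ a b, hessian m φ x a b = - (hessian m φ x (V x) (V x) / N x)
      * coordBil (m x) a b + hessian m φ x a (V x) / N x * coordBil (m x) (V x) b
      + coordBil (m x) (V x) a * (hessian m φ x b (V x) / N x) := by
    intro x hx a b
    refine bilinear_eq_of_orthogonal (B := fun a => coordBil (m x) a)
      (H := fun a => hessian m φ x a) (by simp) (by simp) ?_ ?_ (hL.metric_symm x hx)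
      (hHsymm x hx) (h.pos x hx) (hV0 x hx) ?_ a b
    · intro a b c
      simp only [hessian, map_add, sub_apply, add_apply, ContinuousLinearMap.comp_apply]
      ring
    · intro t a c
      simp only [hessian, map_smul, sub_apply, smul_apply, ContinuousLinearMap.comp_apply,
        smul_eq_mul]
      ring
    · intro X hX1 hX2
      -- The covector dual to X for the metric, encoded as a coordinate vector through the Euclidean
      -- product. The two conditions on X say exactly that the symbol vanishes there.
      set ξ : Coord n := (InnerProductSpace.toDual ℝ (Coord n)).symm (coordBil (m x) X) with hξ
      have hξX : innerSL ℝ ξ = coordBil (m x) X := by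
        ext b
        simp [hξ]
      have hSX : coordSharp (m x)⁻¹ (innerSL ℝ ξ) = X := by
        refine hL.metric_ext hx fun c => ?_
        rw [h.coordBil_coordSharp hx, hξX]
      have h1 := hbr x hx ξ ?_ ?_
      · rw [h.poissonBracket_eq_hessian hφ hx, hSX] at h1
        linarith
      · rw [localRe_eq, hSX, hξX, hX2, ← hVa x hx, sub_self]
      · rw [localIm_eq, hξX]
        change 2 * coordBil (m x) X (V x) = 0
        rw [hL.metric_symm x hx, hX1, mul_zero]
  refine ⟨V, A, fun x => - fderiv ℝ f x (V x), ⟨hL, hVs, hAs, (hf1.clm_apply hVs).neg, ?_,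
    hclosed hφ hVa, hclosed hfs hAa, ?_⟩, hV0⟩
  · intro x hx a
    refine hL.metric_ext hx fun b => ?_
    have h1 := hcov x hx a b
    rw [hHess x hx, ← hfd x hx, ← hfd x hx, ← hfd x hx] at h1
    simp only [map_add, add_apply, map_neg, neg_apply, map_smul, smul_apply, smul_eq_mul,
      hAa x hx] at h1 ⊢
    linarith
  · intro x hx
    rw [hAa x hx, neg_neg]

end IsMetricOn

end Bracket

end CarlemanWeights

end

noncomputable section

namespace CarlemanWeights

set_option maxSynthPendingDepth 6

/-! ### Independence of the linearized obstructions -/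

section Functionals

open Matrix

lemma frameAct_single {n r : ℕ} (Q : Matrix (Fin n) (Fin n) ℝ) (K I : Fin r → Fin n) :
    frameAct Q (Pi.single K 1) I = ∏ k, Q (I k) (K k) := by
  rw [frameAct_apply, Finset.sum_eq_single K]
  · simp
  · intro J _ hJ
    simp [Pi.single_eq_of_ne hJ]
  · simp

lemma submatrix_mul_transpose_eq_one {n : ℕ} {A : Matrix (Fin n) (Fin n) ℝ} (hA : A * Aᵀ = 1)
    (σ : Equiv.Perm (Fin n)) : A.submatrix σ id * (A.submatrix σ id)ᵀ = 1 := by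
  have h := submatrix_mul_equiv A Aᵀ σ (Equiv.refl _) σ
  rw [hA, submatrix_one_equiv] at h
  exact h

/-- The second derivative of the polynomial symmetric form with coefficients `s`. -/
def secondJet {n : ℕ} (s : (Fin 4 → Fin n) → ℝ) (c a z t : Fin n) : ℝ :=
  s ![c, a, z, t] + s ![a, c, z, t] + (s ![c, a, t, z] + s ![a, c, t, z])

/-- The contribution of `secondJet s` to the obstruction in dimension at least four. -/
def weylFunctional (m : ℕ) : ((Fin 4 → Fin (m + 4)) → ℝ) →ₗ[ℝ] ℝ where
  toFun s := (secondJet s 1 0 2 3 - secondJet s 1 3 2 0 - secondJet s 2 0 1 3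
    + secondJet s 2 3 1 0) / 2
  map_add' s t := by
    simp only [secondJet, Pi.add_apply]
    ring
  map_smul' c s := by
    simp only [secondJet, Pi.smul_apply, smul_eq_mul, RingHom.id_apply]
    ring

/-- Test tensors with second index 0 are well suited: since P fixes the vector of index 0, only
terms of `secondJet` with a derivative in that direction survive. -/
lemma weylFunctional_frameAct_single {m : ℕ} {P : Matrix (Fin (m + 4)) (Fin (m + 4)) ℝ}
    (h00 : P 0 0 = 1) (hr : ∀ j, j ≠ 0 → P 0 j = 0) (hc : ∀ i, i ≠ 0 → P i 0 = 0)
    {a c d : Fin (m + 4)} (ha : a ≠ 0) (hc0 : c ≠ 0) (hd : d ≠ 0) :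
    weylFunctional m (frameAct P (Pi.single ![a, 0, c, d] 1))
      = (P 1 a * (P 2 c * P 3 d + P 3 c * P 2 d) - P 2 a * (P 1 c * P 3 d + P 3 c * P 1 d)) / 2 := by
  have h1 : P 1 0 = 0 := hc _ (by simp)
  have h2 : P 2 0 = 0 := hc _ (fin_ne (by simp [two_mod]))
  have h3 : P 3 0 = 0 := hc _ (fin_ne (by simp [three_mod]))
  simp only [weylFunctional, LinearMap.coe_mk, AddHom.coe_mk, secondJet, frameAct_single,
    Fin.prod_univ_four, cons_val_zero, cons_val_one, cons_val, h00, hr a ha, hr c hc0, hr d hd,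
    h1, h2, h3]
  ring

lemma reflectionMatrix_single_add_apply {n : ℕ} {k l : Fin n} (hkl : k ≠ l) (i j : Fin n) :
    reflectionMatrix (Pi.single k 1 + Pi.single l 2) i j = (if i = j then 1 else 0)
      - 2 / 5 * (((if i = k then 1 else 0) + (if i = l then 2 else 0))
        * ((if j = k then 1 else 0) + (if j = l then 2 else 0))) := by
  have : (Pi.single k 1 + Pi.single l 2 : Fin n → ℝ) ⬝ᵥ (Pi.single k 1 + Pi.single l 2) = 5 := by
    simp [dotProduct_add, hkl, hkl.symm]
    norm_num
  simp only [reflectionMatrix, of_apply, this, Pi.add_apply, Pi.single_apply]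

lemma single_add_ne_zero {n : ℕ} {k l : Fin n} (hkl : k ≠ l) :
    (Pi.single k 1 + Pi.single l 2 : Fin n → ℝ) ≠ 0 := by
  intro h
  have := congrFun h k
  simp [hkl] at this

/-- There are enough frames to separate the values of the obstruction. -/
theorem exists_linearIndependent_weylFunctional (m : ℕ) :
    ∃ P : Fin (m + 4) → Matrix (Fin (m + 4)) (Fin (m + 4)) ℝ, (∀ p, P p * (P p)ᵀ = 1) ∧
      (∀ p j, j ≠ 0 → P p 0 j = 0) ∧
      LinearIndependent ℝ fun p => weylFunctional m ∘ₗ frameAct (P p) := by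
  have h01 : (0 : Fin (m + 4)) ≠ 1 := by simp
  have h02 : (0 : Fin (m + 4)) ≠ 2 := fin_ne (by simp [two_mod])
  have h03 : (0 : Fin (m + 4)) ≠ 3 := fin_ne (by simp [three_mod])
  have h12 : (1 : Fin (m + 4)) ≠ 2 := fin_ne (by simp [two_mod])
  have h13 : (1 : Fin (m + 4)) ≠ 3 := fin_ne (by simp [three_mod])
  have h23 : (2 : Fin (m + 4)) ≠ 3 := fin_ne (by simp [two_mod, three_mod])
  -- Frames that merely permute the indices 1, 2, 3 give only two independent functionals, because
  -- of the Bianchi identity. Hence the two reflections with entries 3/5 and -4/5 in `B` and `C`;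
  -- the matrices `D p` bring in the other indices, and `D 3` is the identity.
  set A : Matrix (Fin (m + 4)) (Fin (m + 4)) ℝ :=
    (1 : Matrix (Fin (m + 4)) (Fin (m + 4)) ℝ).submatrix
    (Equiv.swap 1 2 * Equiv.swap 2 3 : Equiv.Perm (Fin (m + 4))) id with hA
  set B : Matrix (Fin (m + 4)) (Fin (m + 4)) ℝ :=
    (reflectionMatrix (Pi.single 1 1 + Pi.single 2 2)).submatrix (Equiv.swap 2 3) id with hB
  set C : Matrix (Fin (m + 4)) (Fin (m + 4)) ℝ :=
    reflectionMatrix (Pi.single 1 1 + Pi.single 3 2) with hC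
  set D : Fin (m + 4) → Matrix (Fin (m + 4)) (Fin (m + 4)) ℝ := fun p =>
    (1 : Matrix (Fin (m + 4)) (Fin (m + 4)) ℝ).submatrix (Equiv.swap 3 p) id with hD
  set P : Fin (m + 4) → Matrix (Fin (m + 4)) (Fin (m + 4)) ℝ := fun p =>
    if p = 0 then A else if p = 1 then B else if p = 2 then C else D p with hP
  have hP0 : P 0 = A := by simp [hP]
  have hP1 : P 1 = B := by simp [hP]
  have hP2 : P 2 = C := by simp [hP, h02.symm, h12.symm]
  have hPp : ∀ p, p ≠ 0 → p ≠ 1 → p ≠ 2 → P p = D p := by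
    intro p a b c
    simp [hP, a, b, c]
  have hcases : ∀ {Q : Matrix (Fin (m + 4)) (Fin (m + 4)) ℝ → Prop}, Q A → Q B → Q C →
      (∀ p, p ≠ 0 → p ≠ 1 → p ≠ 2 → Q (D p)) → ∀ p, Q (P p) := by
    intro Q qA qB qC qD p
    by_cases h0 : p = 0
    · rwa [h0, hP0]
    by_cases h1 : p = 1
    · rwa [h1, hP1]
    by_cases h2 : p = 2
    · rwa [h2, hP2]
    rw [hPp p h0 h1 h2]
    exact qD p h0 h1 h2
  have hrefl : ∀ {k l : Fin (m + 4)}, k ≠ l →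
      reflectionMatrix (Pi.single k 1 + Pi.single l 2) *
        (reflectionMatrix (Pi.single k 1 + Pi.single l 2))ᵀ = 1 := by
    intro k l hkl
    rw [reflectionMatrix_transpose, reflectionMatrix_mul_self (single_add_ne_zero hkl)]
  have hA' : ∀ i j, A i j = if Equiv.swap 1 2 (Equiv.swap 2 3 i) = j then 1 else 0 := by
    intro i j
    simp [hA, one_apply]
  have hD' : ∀ p i j, D p i j = if Equiv.swap 3 p i = j then 1 else 0 := by
    intro p i j
    simp [hD, one_apply]
  have hB' : ∀ i j, B i j = reflectionMatrix (Pi.single 1 1 + Pi.single 2 2)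
      (Equiv.swap 2 3 i) j := fun i j => rfl
  have s23 : Equiv.swap (2 : Fin (m + 4)) 3 0 = 0 := Equiv.swap_apply_of_ne_of_ne h02 h03
  have s23' : Equiv.swap (2 : Fin (m + 4)) 3 1 = 1 := Equiv.swap_apply_of_ne_of_ne h12 h13
  have s12 : Equiv.swap (1 : Fin (m + 4)) 2 0 = 0 := Equiv.swap_apply_of_ne_of_ne h01 h02
  have s12' : Equiv.swap (1 : Fin (m + 4)) 2 3 = 3 :=
    Equiv.swap_apply_of_ne_of_ne h13.symm h23.symm
  have horth : ∀ p, P p * (P p)ᵀ = 1 := by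
    refine hcases (Q := fun R => R * Rᵀ = 1) ?_ ?_ (hrefl h13) ?_
    · exact submatrix_mul_transpose_eq_one (by simp) _
    · exact submatrix_mul_transpose_eq_one (hrefl h12) _
    · exact fun p _ _ _ => submatrix_mul_transpose_eq_one (by simp) _
  have hrow : ∀ p j, P p 0 j = if 0 = j then 1 else 0 := by
    intro p
    refine hcases (Q := fun R => ∀ j, R 0 j = if 0 = j then 1 else 0) ?_ ?_ ?_ ?_ p
    · intro j
      simp [hA', s23, s12]
    · intro j
      simp [hB', s23, reflectionMatrix_single_add_apply h12, h01, h02]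
    · intro j
      simp [hC, reflectionMatrix_single_add_apply h13, h01, h03]
    · intro p h0 _ _ j
      rw [hD', Equiv.swap_apply_of_ne_of_ne h03 h0.symm]
  have hcol : ∀ p i, i ≠ 0 → P p i 0 = 0 := by
    intro p i hi
    have h := congrFun (congrFun (horth p) i) 0
    rw [mul_apply, one_apply_ne hi] at h
    simpa [hrow] using h
  refine ⟨P, horth, fun p j hj => by rw [hrow, if_neg hj.symm], ?_⟩
  rw [Fintype.linearIndependent_iff]
  intro x hx
  have key : ∀ a c d : Fin (m + 4), a ≠ 0 → c ≠ 0 → d ≠ 0 → ∑ p, x p *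
      (P p 1 a * (P p 2 c * P p 3 d + P p 3 c * P p 2 d)
        - P p 2 a * (P p 1 c * P p 3 d + P p 3 c * P p 1 d)) = 0 := by
    intro a c d ha hc hd
    have h := congrArg (fun L => 2 * L (Pi.single ![a, 0, c, d] 1)) hx
    simp only [LinearMap.sum_apply, LinearMap.smul_apply, LinearMap.comp_apply,
      LinearMap.zero_apply, smul_eq_mul, mul_zero] at h
    rw [← h, Finset.mul_sum]
    refine Finset.sum_congr rfl fun p _ => ?_
    rw [weylFunctional_frameAct_single (by simp [hrow]) (fun j hj => by rw [hrow, if_neg hj.symm])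
      (hcol p) ha hc hd]
    ring
  have A1 : ∀ j, A 1 j = if 2 = j then 1 else 0 := by
    intro j
    simp [hA', s23']
  have A2 : ∀ j, A 2 j = if 3 = j then 1 else 0 := by
    intro j
    simp [hA', s12']
  have A3 : ∀ j, A 3 j = if 1 = j then 1 else 0 := by
    intro j
    simp [hA']
  have D1 : ∀ p, p ≠ 1 → ∀ j, D p 1 j = if 1 = j then 1 else 0 := by
    intro p h j
    rw [hD', Equiv.swap_apply_of_ne_of_ne h13 h.symm]
  have D2 : ∀ p, p ≠ 2 → ∀ j, D p 2 j = if 2 = j then 1 else 0 := by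
    intro p h j
    rw [hD', Equiv.swap_apply_of_ne_of_ne h23 h.symm]
  have D3 : ∀ p j, D p 3 j = if p = j then 1 else 0 := by
    intro p j
    simp [hD']
  have B1 : B 1 1 = 3 / 5 := by
    simp [hB', s23', reflectionMatrix_single_add_apply h12, h12]
    norm_num
  have B2 : ∀ j, B 2 j = if 3 = j then 1 else 0 := by
    intro j
    simp [hB', reflectionMatrix_single_add_apply h12, h13.symm, h23.symm]
  have B3 : B 3 1 = - 4 / 5 := by
    simp [hB', reflectionMatrix_single_add_apply h12, h12, h12.symm]
    norm_num
  have C1 : C 1 1 = 3 / 5 := by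
    simp [hC, reflectionMatrix_single_add_apply h13, h13]
    norm_num
  have C2 : ∀ j, C 2 j = if 2 = j then 1 else 0 := by
    intro j
    simp [hC, reflectionMatrix_single_add_apply h13, h12.symm, h23]
  have C3 : C 3 1 = - 4 / 5 := by
    simp [hC, reflectionMatrix_single_add_apply h13, h13, h13.symm]
    norm_num
  -- Triangular elimination. The test indices (1,3,1) see only `B`, then (1,2,1) sees only `C` among
  -- the remaining frames, (1,2,q) only `D q`, and (2,3,1) is left for `A`.
  have x1 : x 1 = 0 := by
    have h := key 1 3 1 h01.symm h03.symm h01.symm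
    rw [Finset.sum_eq_single 1] at h
    · rw [hP1, B1, B2, B2, B3] at h
      simp [h13.symm] at h
      exact h
    · intro p _ hp
      by_cases h0 : p = 0
      · simp [h0, hP0, A1, A2, h12.symm, h13.symm]
      by_cases h2 : p = 2
      · simp [h2, hP2, C2, h23, h12.symm]
      simp [hPp p h0 hp h2, D2 p h2, h23, h12.symm]
    · simp
  have x2 : x 2 = 0 := by
    have h := key 1 2 1 h01.symm h02.symm h01.symm
    rw [Finset.sum_eq_single 2] at h
    · rw [hP2, C1, C2, C2, C3] at h
      simp [h12.symm] at h
      exact h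
    · intro p _ hp
      by_cases h0 : p = 0
      · simp [h0, hP0, A1, A2, h12.symm, h13.symm]
      by_cases h1 : p = 1
      · simp [h1, x1]
      simp [hPp p h0 h1 hp, D2 p hp, D3, h1, h12.symm]
    · simp
  have xp : ∀ q, q ≠ 0 → q ≠ 1 → q ≠ 2 → x q = 0 := by
    intro q q0 q1 q2
    have h := key 1 2 q h01.symm h02.symm q0
    rw [Finset.sum_eq_single q] at h
    · simpa [hPp q q0 q1 q2, D1 q q1, D2 q q2, D3, h12.symm, h12, q1, q2, q1.symm, q2.symm] using h
    · intro p _ hp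
      by_cases h0 : p = 0
      · simp [h0, hP0, A1, A2, h12.symm, h13.symm]
      by_cases h1 : p = 1
      · simp [h1, x1]
      by_cases h2 : p = 2
      · simp [h2, x2]
      simp [hPp p h0 h1 h2, D1 p h1, D2 p h2, D3, h12.symm, h2, hp]
    · simp
  intro q
  by_cases q0 : q = 0
  · have h := key 2 3 1 h02.symm h03.symm h01.symm
    rw [Finset.sum_eq_single 0] at h
    · rw [q0]
      simpa [hP0, A1, A2, A3, h23.symm, h13.symm] using h
    · intro p _ h0
      by_cases h1 : p = 1
      · simp [h1, x1]
      by_cases h2 : p = 2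
      · simp [h2, x2]
      simp [xp p h0 h1 h2]
    · simp
  by_cases q1 : q = 1
  · rw [q1, x1]
  by_cases q2 : q = 2
  · rw [q2, x2]
  exact xp q q0 q1 q2

/-- The third derivative of the polynomial symmetric form with coefficients `s`. -/
def thirdJet {n : ℕ} (s : (Fin 5 → Fin n) → ℝ) (y c a z t : Fin n) : ℝ :=
  (s ![y, c, a, z, t] + s ![y, a, c, z, t] + s ![c, y, a, z, t] + s ![c, a, y, z, t]
    + s ![a, y, c, z, t] + s ![a, c, y, z, t])
  + (s ![y, c, a, t, z] + s ![y, a, c, t, z] + s ![c, y, a, t, z] + s ![c, a, y, t, z]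
    + s ![a, y, c, t, z] + s ![a, c, y, t, z])

/-- The contribution of `thirdJet s` to the derivative of the curvature. -/
def thirdJetCurvature {n : ℕ} (s : (Fin 5 → Fin n) → ℝ) (y c a z t : Fin n) : ℝ :=
  (thirdJet s y c z a t - thirdJet s y c t a z - thirdJet s y a z c t
    + thirdJet s y a t c z) / 2

/-- The contribution of `thirdJet s` to the obstruction in dimension three. -/
def cottonFunctional : ((Fin 5 → Fin 3) → ℝ) →ₗ[ℝ] ℝ where
  toFun s := thirdJetCurvature s 0 0 2 0 1 - thirdJetCurvature s 2 1 2 0 2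
  map_add' s t := by
    simp only [thirdJetCurvature, thirdJet, Pi.add_apply]
    ring
  map_smul' c s := by
    simp only [thirdJetCurvature, thirdJet, Pi.smul_apply, smul_eq_mul, RingHom.id_apply]
    ring

/-- There are enough frames to separate the values of the obstruction. -/
theorem exists_linearIndependent_cottonFunctional :
    ∃ P : Fin 3 → Matrix (Fin 3) (Fin 3) ℝ, (∀ p, P p * (P p)ᵀ = 1) ∧
      (∀ p j, j ≠ 0 → P p 0 j = 0) ∧
      LinearIndependent ℝ fun p => cottonFunctional ∘ₗ frameAct (P p) := by
  refine ⟨![!![1, 0, 0; 0, 1, 0; 0, 0, 1], !![1, 0, 0; 0, 0, 1; 0, 1, 0],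
    !![1, 0, 0; 0, 3 / 5, 4 / 5; 0, 4 / 5, - 3 / 5]], ?_, ?_, ?_⟩
  · intro p
    fin_cases p
    · ext i j
      fin_cases i <;> fin_cases j <;> simp [mul_apply, Fin.sum_univ_three]
    · ext i j
      fin_cases i <;> fin_cases j <;> simp [mul_apply, Fin.sum_univ_three]
    · ext i j
      fin_cases i <;> fin_cases j <;> simp [mul_apply, Fin.sum_univ_three] <;> norm_num
  · intro p j hj
    fin_cases p <;> fin_cases j <;> simp at hj ⊢
  rw [Fintype.linearIndependent_iff]
  intro x hx
  have key : ∀ K, x 0 * cottonFunctional (frameAct !![1, 0, 0; 0, 1, 0; 0, 0, 1] (Pi.single K 1))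
      + x 1 * cottonFunctional (frameAct !![1, 0, 0; 0, 0, 1; 0, 1, 0] (Pi.single K 1))
      + x 2 * cottonFunctional (frameAct !![1, 0, 0; 0, 3 / 5, 4 / 5; 0, 4 / 5, - 3 / 5]
        (Pi.single K 1)) = 0 := by
    intro K
    have h := congrArg (fun L => L (Pi.single K 1)) hx
    simpa [Fin.sum_univ_three] using h
  -- The tensor 00011 detects only the third frame, because it needs a matrix mixing the indices 1
  -- and 2. After that, 22210 detects the first frame and 00021 the sum of the first two.
  have hC := key ![0, 0, 0, 1, 1]
  have hB := key ![2, 2, 2, 1, 0]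
  have hA := key ![0, 0, 0, 2, 1]
  simp only [cottonFunctional, thirdJetCurvature, thirdJet, frameAct_single, Fin.prod_univ_five,
    LinearMap.coe_mk, AddHom.coe_mk, cons_val_zero, cons_val_one, cons_val, of_apply] at hC hB hA
  intro q
  fin_cases q <;> simp only [Fin.zero_eta, Fin.mk_one, Fin.reduceFinMk] <;> linarith

section Bridge

variable {E : Type*} [NormedAddCommGroup E] [NormedSpace ℝ E]

lemma weylObstruction_add {m : ℕ} {g₁ : E →L[ℝ] E →L[ℝ] E →L[ℝ] ℝ}
    {g₂ h : E →L[ℝ] E →L[ℝ] E →L[ℝ] E →L[ℝ] ℝ} {F : Fin (m + 4) → E}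
    {s : (Fin 4 → Fin (m + 4)) → ℝ}
    (hs : ∀ c a z t, h (F c) (F a) (F z) (F t) = secondJet s c a z t) :
    weylObstruction g₁ (g₂ + h) F = weylObstruction g₁ g₂ F + weylFunctional m s := by
  simp only [weylObstruction, jetCurvature, christoffel, _root_.add_apply, hs, weylFunctional,
    LinearMap.coe_mk, AddHom.coe_mk, secondJet]
  ring

lemma cottonObstruction_add {g₁ : E →L[ℝ] E →L[ℝ] E →L[ℝ] ℝ}
    {g₂ : E →L[ℝ] E →L[ℝ] E →L[ℝ] E →L[ℝ] ℝ} {g₃ h : E →L[ℝ] E →L[ℝ] E →L[ℝ] E →L[ℝ] E →L[ℝ] ℝ}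
    {F : Fin 3 → E} {s : (Fin 5 → Fin 3) → ℝ}
    (hs : ∀ y c a z t, h (F y) (F c) (F a) (F z) (F t) = thirdJet s y c a z t) :
    cottonObstruction g₁ g₂ (g₃ + h) F = cottonObstruction g₁ g₂ g₃ F + cottonFunctional s := by
  simp only [cottonObstruction, jetCovCurvature, christoffel, _root_.add_apply, hs, cottonFunctional,
    LinearMap.coe_mk, AddHom.coe_mk, thirdJet, thirdJetCurvature]
  ring

end Bridge

end Functionals

end CarlemanWeights

end

noncomputable section

namespace CarlemanWeights

set_option maxSynthPendingDepth 6

/-! ### Tensor fields on the manifold and their matrices in charts -/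

section Tensors

open Bundle

variable {n : ℕ} {M : Type*} [TopologicalSpace M] [ChartedSpace (Coord n) M]

variable (n M) in
/-- Covariant tensor fields of order two on `M`. -/
abbrev TensorField : Type _ :=
  ∀ x : M, TangentSpace (𝓡 n) x →L[ℝ] TangentSpace (𝓡 n) x →L[ℝ] ℝ

/-- The matrix of a tensor field in the chart `e`. -/
def tensorMatrix (B : TensorField n M) (e : OpenPartialHomeomorph M (Coord n)) (y : Coord n) :
    Matrix (Fin n) (Fin n) ℝ :=
  Matrix.of fun i j => B (e.symm y) (coordVector e i y) (coordVector e j y)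

lemma coordBil_tensorMatrix (B : TensorField n M) (e : OpenPartialHomeomorph M (Coord n))
    (y a b : Coord n) : coordBil (tensorMatrix B e y) a b =
      B (e.symm y) (mfderiv (𝓡 n) (𝓡 n) e.symm y a) (mfderiv (𝓡 n) (𝓡 n) e.symm y b) := by
  let L : Coord n →L[ℝ] TangentSpace (𝓡 n) (e.symm y) := mfderiv (𝓡 n) (𝓡 n) e.symm y
  have hL : ∀ a : Coord n, L a = ∑ i, a i • coordVector e i y := by
    intro a
    have ha : a = ∑ i, a i • EuclideanSpace.single i (1 : ℝ) := by
      ext k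
      simp [Finset.sum_apply, Pi.single_apply]
    conv_lhs => rw [ha]
    rw [map_sum]
    refine Finset.sum_congr rfl fun i _ => ?_
    rw [map_smul]
    rfl
  change _ = B (e.symm y) (L a) (L b)
  rw [coordBil_apply, hL a, hL b]
  simp only [map_sum, map_smul, sum_apply, smul_apply, smul_eq_mul]
  rw [Finset.sum_comm]
  refine Finset.sum_congr rfl fun i _ => ?_
  rw [Finset.mul_sum]
  refine Finset.sum_congr rfl fun j _ => ?_
  simp only [tensorMatrix, Matrix.of_apply]
  ring

variable [IsManifold (𝓡 n) ∞ M]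

/-- Smoothness of a tensor field. -/
def IsSmoothTensor (B : TensorField n M) : Prop :=
  ContMDiff (𝓡 n) ((𝓡 n).prod 𝓘(ℝ, Coord n →L[ℝ] Coord n →L[ℝ] ℝ)) ∞
    (fun b ↦ TotalSpace.mk' (Coord n →L[ℝ] Coord n →L[ℝ] ℝ)
      (E := fun x : M => TangentSpace (𝓡 n) x →L[ℝ] TangentSpace (𝓡 n) x →L[ℝ] ℝ) b (B b))

variable {e : OpenPartialHomeomorph M (Coord n)}

/-- The differential of the inverse chart is a smooth family of maps between tangent spaces, applied
here to a constant vector field. -/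
lemma contMDiffAt_coordVector (he : e ∈ IsManifold.maximalAtlas (𝓡 n) ∞ M) {y : Coord n}
    (hy : y ∈ e.target) (v : Coord n) :
    ContMDiffAt (𝓡 n) ((𝓡 n).prod 𝓘(ℝ, Coord n)) ∞
      (fun z ↦ TotalSpace.mk' (Coord n) (E := fun x : M => TangentSpace (𝓡 n) x) (e.symm z)
        (mfderiv (𝓡 n) (𝓡 n) e.symm z v)) y := by
  have hs : ContMDiffAt (𝓡 n) (𝓡 n) ∞ e.symm y := contMDiffAt_symm_of_mem_maximalAtlas he hy
  have hv : ContMDiffAt (𝓡 n) ((𝓡 n).prod 𝓘(ℝ, Coord n)) ∞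
      (fun z : Coord n ↦ TotalSpace.mk' (Coord n) (E := fun x : Coord n => TangentSpace (𝓡 n) x) z
        v) y :=
    contMDiffAt_vectorSpace_iff_contDiffAt.2 contDiffAt_const
  exact ContMDiffAt.clm_apply_of_inCoordinates (F₁ := Coord n) (F₂ := Coord n) (IM := 𝓡 n)
    (IB₁ := 𝓡 n) (IB₂ := 𝓡 n) (E₁ := fun x : Coord n => TangentSpace (𝓡 n) x)
    (E₂ := fun x : M => TangentSpace (𝓡 n) x) (b₁ := id) (b₂ := e.symm) (v := fun _ => v)
    (ϕ := fun z => mfderiv (𝓡 n) (𝓡 n) e.symm z)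
    (hs.mfderiv_const (m := ∞) (by simp)) hv hs

lemma IsSmoothTensor.contDiffOn {B : TensorField n M} (hB : IsSmoothTensor B)
    (he : e ∈ IsManifold.maximalAtlas (𝓡 n) ∞ M) (i j : Fin n) :
    ContDiffOn ℝ ∞ (fun y => tensorMatrix B e y i j) e.target := by
  intro y hy
  refine ContDiffAt.contDiffWithinAt ?_
  rw [← contMDiffAt_iff_contDiffAt]
  have hs : ContMDiffAt (𝓡 n) (𝓡 n) ∞ e.symm y := contMDiffAt_symm_of_mem_maximalAtlas he hy
  have : ContMDiffAt (𝓡 n) ((𝓡 n).prod 𝓘(ℝ)) ∞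
      (fun m ↦ TotalSpace.mk' ℝ (E := Bundle.Trivial M ℝ) (e.symm m)
        (B (e.symm m) (coordVector e i m) (coordVector e j m))) y := by
    apply ContMDiffAt.clm_bundle_apply₂ (F₁ := Coord n) (F₂ := Coord n)
    · exact ContMDiffAt.comp y hB.contMDiffAt hs
    · exact contMDiffAt_coordVector he hy _
    · exact contMDiffAt_coordVector he hy _
  simp only [contMDiffAt_totalSpace] at this
  exact this.2

lemma mdifferentiable_of_mem_maximalAtlas (he : e ∈ IsManifold.maximalAtlas (𝓡 n) ∞ M) :
    e.MDifferentiable (𝓡 n) (𝓡 n) := by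
  have : IsManifold (𝓡 n) 1 M := IsManifold.of_le (n := ∞) (by simp)
  have he1 : e ∈ IsManifold.maximalAtlas (𝓡 n) 1 M :=
    IsManifold.maximalAtlas_subset_of_le (by simp) he
  exact ⟨fun x hx => (mdifferentiableAt_of_mem_maximalAtlas he1 hx).mdifferentiableWithinAt,
    fun x hx => (mdifferentiableAt_symm_of_mem_maximalAtlas he1 hx).mdifferentiableWithinAt⟩

/-- The matrix of a Riemannian metric in a chart defines a metric on the target of the chart. -/
lemma isMetricOn_metricMatrix (g : SmoothMetric n M)
    (he : e ∈ IsManifold.maximalAtlas (𝓡 n) ∞ M) : IsMetricOn e.target (metricMatrix g e) where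
  isOpen := e.open_target
  smooth := IsSmoothTensor.contDiffOn (B := g.inner) g.contMDiff he
  symm y _ := by
    ext i j
    exact g.symm _ _ _
  pos y hy a ha := by
    change 0 < coordBil (tensorMatrix g.inner e y) a a
    rw [coordBil_tensorMatrix]
    refine g.pos _ _ fun h0 => ha ?_
    exact (mdifferentiable_of_mem_maximalAtlas he).symm.mfderiv_injective (x := y) hy
      (h0.trans (map_zero (mfderiv (𝓡 n) (𝓡 n) e.symm y)).symm)

end Tensors

end CarlemanWeights

end

noncomputable section

namespace CarlemanWeights

set_option maxSynthPendingDepth 6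

/-! ### Carleman weights read in a chart -/

section Weights

variable {n : ℕ} {M : Type*} [TopologicalSpace M] [ChartedSpace (Coord n) M]
  [IsManifold (𝓡 n) ∞ M] {e : OpenPartialHomeomorph M (Coord n)} {U : Set M} {φ : M → ℝ}

lemma IsMetricOn.mono {Ω Ω' : Set (Coord n)} {m : Coord n → Matrix (Fin n) (Fin n) ℝ}
    (h : IsMetricOn Ω m) (hΩ' : IsOpen Ω') (hsub : Ω' ⊆ Ω) : IsMetricOn Ω' m where
  isOpen := hΩ'
  smooth i j := (h.smooth i j).mono hsub
  symm x hx := h.symm x (hsub hx)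
  pos x hx := h.pos x (hsub hx)

/-- In a chart, a limiting Carleman weight gives rise to a Carleman field. -/
theorem IsLimitingCarlemanWeight.exists_isCarlemanField {g : SmoothMetric n M}
    (h : IsLimitingCarlemanWeight g U φ) (hU : IsOpen U)
    (he : e ∈ IsManifold.maximalAtlas (𝓡 n) ∞ M) :
    ∃ V A μ, IsCarlemanField (e.target ∩ e.symm ⁻¹' U)
      (fun x => coordBil (metricMatrix g e x)) (coordGamma (metricMatrix g e)) V A μ ∧
      ∀ x ∈ e.target ∩ e.symm ⁻¹' U, V x ≠ 0 := by
  have hΩ : IsOpen (e.target ∩ e.symm ⁻¹' U) := e.symm.isOpen_inter_preimage hU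
  have hes := contMDiffOn_symm_of_mem_maximalAtlas he
  have hd := mdifferentiable_of_mem_maximalAtlas he
  refine ((isMetricOn_metricMatrix g he).mono hΩ Set.inter_subset_left).exists_isCarlemanField
    (φ := fun y => φ (e.symm y)) ?_ ?_ ?_
  · rw [← contMDiffOn_iff_contDiffOn]
    exact h.smooth.comp (hes.mono Set.inter_subset_left) fun x hx => hx.2
  · rintro x ⟨hx, hxU⟩ h0
    apply h.noncritical _ hxU
    have hφ : MDifferentiableAt (𝓡 n) 𝓘(ℝ, ℝ) φ (e.symm x) :=
      (h.smooth.contMDiffAt (hU.mem_nhds hxU)).mdifferentiableAt (by simp)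
    have hcomp : (mfderiv (𝓡 n) 𝓘(ℝ, ℝ) φ (e.symm x)).comp (mfderiv (𝓡 n) (𝓡 n) e.symm x)
        = 0 := by
      rw [← mfderiv_comp x hφ (hd.mdifferentiableAt_symm hx), mfderiv_eq_fderiv]
      exact h0
    refine ContinuousLinearMap.ext fun v => ?_
    obtain ⟨w, rfl⟩ := hd.symm.mfderiv_surjective (x := x) hx v
    exact congrFun (congrArg DFunLike.coe hcomp) w
  · rintro x ⟨hx, hxU⟩ ξ h1 h2
    have h3 := h.bracket e he (e.symm x) ⟨hxU, e.map_target hx⟩ ξ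
    rw [e.right_inv hx] at h3
    exact h3 (Complex.ext h1 h2)

/-- An orthogonal matrix cannot have a zero row, so the frame vector is rescaled by a nonzero factor
and keeps its direction. -/
lemma frameMul_eq_smul {E : Type*} [NormedAddCommGroup E] [NormedSpace ℝ E]
    {P : Matrix (Fin n) (Fin n) ℝ} (hP : P * P.transpose = 1) {i₀ : Fin n}
    (hP₀ : ∀ j, j ≠ i₀ → P i₀ j = 0) (F : Fin n → E) :
    frameMul P F i₀ = P i₀ i₀ • F i₀ ∧ P i₀ i₀ ≠ 0 := by
  constructor
  · rw [frameMul, Finset.sum_eq_single i₀ (fun j _ hj => by rw [hP₀ j hj, zero_smul]) (by simp)]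
  · intro h0
    have := congrFun (congrFun hP i₀) i₀
    rw [Matrix.mul_apply, Matrix.one_apply_eq, Finset.sum_eq_zero] at this
    · exact zero_ne_one this
    · intro j _
      by_cases hj : j = i₀
      · rw [hj, h0, zero_mul]
      · rw [hP₀ j hj, zero_mul]

/-- An obstruction which vanishes on the orthonormal frames adapted to a Carleman field has a
degenerate frame. -/
lemma IsMetricOn.hasDegenerateFrame {Ω : Set (Coord n)}
    {m : Coord n → Matrix (Fin n) (Fin n) ℝ} (h : IsMetricOn Ω m) {x : Coord n} (hx : x ∈ Ω)
    {v : Coord n} (hv : v ≠ 0) {i₀ : Fin n} {f : (Fin n → Coord n) → ℝ}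
    (hf : ∀ F, IsOrthoFrame (coordBil (m x)) F → ∀ t : ℝ, F i₀ = t • v → t ≠ 0 → f F = 0) :
    HasDegenerateFrame (coordBil (m x)) f i₀ := by
  obtain ⟨F, hF, t, ht, hFv⟩ := exists_isOrthoFrame_smul_eq
    (coordBil_symm (h.symm x hx)) (h.pos x hx) (finrank_euclideanSpace_fin (𝕜 := ℝ)) i₀ hv
  refine ⟨F, hF, fun P hP hP₀ => ?_⟩
  obtain ⟨h1, h2⟩ := frameMul_eq_smul hP hP₀ F
  exact hf _ (hF.frameMul hP) (P i₀ i₀ * t) (by rw [h1, hFv, smul_smul]) (mul_ne_zero h2 ht)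

end Weights

/-! ### Iterated derivatives and nested directional derivatives -/

section Jets

variable {E : Type*} [NormedAddCommGroup E] [NormedSpace ℝ E]

lemma iteratedFDeriv_three_apply_of_isOpen {u : E → ℝ} {Ω : Set E} (hΩ : IsOpen Ω)
    (hu : ContDiffOn ℝ ∞ u Ω) {x : E} (hx : x ∈ Ω) (a b c : E) :
    iteratedFDeriv ℝ 3 u x ![a, b, c]
      = fderiv ℝ (fun y => fderiv ℝ (fun z => fderiv ℝ u z c) y b) x a := by
  rw [iteratedFDeriv_succ_apply_left]
  have h2 : DifferentiableAt ℝ (iteratedFDeriv ℝ 2 u) x :=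
    ((hu.contDiffAt (hΩ.mem_nhds hx)).iteratedFDeriv_right (m := 1) (i := 2)
      (by norm_cast)).differentiableAt (by simp)
  have h3 : ∀ m : Fin 2 → E, fderiv ℝ (iteratedFDeriv ℝ 2 u) x a m
      = fderiv ℝ (fun y => iteratedFDeriv ℝ 2 u y m) x a := by
    intro m
    rw [fderiv_continuousMultilinear_apply_const_apply h2]
  change fderiv ℝ (iteratedFDeriv ℝ 2 u) x a ![b, c] = _
  rw [h3]
  refine congrFun (congrArg DFunLike.coe (fderiv_congr_of_isOpen hΩ hx fun y hy => ?_)) a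
  rw [iteratedFDeriv_two_apply, fderiv_clm_apply_const
    ((hu.fderiv_infty hΩ).differentiableAt_of_mem hΩ hy)]
  rfl

lemma iteratedFDeriv_two_apply_of_isOpen {u : E → ℝ} {Ω : Set E} (hΩ : IsOpen Ω)
    (hu : ContDiffOn ℝ ∞ u Ω) {x : E} (hx : x ∈ Ω) (a b : E) :
    iteratedFDeriv ℝ 2 u x ![a, b] = fderiv ℝ (fun z => fderiv ℝ u z b) x a := by
  rw [iteratedFDeriv_two_apply, fderiv_clm_apply_const
    ((hu.fderiv_infty hΩ).differentiableAt_of_mem hΩ hx)]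
  rfl

variable {F G : Type*} [NormedAddCommGroup F] [NormedSpace ℝ F] [NormedAddCommGroup G]
  [NormedSpace ℝ G] {Ω : Set E} {g : E → F →L[ℝ] G →L[ℝ] ℝ}

lemma fderiv_apply₂ (hΩ : IsOpen Ω) (hg : ContDiffOn ℝ ∞ g Ω) {x : E} (hx : x ∈ Ω) (c : E)
    (z : F) (t : G) : fderiv ℝ g x c z t = fderiv ℝ (fun y => g y z t) x c := by
  have h := hg.differentiableAt_of_mem hΩ hx
  rw [fderiv_clm_apply_const (h.clm_apply (differentiableAt_const z)), fderiv_clm_apply_const h]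

lemma fderiv_fderiv_apply₂ (hΩ : IsOpen Ω) (hg : ContDiffOn ℝ ∞ g Ω) {x : E} (hx : x ∈ Ω)
    (c a : E) (z : F) (t : G) : fderiv ℝ (fderiv ℝ g) x c a z t
      = fderiv ℝ (fun y => fderiv ℝ (fun w => g w z t) y a) x c := by
  have h := (hg.fderiv_infty hΩ).differentiableAt_of_mem hΩ hx
  rw [← fderiv_congr_of_isOpen hΩ hx fun y hy => fderiv_apply₂ hΩ hg hy a z t,
    fderiv_clm_apply_const ((h.clm_apply (differentiableAt_const a)).clm_apply
      (differentiableAt_const z)), fderiv_clm_apply_const (h.clm_apply (differentiableAt_const a)),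
    fderiv_clm_apply_const h]

lemma fderiv_fderiv_fderiv_apply₂ (hΩ : IsOpen Ω) (hg : ContDiffOn ℝ ∞ g Ω) {x : E} (hx : x ∈ Ω)
    (y c a : E) (z : F) (t : G) : fderiv ℝ (fderiv ℝ (fderiv ℝ g)) x y c a z t
      = fderiv ℝ (fun w => fderiv ℝ (fun w' => fderiv ℝ (fun w'' => g w'' z t) w' a) w c) x y := by
  have h := ((hg.fderiv_infty hΩ).fderiv_infty hΩ).differentiableAt_of_mem hΩ hx
  rw [← fderiv_congr_of_isOpen hΩ hx fun w hw => fderiv_fderiv_apply₂ hΩ hg hw c a z t]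
  have h1 := h.clm_apply (differentiableAt_const c)
  have h2 := h1.clm_apply (differentiableAt_const a)
  rw [fderiv_clm_apply_const (h2.clm_apply (differentiableAt_const z)), fderiv_clm_apply_const h2,
    fderiv_clm_apply_const h1, fderiv_clm_apply_const h]

end Jets

/-! ### Continuity of the jet at a point for the C^k topology -/

section Continuity

variable {n : ℕ} {M : Type*} [TopologicalSpace M] [ChartedSpace (Coord n) M]
  [IsManifold (𝓡 n) ∞ M] {e : OpenPartialHomeomorph M (Coord n)} {k : ℕ}

/-- The metric `g`, in the coordinates of the chart `e`. -/
def metricForm (g : SmoothMetric n M) (e : OpenPartialHomeomorph M (Coord n)) (y : Coord n) :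
    Coord n →L[ℝ] Coord n →L[ℝ] ℝ :=
  coordBil (metricMatrix g e y)

lemma contDiffOn_metricForm (he : e ∈ IsManifold.maximalAtlas (𝓡 n) ∞ M) (g : SmoothMetric n M) :
    ContDiffOn ℝ ∞ (metricForm g e) e.target :=
  (isMetricOn_metricMatrix g he).smooth_coordBil

/-- A singleton in the chart target is compact, so uniform convergence on compact sets controls
evaluation at a point. -/
lemma continuous_iteratedFDeriv_metricMatrix (he : e ∈ IsManifold.maximalAtlas (𝓡 n) ∞ M)
    {y : Coord n} (hy : y ∈ e.target) (i j : Fin n) {m : ℕ} (hm : m ≤ k) :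
    Continuous[ckTopology n M k, inferInstance] fun g : SmoothMetric n M =>
      iteratedFDeriv ℝ m (fun z => metricMatrix g e z i j) y := by
  have h1 : Continuous[ckTopology n M k, inferInstance] fun g : SmoothMetric n M =>
      UniformOnFun.ofFun {K : Set (Coord n) | IsCompact K ∧ K ⊆ e.target}
          (iteratedFDeriv ℝ m fun y => metricMatrix g e y i j) := by
    rw [continuous_iff_le_induced]
    exact (iInf_le _ e).trans ((iInf_le _ he).trans ((iInf_le _ i).trans ((iInf_le _ j).trans
      ((iInf_le _ m).trans (iInf_le _ hm)))))
  let := ckTopology n M k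
  have hK : ({y} : Set (Coord n)) ∈ {K : Set (Coord n) | IsCompact K ∧ K ⊆ e.target} :=
    ⟨isCompact_singleton, Set.singleton_subset_iff.2 hy⟩
  exact (UniformOnFun.uniformContinuous_eval_of_mem _ _ (Set.mem_singleton y)
    hK).continuous.comp h1

lemma continuous_iteratedFDeriv_metricForm (he : e ∈ IsManifold.maximalAtlas (𝓡 n) ∞ M)
    {y : Coord n} (hy : y ∈ e.target) {m : ℕ} (hm : m ≤ k) (a b : Coord n) :
    Continuous[ckTopology n M k, inferInstance] fun g : SmoothMetric n M =>
      iteratedFDeriv ℝ m (fun z => metricForm g e z a b) y := by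
  let := ckTopology n M k
  have h1 : ∀ g : SmoothMetric n M, iteratedFDeriv ℝ m (fun z => metricForm g e z a b) y
      = ∑ i, ∑ j, (a i * b j) • iteratedFDeriv ℝ m (fun z => metricMatrix g e z i j) y := by
    intro g
    have hs : ∀ i j, ContDiffAt ℝ m (fun z => metricMatrix g e z i j) y := fun i j =>
      (((isMetricOn_metricMatrix g he).smooth i j).contDiffAt
        (e.open_target.mem_nhds hy)).of_le (by exact ENat.LEInfty.out)
    have hs' : ∀ i j, ContDiffAt ℝ m (fun z => (a i * b j) • metricMatrix g e z i j) y :=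
      fun i j => (hs i j).const_smul _
    have hform : (fun z => metricForm g e z a b)
        = fun z => ∑ i, ∑ j, (a i * b j) • metricMatrix g e z i j := by
      ext z
      rw [metricForm, coordBil_apply]
      refine Finset.sum_congr rfl fun i _ => Finset.sum_congr rfl fun j _ => ?_
      rw [smul_eq_mul, mul_comm]
    rw [hform, iteratedFDeriv_fun_sum_apply fun i _ => ContDiffAt.sum fun j _ => hs' i j]
    refine Finset.sum_congr rfl fun i _ => ?_
    rw [iteratedFDeriv_fun_sum_apply fun j _ => hs' i j]
    refine Finset.sum_congr rfl fun j _ => ?_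
    exact iteratedFDeriv_const_smul_apply' (hs i j)
  simp only [h1]
  exact continuous_finsetSum _ fun i _ => continuous_finsetSum _ fun j _ =>
    (continuous_iteratedFDeriv_metricMatrix he hy i j hm).const_smul (a i * b j)

lemma continuous_metricForm (he : e ∈ IsManifold.maximalAtlas (𝓡 n) ∞ M)
    {y : Coord n} (hy : y ∈ e.target) :
    Continuous[ckTopology n M k, inferInstance] fun g : SmoothMetric n M => metricForm g e y := by
  let := ckTopology n M k
  refine continuous_clm_apply.2 fun a => continuous_clm_apply.2 fun b => ?_
  exact (ContinuousMultilinearMap.apply ℝ (fun _ : Fin 0 => Coord n) ℝ ![]).continuous.comp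
    (continuous_iteratedFDeriv_metricForm he hy (Nat.zero_le k) a b)

lemma continuous_fderiv_metricForm (he : e ∈ IsManifold.maximalAtlas (𝓡 n) ∞ M)
    {y : Coord n} (hy : y ∈ e.target) (hk : 1 ≤ k) :
    Continuous[ckTopology n M k, inferInstance] fun g : SmoothMetric n M =>
      fderiv ℝ (metricForm g e) y := by
  let := ckTopology n M k
  refine continuous_clm_apply.2 fun c => continuous_clm_apply.2 fun a =>
    continuous_clm_apply.2 fun b => ?_
  have h := (ContinuousMultilinearMap.apply ℝ (fun _ : Fin 1 => Coord n) ℝ ![c]).continuous.comp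
    (continuous_iteratedFDeriv_metricForm he hy hk a b)
  refine h.congr fun g => ?_
  rw [fderiv_apply₂ e.open_target (contDiffOn_metricForm he g) hy]
  exact iteratedFDeriv_one_apply _

lemma continuous_fderiv_fderiv_metricForm (he : e ∈ IsManifold.maximalAtlas (𝓡 n) ∞ M)
    {y : Coord n} (hy : y ∈ e.target) (hk : 2 ≤ k) :
    Continuous[ckTopology n M k, inferInstance] fun g : SmoothMetric n M =>
      fderiv ℝ (fderiv ℝ (metricForm g e)) y := by
  let := ckTopology n M k
  refine continuous_clm_apply.2 fun c => continuous_clm_apply.2 fun d =>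
    continuous_clm_apply.2 fun a => continuous_clm_apply.2 fun b => ?_
  have h := (ContinuousMultilinearMap.apply ℝ (fun _ : Fin 2 => Coord n) ℝ
    ![c, d]).continuous.comp (continuous_iteratedFDeriv_metricForm he hy hk a b)
  refine h.congr fun g => ?_
  have hs := contDiffOn_metricForm he g
  rw [fderiv_fderiv_apply₂ e.open_target hs hy]
  exact iteratedFDeriv_two_apply_of_isOpen e.open_target
    ((hs.clm_apply contDiffOn_const).clm_apply contDiffOn_const) hy c d

lemma continuous_fderiv_fderiv_fderiv_metricForm (he : e ∈ IsManifold.maximalAtlas (𝓡 n) ∞ M)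
    {y : Coord n} (hy : y ∈ e.target) (hk : 3 ≤ k) :
    Continuous[ckTopology n M k, inferInstance] fun g : SmoothMetric n M =>
      fderiv ℝ (fderiv ℝ (fderiv ℝ (metricForm g e))) y := by
  let := ckTopology n M k
  refine continuous_clm_apply.2 fun c => continuous_clm_apply.2 fun d =>
    continuous_clm_apply.2 fun d' => continuous_clm_apply.2 fun a =>
    continuous_clm_apply.2 fun b => ?_
  have h := (ContinuousMultilinearMap.apply ℝ (fun _ : Fin 3 => Coord n) ℝ
    ![c, d, d']).continuous.comp (continuous_iteratedFDeriv_metricForm he hy hk a b)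
  refine h.congr fun g => ?_
  have hs := contDiffOn_metricForm he g
  rw [fderiv_fderiv_fderiv_apply₂ e.open_target hs hy]
  exact iteratedFDeriv_three_apply_of_isOpen e.open_target
    ((hs.clm_apply contDiffOn_const).clm_apply contDiffOn_const) hy c d d'

end Continuity

end CarlemanWeights

end

noncomputable section

namespace CarlemanWeights

set_option maxSynthPendingDepth 6

/-! ### Smooth symmetric perturbations of a metric -/

section Forms

open Bundle

variable {n : ℕ} {M : Type*} [TopologicalSpace M] [ChartedSpace (Coord n) M]
  [IsManifold (𝓡 n) ∞ M]

lemma IsSmoothTensor.add {B C : TensorField n M} (hB : IsSmoothTensor B) (hC : IsSmoothTensor C) :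
    IsSmoothTensor (fun x => B x + C x) :=
  ContMDiff.add_section hB hC

lemma IsSmoothTensor.smul {f : M → ℝ} (hf : ContMDiff (𝓡 n) 𝓘(ℝ, ℝ) ∞ f) {B : TensorField n M}
    (hB : IsSmoothTensor B) : IsSmoothTensor (fun x => f x • B x) :=
  ContMDiff.smul_section hf hB

lemma IsSmoothTensor.sum {ι : Type*} {s : Finset ι} {B : ι → TensorField n M}
    (hB : ∀ i ∈ s, IsSmoothTensor (B i)) : IsSmoothTensor (fun x => ∑ i ∈ s, B i x) :=
  ContMDiff.sum_section hB

/-- The differential of a function, as a covector field. -/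
def differential (f : M → ℝ) (x : M) : TangentSpace (𝓡 n) x →L[ℝ] ℝ :=
  mfderiv (𝓡 n) 𝓘(ℝ, ℝ) f x

/-- The tensor product of two differentials. -/
def differentialMul (f h : M → ℝ) : TensorField n M := fun x =>
  (differential f x).smulRight (differential h x)

/-- In the trivialization around the point, the tensor is a fixed continuous bilinear operation on
the coordinate expressions of the two differentials, which are smooth. -/
lemma isSmoothTensor_differentialMul {f h : M → ℝ} (hf : ContMDiff (𝓡 n) 𝓘(ℝ, ℝ) ∞ f)
    (hh : ContMDiff (𝓡 n) 𝓘(ℝ, ℝ) ∞ h) : IsSmoothTensor (differentialMul (n := n) f h) := by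
  intro x₀
  rw [contMDiffAt_hom_bundle]
  refine ⟨contMDiffAt_id, ?_⟩
  have hf1 := (hf x₀).mfderiv_const (m := ∞) (by simp)
  have hh1 := (hh x₀).mfderiv_const (m := ∞) (by simp)
  have key : ∀ {f : M → ℝ} {x : M} (v : Coord n),
      x ∈ (trivializationAt (Coord n) (TangentSpace (𝓡 n) : M → Type _) x₀).baseSet →
      inTangentCoordinates (𝓡 n) 𝓘(ℝ, ℝ) id f (mfderiv (𝓡 n) 𝓘(ℝ, ℝ) f) x₀ x v
        = differential f x
          ((trivializationAt (Coord n) (TangentSpace (𝓡 n) : M → Type _) x₀).symm x v) := by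
    intro f x v hx
    change ContinuousLinearMap.inCoordinates (Coord n) (TangentSpace (𝓡 n) : M → Type _) ℝ
      (TangentSpace 𝓘(ℝ, ℝ) : ℝ → Type _) x₀ x (f x₀) (f x) (mfderiv (𝓡 n) 𝓘(ℝ, ℝ) f x) v = _
    rw [ContinuousLinearMap.inCoordinates_eq hx (show f x ∈ (trivializationAt ℝ
      (TangentSpace 𝓘(ℝ, ℝ) : ℝ → Type _) (f x₀)).baseSet from Set.mem_univ _)]
    simp
    rfl
  have : ContMDiffAt (𝓡 n) 𝓘(ℝ, Coord n →L[ℝ] Coord n →L[ℝ] ℝ) ∞ (fun x =>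
      ContinuousLinearMap.smulRightL ℝ (Coord n) (Coord n →L[ℝ] ℝ)
        (inTangentCoordinates (𝓡 n) 𝓘(ℝ, ℝ) id f (mfderiv (𝓡 n) 𝓘(ℝ, ℝ) f) x₀ x)
        (inTangentCoordinates (𝓡 n) 𝓘(ℝ, ℝ) id h (mfderiv (𝓡 n) 𝓘(ℝ, ℝ) h) x₀ x)) x₀ :=
    (contMDiffAt_const.clm_apply hf1).clm_apply hh1
  refine this.congr_of_eventuallyEq ?_
  filter_upwards [(trivializationAt (Coord n) (TangentSpace (𝓡 n) : M → Type _)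
    x₀).open_baseSet.mem_nhds (FiberBundle.mem_baseSet_trivializationAt' x₀)] with x hx
  ext v w
  rw [inCoordinates_apply_eq₂ hx hx (Set.mem_univ _)]
  simp [← key _ hx, differentialMul]

/-- A perturbation of `g` by a small symmetric tensor field. -/
def perturbMetric (g : SmoothMetric n M) {B : TensorField n M} (hB : IsSmoothTensor B)
    (hsymm : ∀ x u v, B x u v = B x v u) (hle : ∀ x u, |B x u u| ≤ 1 / 2 * g.inner x u u) :
    SmoothMetric n M where
  inner x := g.inner x + B x
  symm x u v := by
    rw [add_apply, add_apply, add_apply, add_apply, g.symm, hsymm]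
  pos x u hu := by
    have h1 := g.pos x u hu
    have h2 := neg_le_of_abs_le (hle x u)
    rw [add_apply, add_apply]
    linarith
  isVonNBounded x := by
    -- If (g + B)(u,u) < 1 then g(u,u) < 2 by the domination of B. Hence u/2 lies in the unit ball
    -- of g, and the new ball lies in its dilation by 2.
    have h := (g.isVonNBounded x).image
      ((2 : ℝ) • ContinuousLinearMap.id ℝ (TangentSpace (𝓡 n) x))
    refine h.subset fun u hu => (Set.mem_image _ _ _).2 ⟨(2 : ℝ)⁻¹ • u, ?_, ?_⟩
    · have h1 : g.inner x u u + B x u u < 1 := hu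
      have h2 := neg_le_of_abs_le (hle x u)
      have h3 : g.inner x ((2 : ℝ)⁻¹ • u) ((2 : ℝ)⁻¹ • u) = (2 : ℝ)⁻¹ * ((2 : ℝ)⁻¹ * g.inner x u u) := by
        rw [map_smul, map_smul, smul_apply, smul_eq_mul, smul_eq_mul]
      change g.inner x _ _ < 1
      rw [h3]
      linarith
    · change (2 : ℝ) • (2 : ℝ)⁻¹ • u = u
      rw [smul_smul]
      norm_num
  contMDiff := IsSmoothTensor.add (B := g.inner) g.contMDiff hB

end Forms

/-! ### Domination of a tensor field by a metric -/

section Domination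

variable {n : ℕ} {M : Type*} [TopologicalSpace M] [ChartedSpace (Coord n) M]
  [IsManifold (𝓡 n) ∞ M]

lemma IsSmoothTensor.contDiffOn_coordBil {B : TensorField n M} (hB : IsSmoothTensor B)
    {e : OpenPartialHomeomorph M (Coord n)} (he : e ∈ IsManifold.maximalAtlas (𝓡 n) ∞ M) :
    ContDiffOn ℝ ∞ (fun y => coordBil (tensorMatrix B e y)) e.target :=
  ContDiffOn.sum fun i _ => ContDiffOn.sum fun j _ => (hB.contDiffOn he i j).smul contDiffOn_const

/-- In a chart near q the metric is at least (c/2)‖·‖² and the tensor at most K‖·‖², so the constant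
2K/c works. Compactness makes it global in `IsSmoothTensor.exists_le`. -/
lemma IsSmoothTensor.exists_le_nhds (g : SmoothMetric n M) {B : TensorField n M}
    (hB : IsSmoothTensor B) (q : M) :
    ∃ C : ℝ, ∀ᶠ x in 𝓝 q, ∀ u, |B x u u| ≤ C * g.inner x u u := by
  set e := chartAt (Coord n) q with he_def
  have he : e ∈ IsManifold.maximalAtlas (𝓡 n) ∞ M := IsManifold.chart_mem_maximalAtlas q
  have hq : q ∈ e.source := mem_chart_source _ q
  have hy : e q ∈ e.target := e.map_source hq
  have hG := isMetricOn_metricMatrix g he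
  obtain ⟨c, hc, hle⟩ := exists_pos_mul_norm_sq_le (hG.pos _ hy)
  have cG : ContinuousAt (fun y => coordBil (metricMatrix g e y)) (e q) :=
    hG.smooth_coordBil.continuousOn.continuousAt (e.open_target.mem_nhds hy)
  have cB : ContinuousAt (fun y => coordBil (tensorMatrix B e y)) (e q) :=
    (hB.contDiffOn_coordBil he).continuousOn.continuousAt (e.open_target.mem_nhds hy)
  have h1 : ∀ᶠ y in 𝓝 (e q), ‖coordBil (metricMatrix g e y) - coordBil (metricMatrix g e (e q))‖
      < c / 2 := by
    have h : Filter.Tendsto (fun y => ‖coordBil (metricMatrix g e y)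
        - coordBil (metricMatrix g e (e q))‖) (𝓝 (e q)) (𝓝 0) := by
      have h := cG.tendsto.sub_const (coordBil (metricMatrix g e (e q)))
      rw [sub_self] at h
      simpa using h.norm
    exact h.eventually (gt_mem_nhds (by positivity))
  set K := ‖coordBil (tensorMatrix B e (e q))‖ + 1 with hK
  have h2 : ∀ᶠ y in 𝓝 (e q), ‖coordBil (tensorMatrix B e y)‖ < K :=
    cB.norm.eventually (gt_mem_nhds (by linarith))
  have h3 : ∀ᶠ y in 𝓝 (e q), ∀ u, |B (e.symm y) u u| ≤ 2 * K / c * g.inner (e.symm y) u u := by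
    filter_upwards [h1, h2, e.open_target.mem_nhds hy] with y hy1 hy2 hyt u
    suffices key : ∀ a : Coord n,
        |B (e.symm y) (mfderiv (𝓡 n) (𝓡 n) e.symm y a) (mfderiv (𝓡 n) (𝓡 n) e.symm y a)|
          ≤ 2 * K / c * g.inner (e.symm y) (mfderiv (𝓡 n) (𝓡 n) e.symm y a)
            (mfderiv (𝓡 n) (𝓡 n) e.symm y a) by
      obtain ⟨a, rfl⟩ := (mdifferentiable_of_mem_maximalAtlas he).symm.mfderiv_surjective
        (x := y) hyt u
      exact key a
    intro a
    have e1 : B (e.symm y) (mfderiv (𝓡 n) (𝓡 n) e.symm y a) (mfderiv (𝓡 n) (𝓡 n) e.symm y a)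
      = coordBil (tensorMatrix B e y) a a := (coordBil_tensorMatrix B e y a a).symm
    have e2 : g.inner (e.symm y) (mfderiv (𝓡 n) (𝓡 n) e.symm y a)
        (mfderiv (𝓡 n) (𝓡 n) e.symm y a) = coordBil (metricMatrix g e y) a a :=
      (coordBil_tensorMatrix g.inner e y a a).symm
    have b1 : |coordBil (tensorMatrix B e y) a a| ≤ K * ‖a‖ ^ 2 := by
      have := (coordBil (tensorMatrix B e y)).le_opNorm₂ a a
      rw [Real.norm_eq_abs] at this
      nlinarith [mul_nonneg (norm_nonneg a) (norm_nonneg a)]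
    have b2 : c / 2 * ‖a‖ ^ 2 ≤ coordBil (metricMatrix g e y) a a := by
      have := (coordBil (metricMatrix g e y) - coordBil (metricMatrix g e (e q))).le_opNorm₂ a a
      rw [Real.norm_eq_abs, sub_apply, sub_apply] at this
      have h5 := neg_le_of_abs_le this
      have h6 := hle a
      nlinarith [mul_nonneg (norm_nonneg a) (norm_nonneg a)]
    rw [e1, e2]
    refine b1.trans ?_
    have hK0 : 0 ≤ 2 * K / c := by positivity
    calc K * ‖a‖ ^ 2 = 2 * K / c * (c / 2 * ‖a‖ ^ 2) := by field_simp
      _ ≤ _ := by gcongr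
  refine ⟨2 * K / c, ?_⟩
  have hcont : ContinuousAt e q := e.continuousAt hq
  filter_upwards [hcont.eventually h3, e.open_source.mem_nhds hq] with x hx hxs
  rw [e.left_inv hxs] at hx
  exact hx

lemma IsSmoothTensor.exists_le [CompactSpace M] (g : SmoothMetric n M) {B : TensorField n M}
    (hB : IsSmoothTensor B) : ∃ C : ℝ, ∀ x u, |B x u u| ≤ C * g.inner x u u := by
  have hpos : ∀ x u, 0 ≤ g.inner x u u := by
    intro x u
    by_cases hu : u = 0
    · rw [hu, map_zero]
    · exact (g.pos x u hu).le
  suffices ∃ C : ℝ, ∀ x ∈ (Set.univ : Set M), ∀ u, |B x u u| ≤ C * g.inner x u u by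
    obtain ⟨C, hC⟩ := this
    exact ⟨C, fun x => hC x (Set.mem_univ x)⟩
  refine isCompact_univ.induction_on ⟨0, by simp⟩ ?_ ?_ ?_
  · rintro s t hst ⟨C, hC⟩
    exact ⟨C, fun x hx => hC x (hst hx)⟩
  · rintro s t ⟨C, hC⟩ ⟨D, hD⟩
    refine ⟨max C D, fun x hx u => ?_⟩
    rcases hx with hx | hx
    · exact (hC x hx u).trans (mul_le_mul_of_nonneg_right (le_max_left _ _) (hpos x u))
    · exact (hD x hx u).trans (mul_le_mul_of_nonneg_right (le_max_right _ _) (hpos x u))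
  · intro q _
    obtain ⟨C, hC⟩ := hB.exists_le_nhds g q
    exact ⟨_, mem_nhdsWithin_of_mem_nhds hC, C, fun x hx => hx⟩

end Domination

/-! ### Convergence of small perturbations in the C^k topology -/

section Perturbation

variable {n : ℕ} {M : Type*} [TopologicalSpace M] [ChartedSpace (Coord n) M]
  [IsManifold (𝓡 n) ∞ M]

/-- The topology is an infimum of induced ones, so each seminorm is treated alone. The difference
from g is a finite combination of fixed tensors whose derivatives are bounded on the compact set,
with coefficients tending to 0. -/
lemma tendsto_ckTopology {ι : Type*} [Fintype ι] {g : SmoothMetric n M} {k : ℕ}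
    {b : ι → TensorField n M} (hb : ∀ I, IsSmoothTensor (b I)) {T : (ι → ℝ) → SmoothMetric n M}
    (hT : ∀ᶠ s in 𝓝 0, ∀ x, (T s).inner x = g.inner x + ∑ I, s I • b I x) :
    Filter.Tendsto T (𝓝 0) (@nhds _ (ckTopology n M k) g) := by
  -- Naming the source filter confines the rewriting of neighbourhoods below to the target.
  obtain ⟨l, hl⟩ : ∃ l, l = 𝓝 (0 : ι → ℝ) := ⟨_, rfl⟩
  rw [← hl] at hT ⊢
  simp only [nhds_iInf, nhds_induced, Filter.tendsto_iInf, Filter.tendsto_comap_iff]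
  intro e he i j m hm
  rw [UniformOnFun.tendsto_iff_tendstoUniformlyOn]
  rintro K ⟨hK, hKt⟩
  rw [Metric.tendstoUniformlyOn_iff]
  intro ε hε
  have hsm : ∀ I, ContDiffOn ℝ ∞ (fun y => tensorMatrix (b I) e y i j) e.target := fun I =>
    (hb I).contDiffOn he i j
  have hbd : ∀ I, ∃ C, ∀ y ∈ K,
      ‖iteratedFDeriv ℝ m (fun y => tensorMatrix (b I) e y i j) y‖ ≤ C := by
    intro I
    refine hK.exists_bound_of_continuousOn ?_
    have h := (hsm I).continuousOn_iteratedFDerivWithin (m := m) (by exact ENat.LEInfty.out)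
      e.open_target.uniqueDiffOn
    exact (h.congr fun y hy => (iteratedFDerivWithin_of_isOpen m e.open_target hy).symm).mono hKt
  choose C hC using hbd
  have hlim : ∀ᶠ s : ι → ℝ in l, ∑ I, |s I| * C I < ε := by
    rw [hl]
    have h : Continuous fun s : ι → ℝ => ∑ I, |s I| * C I := by fun_prop
    have h0 := h.tendsto 0
    simp only [Pi.zero_apply, abs_zero, zero_mul, Finset.sum_const_zero] at h0
    exact h0.eventually (gt_mem_nhds hε)
  filter_upwards [hT, hlim] with s hs1 hs2 y hy
  have hyt := hKt hy
  have hcd : ∀ I, ContDiffAt ℝ m (fun y => tensorMatrix (b I) e y i j) y := fun I =>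
    ((hsm I).contDiffAt (e.open_target.mem_nhds hyt)).of_le (by exact ENat.LEInfty.out)
  have hg : ContDiffAt ℝ m (fun y => metricMatrix g e y i j) y :=
    (((isMetricOn_metricMatrix g he).smooth i j).contDiffAt
      (e.open_target.mem_nhds hyt)).of_le (by exact ENat.LEInfty.out)
  have hfun : (fun y => metricMatrix (T s) e y i j)
      = fun y => metricMatrix g e y i j + ∑ I, s I • tensorMatrix (b I) e y i j := by
    ext z
    simp only [metricMatrix, tensorMatrix, Matrix.of_apply, hs1, add_apply, sum_apply, smul_apply]
  have hder : iteratedFDeriv ℝ m (fun y => metricMatrix (T s) e y i j) y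
      = iteratedFDeriv ℝ m (fun y => metricMatrix g e y i j) y
        + ∑ I, s I • iteratedFDeriv ℝ m (fun y => tensorMatrix (b I) e y i j) y := by
    rw [hfun, fun_iteratedFDeriv_add_apply hg
      (ContDiffAt.sum fun I _ => (hcd I).const_smul (s I)),
      iteratedFDeriv_fun_sum_apply fun I _ => (hcd I).const_smul (s I)]
    congr 1
    exact Finset.sum_congr rfl fun I _ => iteratedFDeriv_const_smul_apply' (hcd I)
  change dist (iteratedFDeriv ℝ m (fun y => metricMatrix g e y i j) y)
    (iteratedFDeriv ℝ m (fun y => metricMatrix (T s) e y i j) y) < ε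
  rw [hder, dist_self_add_right]
  refine lt_of_le_of_lt ((norm_sum_le _ _).trans (Finset.sum_le_sum fun I _ => ?_)) hs2
  rw [norm_smul, Real.norm_eq_abs]
  exact mul_le_mul_of_nonneg_left (hC I y hy) (abs_nonneg _)

/-- Small linear combinations of symmetric tensor fields perturb a metric in the `C^k`
topology. -/
lemma exists_perturbation [CompactSpace M] {ι : Type*} [Fintype ι] (g : SmoothMetric n M)
    {b : ι → TensorField n M} (hb : ∀ I, IsSmoothTensor (b I))
    (hsymm : ∀ I x u v, b I x u v = b I x v u) :
    ∃ T : (ι → ℝ) → SmoothMetric n M,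
      ∀ᶠ s in 𝓝 0, ∀ x, (T s).inner x = g.inner x + ∑ I, s I • b I x := by
  classical
  have hsm : ∀ s : ι → ℝ, IsSmoothTensor (fun x => ∑ I, s I • b I x) := fun s =>
    IsSmoothTensor.sum fun I _ => IsSmoothTensor.smul (f := fun _ => s I) contMDiff_const (hb I)
  have hsy : ∀ (s : ι → ℝ) x u v, (∑ I, s I • b I x) u v = (∑ I, s I • b I x) v u := by
    intro s x u v
    simp only [sum_apply, smul_apply, hsymm _ x u v]
  -- The value g is a default for large s; only s near 0 matters.
  refine ⟨fun s => if h : ∀ x u, |(∑ I, s I • b I x) u u| ≤ 1 / 2 * g.inner x u u then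
    perturbMetric g (hsm s) (hsy s) h else g, ?_⟩
  choose C hC using fun I => (hb I).exists_le g
  have hlim : ∀ᶠ s : ι → ℝ in 𝓝 0, ∑ I, |s I| * C I < 1 / 2 := by
    have h : Continuous fun s : ι → ℝ => ∑ I, |s I| * C I := by fun_prop
    have h0 := h.tendsto 0
    simp only [Pi.zero_apply, abs_zero, zero_mul, Finset.sum_const_zero] at h0
    exact h0.eventually (gt_mem_nhds (by norm_num))
  filter_upwards [hlim] with s hs x
  rw [dif_pos]
  · rfl
  · intro x u
    have hpos : 0 ≤ g.inner x u u := by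
      by_cases hu : u = 0
      · rw [hu, map_zero]
      · exact (g.pos x u hu).le
    simp only [sum_apply, smul_apply, smul_eq_mul]
    calc |∑ I, s I * b I x u u| ≤ ∑ I, |s I * b I x u u| := Finset.abs_sum_le_sum_abs _ _
      _ ≤ ∑ I, |s I| * C I * g.inner x u u := Finset.sum_le_sum fun I _ => by
          rw [abs_mul, mul_assoc]
          exact mul_le_mul_of_nonneg_left (hC I x u) (abs_nonneg _)
      _ = (∑ I, |s I| * C I) * g.inner x u u := by rw [Finset.sum_mul]
      _ ≤ _ := mul_le_mul_of_nonneg_right hs.le hpos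

end Perturbation

end CarlemanWeights

end

noncomputable section

namespace CarlemanWeights

set_option maxSynthPendingDepth 6

/-! ### Perturbations that are polynomial near a point -/

section PolyForm

variable {n d : ℕ}

/-- The symmetric bilinear form with polynomial coefficients `s` in the linear coordinates
`lam`. -/
def polyForm (lam : Fin n → Coord n →L[ℝ] ℝ) (s : (Fin (d + 2) → Fin n) → ℝ) (w : Coord n) :
    Coord n →L[ℝ] Coord n →L[ℝ] ℝ :=
  ∑ I, s I • (∏ k : Fin d, lam (I (Fin.castAdd 2 k)) w) •
    ((lam (I (Fin.natAdd d 0))).smulRight (lam (I (Fin.natAdd d 1)))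
      + (lam (I (Fin.natAdd d 1))).smulRight (lam (I (Fin.natAdd d 0))))

lemma contDiff_polyForm (lam : Fin n → Coord n →L[ℝ] ℝ) (s : (Fin (d + 2) → Fin n) → ℝ)
    (y₀ : Coord n) : ContDiff ℝ ∞ fun y => polyForm lam s (y - y₀) := by
  refine ContDiff.sum fun I _ => ContDiff.const_smul _ (ContDiff.fun_smul ?_ contDiff_const)
  refine contDiff_prod fun k _ => ?_
  exact (lam _).contDiff.comp (contDiff_id.sub contDiff_const)

section Manifold

variable {M : Type*} [TopologicalSpace M] [ChartedSpace (Coord n) M] [IsManifold (𝓡 n) ∞ M]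

/-- A globally defined smooth function which is a given linear function of the coordinates near
a point. -/
lemma exists_contMDiff_eventually_eq [T2Space M] (q : M) (lam : Coord n →L[ℝ] ℝ) :
    ∃ f : M → ℝ, ContMDiff (𝓡 n) 𝓘(ℝ, ℝ) ∞ f ∧ ∀ᶠ y in 𝓝 (chartAt (Coord n) q q),
      f ((chartAt (Coord n) q).symm y) = lam (y - chartAt (Coord n) q q) := by
  set e := chartAt (Coord n) q with he_def
  have he : e ∈ IsManifold.maximalAtlas (𝓡 n) ∞ M := IsManifold.chart_mem_maximalAtlas q
  have hq : q ∈ e.source := mem_chart_source _ q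
  obtain ⟨ρ⟩ : Nonempty (SmoothBumpFunction (𝓡 n) q) := inferInstance
  -- The bump function is supported in the chart domain, so the product is smooth on all of M
  -- whatever the chart function is elsewhere.
  refine ⟨fun x => ρ x • lam (e x - e q), ρ.contMDiff_smul ?_, ?_⟩
  · have h1 : ContMDiff (𝓡 n) 𝓘(ℝ, ℝ) ∞ (fun y : Coord n => lam (y - e q)) :=
      (lam.contDiff.comp (contDiff_id.sub contDiff_const)).contMDiff
    exact h1.comp_contMDiffOn (contMDiffOn_of_mem_maximalAtlas he)
  · have hcont : Filter.Tendsto e.symm (𝓝 (e q)) (𝓝 q) := by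
      have := e.symm.continuousAt (x := e q) (e.map_source hq)
      rwa [ContinuousAt, e.left_inv hq] at this
    filter_upwards [hcont.eventually ρ.eventuallyEq_one,
      e.open_target.mem_nhds (e.map_source hq)] with y hy hyt
    rw [hy, Pi.one_apply, one_smul, e.right_inv hyt]

lemma differential_mfderiv_symm {e : OpenPartialHomeomorph M (Coord n)}
    (he : e ∈ IsManifold.maximalAtlas (𝓡 n) ∞ M) {f : M → ℝ}
    (hf : ContMDiff (𝓡 n) 𝓘(ℝ, ℝ) ∞ f) {y : Coord n} (hy : y ∈ e.target) (a : Coord n) :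
    differential f (e.symm y) (mfderiv (𝓡 n) (𝓡 n) e.symm y a)
      = fderiv ℝ (fun z => f (e.symm z)) y a := by
  have h := mfderiv_comp (I := 𝓡 n) (I' := 𝓡 n) (I'' := 𝓘(ℝ, ℝ)) y
    ((hf (e.symm y)).mdifferentiableAt (by simp))
    ((mdifferentiable_of_mem_maximalAtlas he).mdifferentiableAt_symm hy)
  rw [mfderiv_eq_fderiv] at h
  exact (congrFun (congrArg DFunLike.coe h) a).symm

/-- Metrics can be perturbed by arbitrary small polynomials near a point. -/
theorem exists_perturbation_polyForm [T2Space M] [CompactSpace M] (g : SmoothMetric n M) (q : M)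
    (lam : Fin n → Coord n →L[ℝ] ℝ) (k : ℕ) :
    ∃ T : ((Fin (d + 2) → Fin n) → ℝ) → SmoothMetric n M,
      Filter.Tendsto T (𝓝 0) (@nhds _ (ckTopology n M k) g) ∧
      ∀ᶠ s in 𝓝 0, ∀ᶠ y in 𝓝 (chartAt (Coord n) q q),
        metricForm (T s) (chartAt (Coord n) q) y = metricForm g (chartAt (Coord n) q) y
          + polyForm lam s (y - chartAt (Coord n) q q) := by
  choose f hf hfe using fun i => exists_contMDiff_eventually_eq (M := M) q (lam i)
  set e := chartAt (Coord n) q with he_def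
  have he : e ∈ IsManifold.maximalAtlas (𝓡 n) ∞ M := IsManifold.chart_mem_maximalAtlas q
  have hq : q ∈ e.source := mem_chart_source _ q
  -- Global tensors built from the extended coordinate functions and their differentials. Near q
  -- these functions are linear in the chart, so the tensors become the monomials of `polyForm`.
  let b : (Fin (d + 2) → Fin n) → TensorField n M := fun I x =>
    (∏ k : Fin d, f (I (Fin.castAdd 2 k)) x) •
      (differentialMul (f (I (Fin.natAdd d 0))) (f (I (Fin.natAdd d 1))) x
        + differentialMul (f (I (Fin.natAdd d 1))) (f (I (Fin.natAdd d 0))) x)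
  have hb : ∀ I, IsSmoothTensor (b I) := fun I =>
    IsSmoothTensor.smul (contMDiff_finsetProd fun k _ => hf _)
      ((isSmoothTensor_differentialMul (hf _) (hf _)).add
        (isSmoothTensor_differentialMul (hf _) (hf _)))
  have hsymm : ∀ I x u v, b I x u v = b I x v u := by
    intro I x u v
    simp only [b, differentialMul, smul_apply, add_apply, ContinuousLinearMap.smulRight_apply,
      smul_eq_mul]
    ring
  obtain ⟨T, hT⟩ := exists_perturbation g hb hsymm
  refine ⟨T, tendsto_ckTopology hb hT, ?_⟩
  filter_upwards [hT] with s hs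
  filter_upwards [Filter.eventually_all.2 fun i => eventually_eventually_nhds.2 (hfe i),
    e.open_target.mem_nhds (e.map_source hq)] with y hy hyt
  have hd : ∀ i (a : Coord n), differential (f i) (e.symm y) (mfderiv (𝓡 n) (𝓡 n) e.symm y a)
      = lam i a := by
    intro i a
    rw [differential_mfderiv_symm he (hf i) hyt, Filter.EventuallyEq.fderiv_eq (hy i)]
    have : HasFDerivAt (fun z => lam i (z - e q)) (lam i) y :=
      (lam i).hasFDerivAt.comp y ((hasFDerivAt_id y).sub_const (e q))
    rw [this.fderiv]
  ext a c
  rw [add_apply, add_apply]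
  change coordBil (tensorMatrix (T s).inner e y) a c
    = coordBil (tensorMatrix g.inner e y) a c + _
  rw [coordBil_tensorMatrix, coordBil_tensorMatrix, hs, add_apply, add_apply]
  congr 1
  simp only [polyForm, sum_apply, smul_apply, b, differentialMul, add_apply,
    ContinuousLinearMap.smulRight_apply, hd, (hy _).self_of_nhds]

end Manifold

section PolyJets

variable {lam : Fin n → Coord n →L[ℝ] ℝ} {y₀ : Coord n}

lemma hasFDerivAt_sub_const_clm (α : Coord n →L[ℝ] ℝ) (y : Coord n) :
    HasFDerivAt (fun z => α (z - y₀)) α y :=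
  α.hasFDerivAt.comp y ((hasFDerivAt_id y).sub_const y₀)

lemma fderiv_sum_mul {ι : Type*} [Fintype ι] {k : ι → ℝ} {u : ι → Coord n → ℝ} {y : Coord n}
    (hu : ∀ I, DifferentiableAt ℝ (u I) y) (a : Coord n) :
    fderiv ℝ (fun z => ∑ I, k I * u I z) y a = ∑ I, k I * fderiv ℝ (u I) y a := by
  rw [fderiv_fun_sum fun I _ => (hu I).const_mul (k I), sum_apply]
  refine Finset.sum_congr rfl fun I _ => ?_
  rw [fderiv_const_mul (hu I), smul_apply, smul_eq_mul]

lemma fderiv_mul_clm (α β : Coord n →L[ℝ] ℝ) (y a : Coord n) :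
    fderiv ℝ (fun z => α (z - y₀) * β (z - y₀)) y a
      = α a * β (y - y₀) + α (y - y₀) * β a := by
  rw [((hasFDerivAt_sub_const_clm α y).fun_mul (hasFDerivAt_sub_const_clm β y)).fderiv]
  simp only [add_apply, smul_apply, smul_eq_mul]
  ring

lemma fderiv_mul_mul_clm (α β γ : Coord n →L[ℝ] ℝ) (y a : Coord n) :
    fderiv ℝ (fun z => α (z - y₀) * β (z - y₀) * γ (z - y₀)) y a
      = α a * (β (y - y₀) * γ (y - y₀)) + β a * (α (y - y₀) * γ (y - y₀))
        + γ a * (α (y - y₀) * β (y - y₀)) := by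
  rw [(((hasFDerivAt_sub_const_clm α y).fun_mul (hasFDerivAt_sub_const_clm β y)).fun_mul
    (hasFDerivAt_sub_const_clm γ y)).fderiv]
  simp only [add_apply, smul_apply, smul_eq_mul]
  ring

lemma polyForm_two_apply (s : (Fin 4 → Fin n) → ℝ) (w z t : Coord n) :
    polyForm (d := 2) lam s w z t = ∑ I, s I * (lam (I 2) z * lam (I 3) t
      + lam (I 3) z * lam (I 2) t) * (lam (I 0) w * lam (I 1) w) := by
  simp only [polyForm, sum_apply, smul_apply, Fin.prod_univ_two, add_apply, smul_eq_mul,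
    ContinuousLinearMap.smulRight_apply]
  refine Finset.sum_congr rfl fun I _ => ?_
  change s I * (lam (I 0) w * lam (I 1) w * (lam (I 2) z * lam (I 3) t
      + lam (I 3) z * lam (I 2) t)) = _
  ring

lemma polyForm_three_apply (s : (Fin 5 → Fin n) → ℝ) (w z t : Coord n) :
    polyForm (d := 3) lam s w z t = ∑ I, s I * (lam (I 3) z * lam (I 4) t
      + lam (I 4) z * lam (I 3) t) * (lam (I 0) w * lam (I 1) w * lam (I 2) w) := by
  simp only [polyForm, sum_apply, smul_apply, Fin.prod_univ_three, add_apply, smul_eq_mul,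
    ContinuousLinearMap.smulRight_apply]
  refine Finset.sum_congr rfl fun I _ => ?_
  change s I * (lam (I 0) w * lam (I 1) w * lam (I 2) w * (lam (I 3) z * lam (I 4) t
      + lam (I 4) z * lam (I 3) t)) = _
  ring

lemma fderiv_polyForm_two_apply (s : (Fin 4 → Fin n) → ℝ) (y a z t : Coord n) :
    fderiv ℝ (fun w => polyForm (d := 2) lam s (w - y₀) z t) y a
      = ∑ I, s I * (lam (I 2) z * lam (I 3) t + lam (I 3) z * lam (I 2) t)
        * (lam (I 0) a * lam (I 1) (y - y₀) + lam (I 0) (y - y₀) * lam (I 1) a) := by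
  simp only [polyForm_two_apply]
  rw [fderiv_sum_mul fun I => by fun_prop]
  simp only [fderiv_mul_clm]

lemma fderiv_fderiv_polyForm_two_apply (s : (Fin 4 → Fin n) → ℝ) (y c a z t : Coord n) :
    fderiv ℝ (fun w' => fderiv ℝ (fun w => polyForm (d := 2) lam s (w - y₀) z t) w' a) y c
      = ∑ I, s I * (lam (I 2) z * lam (I 3) t + lam (I 3) z * lam (I 2) t)
        * (lam (I 0) a * lam (I 1) c + lam (I 0) c * lam (I 1) a) := by
  simp only [fderiv_polyForm_two_apply]
  rw [fderiv_sum_mul fun I => by fun_prop]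
  refine Finset.sum_congr rfl fun I _ => ?_
  rw [(((hasFDerivAt_sub_const_clm (y₀ := y₀) (lam (I 1)) y).const_mul (lam (I 0) a)).fun_add
    ((hasFDerivAt_sub_const_clm (y₀ := y₀) (lam (I 0)) y).mul_const (lam (I 1) a))).fderiv]
  simp only [add_apply, smul_apply, smul_eq_mul]
  ring

lemma fderiv_polyForm_three_apply (s : (Fin 5 → Fin n) → ℝ) (y a z t : Coord n) :
    fderiv ℝ (fun w => polyForm (d := 3) lam s (w - y₀) z t) y a
      = ∑ I, s I * (lam (I 3) z * lam (I 4) t + lam (I 4) z * lam (I 3) t)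
        * (lam (I 0) a * (lam (I 1) (y - y₀) * lam (I 2) (y - y₀))
          + lam (I 1) a * (lam (I 0) (y - y₀) * lam (I 2) (y - y₀))
          + lam (I 2) a * (lam (I 0) (y - y₀) * lam (I 1) (y - y₀))) := by
  simp only [polyForm_three_apply]
  rw [fderiv_sum_mul fun I => by fun_prop]
  simp only [fderiv_mul_mul_clm]

lemma fderiv_fderiv_polyForm_three_apply (s : (Fin 5 → Fin n) → ℝ) (y c a z t : Coord n) :
    fderiv ℝ (fun w' => fderiv ℝ (fun w => polyForm (d := 3) lam s (w - y₀) z t) w' a) y c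
      = ∑ I, s I * (lam (I 3) z * lam (I 4) t + lam (I 4) z * lam (I 3) t)
        * (lam (I 0) a * (lam (I 1) c * lam (I 2) (y - y₀) + lam (I 1) (y - y₀) * lam (I 2) c)
          + lam (I 1) a * (lam (I 0) c * lam (I 2) (y - y₀) + lam (I 0) (y - y₀) * lam (I 2) c)
          + lam (I 2) a * (lam (I 0) c * lam (I 1) (y - y₀)
            + lam (I 0) (y - y₀) * lam (I 1) c)) := by
  simp only [fderiv_polyForm_three_apply]
  rw [fderiv_sum_mul fun I => by fun_prop]
  refine Finset.sum_congr rfl fun I _ => ?_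
  rw [fderiv_fun_add (by fun_prop) (by fun_prop), fderiv_fun_add (by fun_prop) (by fun_prop),
    fderiv_const_mul (by fun_prop), fderiv_const_mul (by fun_prop), fderiv_const_mul (by fun_prop)]
  simp only [add_apply, smul_apply, smul_eq_mul, fderiv_mul_clm]

lemma fderiv_fderiv_fderiv_polyForm_three_apply (s : (Fin 5 → Fin n) → ℝ)
    (y c' c a z t : Coord n) :
    fderiv ℝ (fun w'' => fderiv ℝ (fun w' =>
        fderiv ℝ (fun w => polyForm (d := 3) lam s (w - y₀) z t) w' a) w'' c) y c'
      = ∑ I, s I * (lam (I 3) z * lam (I 4) t + lam (I 4) z * lam (I 3) t)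
        * (lam (I 0) a * (lam (I 1) c * lam (I 2) c' + lam (I 1) c' * lam (I 2) c)
          + lam (I 1) a * (lam (I 0) c * lam (I 2) c' + lam (I 0) c' * lam (I 2) c)
          + lam (I 2) a * (lam (I 0) c * lam (I 1) c' + lam (I 0) c' * lam (I 1) c)) := by
  simp only [fderiv_fderiv_polyForm_three_apply]
  rw [fderiv_sum_mul fun I => by fun_prop]
  refine Finset.sum_congr rfl fun I _ => ?_
  have h : ∀ (α β : Coord n →L[ℝ] ℝ) (p r : ℝ),
      HasFDerivAt (fun z => p * β (z - y₀) + α (z - y₀) * r) (p • β + r • α) y := fun α β p r =>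
    ((hasFDerivAt_sub_const_clm β y).const_mul p).fun_add
      ((hasFDerivAt_sub_const_clm α y).mul_const r)
  rw [((((h (lam (I 1)) (lam (I 2)) (lam (I 1) c) (lam (I 2) c)).const_mul (lam (I 0) a)).fun_add
    ((h (lam (I 0)) (lam (I 2)) (lam (I 0) c) (lam (I 2) c)).const_mul (lam (I 1) a))).fun_add
    ((h (lam (I 0)) (lam (I 1)) (lam (I 0) c) (lam (I 1) c)).const_mul (lam (I 2) a))).fderiv]
  simp only [add_apply, smul_apply, smul_eq_mul]
  ring

end PolyJets

end PolyForm

end CarlemanWeights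

end

noncomputable section

namespace CarlemanWeights

set_option maxSynthPendingDepth 6

/-! ### Passing between orthonormal frames -/

section FrameChange

open Matrix

variable {E : Type*} [NormedAddCommGroup E] [NormedSpace ℝ E] {n : ℕ}

lemma exists_frameMul_eq [FiniteDimensional ℝ E] {B : E →L[ℝ] E →L[ℝ] ℝ} {F F₀ : Fin n → E}
    (hF : IsOrthoFrame B F) (hF₀ : IsOrthoFrame B F₀) (hn : Module.finrank ℝ E = n) :
    ∃ Q : Matrix (Fin n) (Fin n) ℝ, Q * Qᵀ = 1 ∧ frameMul Q F₀ = F := by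
  have hmul : frameMul (Matrix.of fun i j => B (F i) (F₀ j)) F₀ = F :=
    funext fun i => hF₀.sum_smul hn (F i)
  refine ⟨Matrix.of fun i j => B (F i) (F₀ j), ?_, hmul⟩
  ext i k
  rw [Matrix.mul_apply, Matrix.one_apply, ← hF i k]
  conv_rhs => rw [← hF₀.sum_smul hn (F k)]
  simp only [map_sum, map_smul, smul_eq_mul, transpose_apply, of_apply]
  exact Finset.sum_congr rfl fun j _ => mul_comm _ _

lemma apply_frameMul {B : E →L[ℝ] E →L[ℝ] ℝ} {F₀ : Fin n → E}
    (hF₀ : IsOrthoFrame B F₀) (Q : Matrix (Fin n) (Fin n) ℝ) (i k : Fin n) :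
    B (F₀ k) (frameMul Q F₀ i) = Q i k := by
  simp [frameMul, hF₀ _ _]

end FrameChange

section SumJets

variable {E F : Type*} [NormedAddCommGroup E] [NormedSpace ℝ E] [NormedAddCommGroup F]
  [NormedSpace ℝ F]

lemma eventuallyEq_fderiv_add {Ω : Set E} (hΩ : IsOpen Ω) {x : E} (hx : x ∈ Ω) {u v w : E → F}
    (hv : ContDiffOn ℝ ∞ v Ω) (hw : ContDiff ℝ ∞ w) (h : u =ᶠ[𝓝 x] fun y => v y + w y) :
    fderiv ℝ u =ᶠ[𝓝 x] fun y => fderiv ℝ v y + fderiv ℝ w y := by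
  filter_upwards [h.fderiv (𝕜 := ℝ), hΩ.mem_nhds hx] with y hy hyΩ
  rw [hy, fderiv_fun_add (hv.differentiableAt_of_mem hΩ hyΩ) (hw.differentiable (by simp) y)]

lemma contDiff_fderiv_infty {w : E → F} (hw : ContDiff ℝ ∞ w) : ContDiff ℝ ∞ (fderiv ℝ w) :=
  hw.fderiv_right (by simp)

end SumJets

/-! ### The jet of a cubic perturbation at its centre -/

section PolyJetsAtOrigin

variable {n : ℕ} (lam : Fin n → Coord n →L[ℝ] ℝ) (s : (Fin 5 → Fin n) → ℝ) (y₀ : Coord n)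

lemma fderiv_polyForm_three_self :
    fderiv ℝ (fun y => polyForm (d := 3) lam s (y - y₀)) y₀ = 0 := by
  ext a z t
  rw [fderiv_apply₂ isOpen_univ (contDiff_polyForm lam s y₀).contDiffOn (Set.mem_univ _),
    fderiv_polyForm_three_apply]
  simp

lemma fderiv_fderiv_polyForm_three_self :
    fderiv ℝ (fderiv ℝ (fun y => polyForm (d := 3) lam s (y - y₀))) y₀ = 0 := by
  ext c a z t
  rw [fderiv_fderiv_apply₂ isOpen_univ (contDiff_polyForm lam s y₀).contDiffOn (Set.mem_univ _),
    fderiv_fderiv_polyForm_three_apply]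
  simp

lemma fderiv_fderiv_fderiv_polyForm_three_frameMul {B : Coord n →L[ℝ] Coord n →L[ℝ] ℝ}
    {F₀ : Fin n → Coord n} (hF₀ : IsOrthoFrame B F₀) (Q : Matrix (Fin n) (Fin n) ℝ)
    (y c a z t : Fin n) :
    fderiv ℝ (fderiv ℝ (fderiv ℝ fun y => polyForm (d := 3) (fun i => B (F₀ i)) s (y - y₀))) y₀
      (frameMul Q F₀ y) (frameMul Q F₀ c) (frameMul Q F₀ a) (frameMul Q F₀ z) (frameMul Q F₀ t)
      = thirdJet (frameAct Q s) y c a z t := by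
  rw [fderiv_fderiv_fderiv_apply₂ isOpen_univ (contDiff_polyForm _ s y₀).contDiffOn
    (Set.mem_univ _), fderiv_fderiv_fderiv_polyForm_three_apply]
  simp only [apply_frameMul hF₀, thirdJet, frameAct_apply, Fin.prod_univ_five,
    ← Finset.sum_add_distrib]
  refine Finset.sum_congr rfl fun I _ => ?_
  simp only [Matrix.cons_val_zero, Matrix.cons_val_one, Matrix.cons_val]
  ring

end PolyJetsAtOrigin

/-! ### Effect of a polynomial perturbation on the obstructions -/

section Obstructions

variable {M : Type*} [TopologicalSpace M]

/-- The obstruction in dimension at least four, for a metric at a point of a chart. -/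
def weylAt {m : ℕ} [ChartedSpace (Coord (m + 4)) M] [IsManifold (𝓡 (m + 4)) ∞ M]
    (e : OpenPartialHomeomorph M (Coord (m + 4))) (y : Coord (m + 4)) (g : SmoothMetric (m + 4) M)
    (F : Fin (m + 4) → Coord (m + 4)) : ℝ :=
  weylObstruction (fderiv ℝ (metricForm g e) y) (fderiv ℝ (fderiv ℝ (metricForm g e)) y) F

/-- The obstruction in dimension three, for a metric at a point of a chart. -/
def cottonAt [ChartedSpace (Coord 3) M] [IsManifold (𝓡 3) ∞ M]
    (e : OpenPartialHomeomorph M (Coord 3)) (y : Coord 3) (g : SmoothMetric 3 M)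
    (F : Fin 3 → Coord 3) : ℝ :=
  cottonObstruction (fderiv ℝ (metricForm g e) y) (fderiv ℝ (fderiv ℝ (metricForm g e)) y)
    (fderiv ℝ (fderiv ℝ (fderiv ℝ (metricForm g e))) y) F

/-- The linear coordinates are the coframe dual to F₀ and take the value Q i k on the rotated frame.
The coefficients thus transform by `frameAct`. A quadratic form leaves the 1-jet alone, and the
obstruction is affine in the second derivatives. -/
lemma weylAt_perturbation {m : ℕ} [ChartedSpace (Coord (m + 4)) M] [IsManifold (𝓡 (m + 4)) ∞ M]
    {e : OpenPartialHomeomorph M (Coord (m + 4))}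
    (he : e ∈ IsManifold.maximalAtlas (𝓡 (m + 4)) ∞ M) {y₀ : Coord (m + 4)} (hy₀ : y₀ ∈ e.target)
    {g g' : SmoothMetric (m + 4) M} {F₀ : Fin (m + 4) → Coord (m + 4)}
    (hF₀ : IsOrthoFrame (metricForm g e y₀) F₀) {s : (Fin 4 → Fin (m + 4)) → ℝ}
    (h : ∀ᶠ y in 𝓝 y₀, metricForm g' e y = metricForm g e y
      + polyForm (d := 2) (fun i => metricForm g e y₀ (F₀ i)) s (y - y₀)) :
    metricForm g' e y₀ = metricForm g e y₀ ∧ ∀ Q : Matrix (Fin (m + 4)) (Fin (m + 4)) ℝ,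
      weylAt e y₀ g' (frameMul Q F₀)
        = weylAt e y₀ g (frameMul Q F₀) + weylFunctional m (frameAct Q s) := by
  set lam : Fin (m + 4) → Coord (m + 4) →L[ℝ] ℝ := fun i => metricForm g e y₀ (F₀ i) with hlam
  have hp : ContDiff ℝ ∞ fun y => polyForm (d := 2) lam s (y - y₀) := contDiff_polyForm lam s y₀
  have hg := contDiffOn_metricForm he g
  have h1 := eventuallyEq_fderiv_add e.open_target hy₀ hg hp h
  have h2 := eventuallyEq_fderiv_add e.open_target hy₀ (hg.fderiv_infty e.open_target)
    (contDiff_fderiv_infty hp) h1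
  have p0 : polyForm (d := 2) lam s (y₀ - y₀) = 0 := by
    ext z t
    simp [polyForm_two_apply]
  have p1 : fderiv ℝ (fun y => polyForm (d := 2) lam s (y - y₀)) y₀ = 0 := by
    ext a z t
    rw [fderiv_apply₂ isOpen_univ hp.contDiffOn (Set.mem_univ _), fderiv_polyForm_two_apply]
    simp
  refine ⟨by rw [h.self_of_nhds, p0, add_zero], fun Q => ?_⟩
  rw [weylAt, h1.self_of_nhds, h2.self_of_nhds]
  beta_reduce
  rw [p1, add_zero]
  refine weylObstruction_add fun c a z t => ?_
  rw [fderiv_fderiv_apply₂ isOpen_univ hp.contDiffOn (Set.mem_univ _),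
    fderiv_fderiv_polyForm_two_apply]
  simp only [hlam, apply_frameMul hF₀, secondJet, frameAct_apply, Fin.prod_univ_four,
    ← Finset.sum_add_distrib]
  refine Finset.sum_congr rfl fun I _ => ?_
  simp only [Matrix.cons_val_zero, Matrix.cons_val_one, Matrix.cons_val]
  ring

set_option maxHeartbeats 1000000 in
-- As in the quadratic case, one order higher: a cubic perturbation leaves the 2-jet unchanged, and
-- the obstruction is affine in the third derivatives once the 2-jet is fixed.
lemma cottonAt_perturbation [ChartedSpace (Coord 3) M] [IsManifold (𝓡 3) ∞ M]
    {e : OpenPartialHomeomorph M (Coord 3)}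
    (he : e ∈ IsManifold.maximalAtlas (𝓡 3) ∞ M) {y₀ : Coord 3} (hy₀ : y₀ ∈ e.target)
    {g g' : SmoothMetric 3 M} {F₀ : Fin 3 → Coord 3}
    (hF₀ : IsOrthoFrame (metricForm g e y₀) F₀) {s : (Fin 5 → Fin 3) → ℝ}
    (h : ∀ᶠ y in 𝓝 y₀, metricForm g' e y = metricForm g e y
      + polyForm (d := 3) (fun i => metricForm g e y₀ (F₀ i)) s (y - y₀)) :
    metricForm g' e y₀ = metricForm g e y₀ ∧ ∀ Q : Matrix (Fin 3) (Fin 3) ℝ,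
      cottonAt e y₀ g' (frameMul Q F₀)
        = cottonAt e y₀ g (frameMul Q F₀) + cottonFunctional (frameAct Q s) := by
  set lam : Fin 3 → Coord 3 →L[ℝ] ℝ := fun i => metricForm g e y₀ (F₀ i) with hlam
  have hp : ContDiff ℝ ∞ fun y => polyForm (d := 3) lam s (y - y₀) := contDiff_polyForm lam s y₀
  have hp1 := contDiff_fderiv_infty hp
  have hg := contDiffOn_metricForm he g
  have hg1 := hg.fderiv_infty e.open_target
  have h1 := eventuallyEq_fderiv_add e.open_target hy₀ hg hp h
  have h2 := eventuallyEq_fderiv_add e.open_target hy₀ hg1 hp1 h1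
  have h3 := eventuallyEq_fderiv_add e.open_target hy₀ (hg1.fderiv_infty e.open_target)
    (contDiff_fderiv_infty hp1) h2
  have p0 : polyForm (d := 3) lam s (y₀ - y₀) = 0 := by
    ext z t
    simp [polyForm_three_apply]
  refine ⟨by rw [h.self_of_nhds, p0, add_zero], fun Q => ?_⟩
  rw [cottonAt, h1.self_of_nhds, h2.self_of_nhds, h3.self_of_nhds]
  beta_reduce
  rw [fderiv_polyForm_three_self, fderiv_fderiv_polyForm_three_self, add_zero, add_zero]
  exact cottonObstruction_add
    (fderiv_fderiv_fderiv_polyForm_three_frameMul s y₀ hF₀ Q)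

end Obstructions

/-! ### Openness and density from an abstract obstruction -/

section Generic

open Matrix

variable {n r k : ℕ} {M : Type*} [TopologicalSpace M] [ChartedSpace (Coord n) M]
  [IsManifold (𝓡 n) ∞ M] {e : OpenPartialHomeomorph M (Coord n)} {y₀ : Coord n}

/-- Metrics without degenerate frame are dense, as soon as the obstruction can be perturbed in
sufficiently many independent ways. -/
theorem dense_not_hasDegenerateFrame (he : e ∈ IsManifold.maximalAtlas (𝓡 n) ∞ M)
    (hy₀ : y₀ ∈ e.target) (i₀ : Fin n) {f : SmoothMetric n M → (Fin n → Coord n) → ℝ}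
    (hf : ∀ g, ContDiff ℝ 1 (f g)) {ℓ : ((Fin r → Fin n) → ℝ) →ₗ[ℝ] ℝ}
    (hℓ : ∃ P : Fin n → Matrix (Fin n) (Fin n) ℝ, (∀ p, P p * (P p)ᵀ = 1) ∧
      (∀ p j, j ≠ i₀ → P p i₀ j = 0) ∧ LinearIndependent ℝ fun p => ℓ ∘ₗ frameAct (P p))
    (hT : ∀ (g : SmoothMetric n M) (F₀ : Fin n → Coord n), IsOrthoFrame (metricForm g e y₀) F₀ →
      ∃ T : ((Fin r → Fin n) → ℝ) → SmoothMetric n M,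
        Filter.Tendsto T (𝓝 0) (@nhds _ (ckTopology n M k) g) ∧
        ∀ᶠ s in 𝓝 0, metricForm (T s) e y₀ = metricForm g e y₀ ∧
          ∀ Q : Matrix (Fin n) (Fin n) ℝ,
            f (T s) (frameMul Q F₀) = f g (frameMul Q F₀) + ℓ (frameAct Q s)) :
    @Dense _ (ckTopology n M k) {g | ¬ HasDegenerateFrame (metricForm g e y₀) (f g) i₀} := by
  let := ckTopology n M k
  intro g
  have hm := isMetricOn_metricMatrix g he
  have hn : Module.finrank ℝ (Coord n) = n := finrank_euclideanSpace_fin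
  obtain ⟨F₀, hF₀⟩ : ∃ F₀, IsOrthoFrame (metricForm g e y₀) F₀ :=
    exists_isOrthoFrame (coordBil_symm (hm.symm y₀ hy₀)) (hm.pos y₀ hy₀) hn
  obtain ⟨T, hTg, hTs⟩ := hT g F₀ hF₀
  obtain ⟨P, hP, hP₀, hli⟩ := hℓ
  -- The dimension count needs a C¹ function on all matrices, so the obstruction of g is evaluated
  -- on arbitrary multiples of F₀, orthonormal or not.
  have hc : ContDiff ℝ 1 fun Q : Fin n → Fin n → ℝ => f g (frameMul (Matrix.of Q) F₀) := by
    refine (hf g).comp (contDiff_pi.2 fun i => ContDiff.sum fun j _ => ?_)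
    exact ContDiff.fun_smul ((contDiff_apply ℝ ℝ j).comp (contDiff_apply ℝ (Fin n → ℝ) i))
      contDiff_const
  have hD := dense_setOf_frame_ne_zero i₀ _ hc ℓ P hP hP₀ hli
  -- Good tensors accumulate at 0, and the metrics `T s` tend to g. The metric at the point does not
  -- change, so its orthonormal frames are still the Q F₀ with Q orthogonal.
  refine mem_closure_of_frequently_of_tendsto
    ((mem_closure_iff_frequently.1 (hD 0)).and_eventually hTs |>.mono ?_) hTg
  rintro s ⟨hs, hs0, hsQ⟩ ⟨F, hF, hFP⟩
  rw [hs0] at hF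
  obtain ⟨Q, hQ, rfl⟩ := exists_frameMul_eq hF hF₀ hn
  obtain ⟨R, hR, hR₀, hne⟩ := hs Q hQ
  apply hne
  have h := hFP R hR hR₀
  rwa [← frameMul_mul, hsQ] at h

/-- The metrics without degenerate frame form an open set without limiting Carleman weights. -/
theorem exists_isOpen_dense {U : Set M} (hU : IsOpen U)
    (he : e ∈ IsManifold.maximalAtlas (𝓡 n) ∞ M) (hy₀ : y₀ ∈ e.target) (hy₀U : e.symm y₀ ∈ U)
    (i₀ : Fin n) {f : SmoothMetric n M → (Fin n → Coord n) → ℝ}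
    (hf : Continuous[@instTopologicalSpaceProd _ _ (ckTopology n M k) _, inferInstance]
      fun p : SmoothMetric n M × (Fin n → Coord n) => f p.1 p.2)
    (hdense : @Dense _ (ckTopology n M k)
      {g | ¬ HasDegenerateFrame (metricForm g e y₀) (f g) i₀})
    (hfV : ∀ g (Ω : Set (Coord n)) V A μ, y₀ ∈ Ω →
      IsCarlemanField Ω (metricForm g e) (coordGamma (metricMatrix g e)) V A μ →
      ∀ F, IsOrthoFrame (metricForm g e y₀) F → ∀ t : ℝ, F i₀ = t • V y₀ → t ≠ 0 → f g F = 0) :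
    ∃ O : Set (SmoothMetric n M), IsOpen[ckTopology n M k] O ∧ @Dense _ (ckTopology n M k) O ∧
      ∀ g ∈ O, ¬ ∃ φ : M → ℝ, IsLimitingCarlemanWeight g U φ := by
  let := ckTopology n M k
  refine ⟨_, ?_, hdense, ?_⟩
  · exact isOpen_not_hasDegenerateFrame (continuous_metricForm he hy₀)
      (fun g => (isMetricOn_metricMatrix g he).pos y₀ hy₀) hf i₀
  · rintro g hg ⟨φ, hφ⟩
    obtain ⟨V, A, μ, hV, hV0⟩ := hφ.exists_isCarlemanField hU he
    have hmem : y₀ ∈ e.target ∩ e.symm ⁻¹' U := ⟨hy₀, hy₀U⟩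
    exact hg ((isMetricOn_metricMatrix g he).hasDegenerateFrame hy₀ (hV0 y₀ hmem)
      (hfV g _ V A μ hmem hV))

end Generic

/-! ### The two ranges of dimension -/

section Main

variable {M : Type*} [TopologicalSpace M] [T2Space M] [CompactSpace M]

theorem exists_isOpen_dense_of_four_le (m : ℕ) [ChartedSpace (Coord (m + 4)) M]
    [IsManifold (𝓡 (m + 4)) ∞ M] {U : Set M} (hU : IsOpen U) (hne : U.Nonempty) :
    ∃ O : Set (SmoothMetric (m + 4) M), IsOpen[ckTopology (m + 4) M 2] O ∧
      @Dense _ (ckTopology (m + 4) M 2) O ∧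
      ∀ g ∈ O, ¬ ∃ φ : M → ℝ, IsLimitingCarlemanWeight g U φ := by
  obtain ⟨q, hq⟩ := hne
  set e := chartAt (Coord (m + 4)) q with he_def
  have he : e ∈ IsManifold.maximalAtlas (𝓡 (m + 4)) ∞ M := IsManifold.chart_mem_maximalAtlas q
  have hqs : q ∈ e.source := mem_chart_source _ q
  have hy₀ : e q ∈ e.target := e.map_source hqs
  refine exists_isOpen_dense (f := weylAt e (e q)) (i₀ := 0) hU he hy₀
    (by rwa [e.left_inv hqs]) ?_ ?_ ?_
  · let := ckTopology (m + 4) M 2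
    exact continuous_weylObstruction
      ((continuous_fderiv_metricForm he hy₀ (by norm_num)).comp continuous_fst)
      ((continuous_fderiv_fderiv_metricForm he hy₀ le_rfl).comp continuous_fst) continuous_snd
  · refine dense_not_hasDegenerateFrame he hy₀ 0 (fun g => ?_)
      (exists_linearIndependent_weylFunctional m) fun g F₀ hF₀ => ?_
    · exact contDiff_weylObstruction _ _
    · obtain ⟨T, h1, h2⟩ := exists_perturbation_polyForm (d := 2) g q
        (fun i => metricForm g e (e q) (F₀ i)) 2
      exact ⟨T, h1, h2.mono fun s hs => weylAt_perturbation he hy₀ hF₀ hs⟩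
  · intro g Ω V A μ hmem hV F hF t hFt ht
    exact hV.weylObstruction_eq_zero hmem hF finrank_euclideanSpace_fin hFt ht

theorem exists_isOpen_dense_of_eq_three [ChartedSpace (Coord 3) M]
    [IsManifold (𝓡 3) ∞ M] {U : Set M} (hU : IsOpen U) (hne : U.Nonempty) :
    ∃ O : Set (SmoothMetric 3 M), IsOpen[ckTopology 3 M 3] O ∧
      @Dense _ (ckTopology 3 M 3) O ∧
      ∀ g ∈ O, ¬ ∃ φ : M → ℝ, IsLimitingCarlemanWeight g U φ := by
  obtain ⟨q, hq⟩ := hne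
  set e := chartAt (Coord 3) q with he_def
  have he : e ∈ IsManifold.maximalAtlas (𝓡 3) ∞ M := IsManifold.chart_mem_maximalAtlas q
  have hqs : q ∈ e.source := mem_chart_source _ q
  have hy₀ : e q ∈ e.target := e.map_source hqs
  refine exists_isOpen_dense (f := cottonAt e (e q)) (i₀ := 0) hU he hy₀
    (by rwa [e.left_inv hqs]) ?_ ?_ ?_
  · let := ckTopology 3 M 3
    exact continuous_cottonObstruction
      ((continuous_fderiv_metricForm he hy₀ (by norm_num)).comp continuous_fst)
      ((continuous_fderiv_fderiv_metricForm he hy₀ (by norm_num)).comp continuous_fst)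
      ((continuous_fderiv_fderiv_fderiv_metricForm he hy₀ le_rfl).comp continuous_fst)
      continuous_snd
  · refine dense_not_hasDegenerateFrame he hy₀ 0 (fun g => ?_)
      exists_linearIndependent_cottonFunctional fun g F₀ hF₀ => ?_
    · exact contDiff_cottonObstruction _ _ _
    · obtain ⟨T, h1, h2⟩ := exists_perturbation_polyForm (d := 3) g q
        (fun i => metricForm g e (e q) (F₀ i)) 3
      rw [← he_def] at h2
      exact ⟨T, h1, h2.mono fun s hs => cottonAt_perturbation he hy₀ hF₀ hs⟩
  · intro g Ω V A μ hmem hV F hF t hFt ht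
    exact hV.cottonObstruction_eq_zero hmem hF finrank_euclideanSpace_fin hFt ht

end Main

end CarlemanWeights

end

theorem theorem1p8 (n : ℕ) (hn : 3 ≤ n) (M : Type*) [TopologicalSpace M] [T2Space M]
    [CompactSpace M] [ChartedSpace (EuclideanSpace ℝ (Fin n)) M] [IsManifold (𝓡 n) ∞ M]
    (U : Set M) (hU : IsOpen U) (hne : U.Nonempty) :
    ∃ O : Set (CarlemanWeights.SmoothMetric n M),
      IsOpen[CarlemanWeights.ckTopology n M (if n = 3 then 3 else 2)] O ∧
      @Dense _ (CarlemanWeights.ckTopology n M (if n = 3 then 3 else 2)) O ∧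
      ∀ g ∈ O, ¬ ∃ φ : M → ℝ, CarlemanWeights.IsLimitingCarlemanWeight g U φ := by
  by_cases h3 : n = 3
  · subst h3
    exact CarlemanWeights.exists_isOpen_dense_of_eq_three hU hne
  · obtain ⟨m, rfl⟩ : ∃ m, n = m + 4 := ⟨n - 4, by omega⟩
    rw [if_neg h3]
    exact CarlemanWeights.exists_isOpen_dense_of_four_le m hU hne
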